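/- Let $K$ be a field of characteristic $0$, let $\Xi$ be a set of colours, let $\mathcal O$ be a $\Xi$-coloured operad in cochain complexes over $K$ and let $\mathcal H:=H^\bullet(\mathcal O)$ be its cohomology operad, regarded as a dg operad with zero differential. Let $P$ be a $\Xi$-coloured dg pseudo-cooperad (a collection of cochain complexes with compatible comultiplications $\Delta_{\mathbf t}$ for all coloured trees $\mathbf t$), with differential $\partial_P$. Let $\mathrm{Cobar}(P^\diamondsuit)$ be its cobar construction, i.e. the free operad $\mathbb{OP}(\mathbf sP)$ generated by the suspension $\mathbf sP$ (where $|\mathbf sX|=|X|+1$), with the differential $\partial$ determined by $$\partial(\mathbf sX)=-\mathbf s\,\partial_PX-\sum_{\mathbf t}\sum(-1)^{|X'|}\,\mathbf sX'\circ_{\mathbf t}\mathbf sX'',\qquad \Delta_{\mathbf t}X=\sum X'\otimes X'',$$ where $\mathbf t$ runs over the isomorphism classes of labelled trees with two nodal vertices. Let $\rho:\mathrm{Cobar}(P^\diamondsuit)\to\mathcal H$ be a quasi-isomorphism of dg operads. Assume: (C1) $P=\bigoplus_{k\ge1}\mathcal G^kP$ (as a collection of graded vector spaces, and $\mathcal G^{\le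 0}P=0$) with $\partial_P(\mathcal G^kP)\subset\mathcal G^{k-1}P$ and $\Delta_{\mathbf t}(\mathcal G^mP)\subset\bigoplus_{r_1+\dots+r_q=m}\mathcal G^{r_1}P\otimes\dots\otimes\mathcal G^{r_q}P$ for every tree $\mathbf t$ with $q$ nodal vertices; (C2) the graded components of $\mathcal G^kP(\mathbf q)$ and of $\mathcal O(\mathbf q)$ are finite dimensional for every $k$ and every corolla $\mathbf q$; (C3) the operad $\mathcal H$ is generated by $\rho(\mathbf s\,\mathcal G^1P)$, and $\rho|_{\mathbf s\,\mathcal G^kP}=0$ for all $k\ge2$. For homomorphisms of collections $f,g$ from $P$ to a graded operad put $(f\bullet g)(X)=\sum_{\mathbf t}\sum(-1)^{|g||X'|}f(X')\circ_{\mathbf t}g(X'')$ (the sum again over isomorphism classes of labelled trees with two nodal vertices) and $[f,g]=f\bullet g-(-1)^{|f||g|}g\bullet f$. Let $\alpha_{\mathcal H}:=\rho\circ\mathbf s:P\to\mathcal H$, an element of degree $1$. For $w\in\mathbb Z$ let $\mathrm{Cobar}(P^\diamondsuit)^{(w)}$ be the span of the operadic monomials in $\mathbf sX_1,\mathbf sX_2,\dots$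 with $X_i\in\mathcal G^{k_i}P$ and $\sum_i(k_i-1)=w$. Let $m\ge2$ and let $\psi:P\to\mathcal H$ be a homomorphism of collections of degree $1$ that vanishes on $\mathcal G^kP$ for all $k\ne m$ (that is, $\psi\in\mathrm{Hom}(\mathcal G^mP,\mathcal H)$) and satisfies $$\psi\circ\partial_P+[\alpha_{\mathcal H},\psi]=0.$$ Then there is a derivation $\mathcal D$ of degree $0$ of the operad $\mathrm{Cobar}(P^\diamondsuit)$ such that (1) $\partial\circ\mathcal D=\mathcal D\circ\partial$; (2) $\mathcal D(\mathbf s\,\mathcal G^kP)\subset\mathrm{Cobar}(P^\diamondsuit)^{((k-1)+(1-m))}$ for all $k\ge1$; (3) $\rho(\mathcal D(\mathbf sX))=\psi(X)$ for all $X\in P$; (4) $\mathcal D(\mathbf sX)=0$ for all $X\in\mathcal G^kP$ with $k<m$. -/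

import Mathlib

open scoped TensorProduct DirectSum

noncomputable section

universe uK uC u u'

namespace Opd

/-! ### Coloured corollas and labelled trees with two nodal vertices -/

/-- A corolla with `arity` labelled incoming edges, coloured by `color`, and an outgoing edge
of colour `out`.  All orderings of the incoming colours are allowed; the groupoid of corollas and
colour preserving relabellings is equivalent to its full subgroupoid of corollas with the standard
labelling, whose automorphism groups are the products of symmetric groups. -/
structure Corolla (Ξ : Type uC) where
  arity : ℕ
  color : Fin arity → Ξ
  out : Ξ

/-- The corolla with one incoming edge, both edges having colour `ξ`. -/
def Corolla.one {Ξ : Type uC} (ξ : Ξ) : Corolla Ξ := ⟨1, fun _ => ξ, ξ⟩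

/-- A colour preserving relabelling of the incoming edges. -/
structure Corolla.Iso {Ξ : Type uC} (q q' : Corolla Ξ) where
  toEquiv : Fin q.arity ≃ Fin q'.arity
  color_eq : ∀ x, q'.color (toEquiv x) = q.color x
  out_eq : q'.out = q.out

def Corolla.Iso.refl {Ξ : Type uC} (q : Corolla Ξ) : Corolla.Iso q q :=
  ⟨Equiv.refl _, fun _ => rfl, rfl⟩

def Corolla.Iso.trans {Ξ : Type uC} {q q' q'' : Corolla Ξ}
    (σ : Corolla.Iso q q') (τ : Corolla.Iso q' q'') : Corolla.Iso q q'' :=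
  ⟨σ.toEquiv.trans τ.toEquiv, fun x => by simp [τ.color_eq, σ.color_eq],
    by rw [τ.out_eq, σ.out_eq]⟩

/-- A coloured tree with two nodal vertices whose leaves are labelled by the incoming edges
of `q`.  The lower (root) vertex is `q₁`, the upper vertex is `q₂`, and the root edge of `q₂` is
glued to the incoming edge `edge` of `q₁`.  The leaf `ℓ` of the tree is the incoming edge `src ℓ`
of one of the two vertices. -/
structure Tree₂ {Ξ : Type uC} (q q₁ q₂ : Corolla Ξ) where
  edge : Fin q₁.arity
  src : Fin q.arity → Fin q₁.arity ⊕ Fin q₂.arity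
  src_injective : Function.Injective src
  src_range : ∀ z, (∃ ℓ, src ℓ = z) ↔ z ≠ Sum.inl edge
  color_eq : ∀ ℓ, q.color ℓ = Sum.elim q₁.color q₂.color (src ℓ)
  edge_eq : q₁.color edge = q₂.out
  out_eq : q.out = q₁.out

/-- `σ₁`, `σ₂` (on the vertices) and `σ` (on the leaf labels) form an isomorphism of trees. -/
def Tree₂.Compat {Ξ : Type uC} {q q₁ q₂ q' q₁' q₂' : Corolla Ξ}
    (t : Tree₂ q q₁ q₂) (t' : Tree₂ q' q₁' q₂')
    (σ : Corolla.Iso q q') (σ₁ : Corolla.Iso q₁ q₁') (σ₂ : Corolla.Iso q₂ q₂') : Prop :=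
  t'.edge = σ₁.toEquiv t.edge ∧
    ∀ ℓ, t'.src (σ.toEquiv ℓ) = Sum.map σ₁.toEquiv σ₂.toEquiv (t.src ℓ)

/-- The two ways of building the same tree with three vertices in a chain: `q₂` on top of `q₁` and
`q₃` on top of `q₂`. -/
def SeqCompat {Ξ : Type uC} {q q₁ q₂ q₃ q₁₂ q₂₃ : Corolla Ξ}
    (t₁ : Tree₂ q₁₂ q₁ q₂) (t₂ : Tree₂ q q₁₂ q₃)
    (t₃ : Tree₂ q₂₃ q₂ q₃) (t₄ : Tree₂ q q₁ q₂₃) : Prop :=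
  t₁.src t₂.edge = Sum.inr t₃.edge ∧ t₄.edge = t₁.edge ∧
    ∀ ℓ, Equiv.sumAssoc _ _ _ (Sum.map t₁.src id (t₂.src ℓ)) = Sum.map id t₃.src (t₄.src ℓ)

/-- The two ways of building the same tree with three vertices, `q₂` and `q₃` being both attached
to `q₁`. -/
def ParCompat {Ξ : Type uC} {q q₁ q₂ q₃ q₁₂ q₁₃ : Corolla Ξ}
    (t₁ : Tree₂ q₁₂ q₁ q₂) (t₂ : Tree₂ q q₁₂ q₃)
    (t₃ : Tree₂ q₁₃ q₁ q₃) (t₄ : Tree₂ q q₁₃ q₂) : Prop :=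
  t₁.src t₂.edge = Sum.inl t₃.edge ∧ t₃.src t₄.edge = Sum.inl t₁.edge ∧
    ∀ ℓ, Sum.map t₁.src id (t₂.src ℓ) =
      Sum.elim (Sum.elim (Sum.inl ∘ Sum.inl) Sum.inr) (Sum.inl ∘ Sum.inr)
        (Sum.map t₃.src id (t₄.src ℓ))

/-! ### Collections, operads, pseudo-cooperads -/

/-- Coloured collections of (cohomologically) `ℤ`-graded vector spaces. -/
structure Coll (K : Type uK) [Field K] (Ξ : Type uC) where
  obj : Corolla Ξ → ℤ → Type u
  [addCommGroup : ∀ q i, AddCommGroup (obj q i)]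
  [module : ∀ q i, Module K (obj q i)]
  act : ∀ {q q' : Corolla Ξ} {i : ℤ}, Corolla.Iso q q' → obj q i →ₗ[K] obj q' i
  act_refl : ∀ {q : Corolla Ξ} {i : ℤ} (x : obj q i), act (Corolla.Iso.refl q) x = x
  act_trans : ∀ {q q' q'' : Corolla Ξ} {i : ℤ} (σ : Corolla.Iso q q') (τ : Corolla.Iso q' q'')
    (x : obj q i), act (σ.trans τ) x = act τ (act σ x)

attribute [instance] Coll.addCommGroup Coll.module

/-- Homomorphisms of collections of degree `d`. -/
structure HomColl {K : Type uK} [Field K] {Ξ : Type uC} (V : Coll.{uK, uC, u} K Ξ)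
    (W : Coll.{uK, uC, u'} K Ξ) (d : ℤ) where
  app : ∀ {q : Corolla Ξ} {i j : ℤ} (_ : i + d = j), V.obj q i →ₗ[K] W.obj q j
  app_act : ∀ {q q' : Corolla Ξ} {i j : ℤ} (h : i + d = j) (σ : Corolla.Iso q q')
    (x : V.obj q i), app h (V.act σ x) = W.act σ (app h x)

/-- Coloured operads in graded vector spaces (with the Koszul sign rule), given by the
multiplications along labelled trees with two nodal vertices and the units. -/
structure Operad (K : Type uK) [Field K] (Ξ : Type uC) extends Coll.{uK, uC, u} K Ξ where
  unit : ∀ ξ : Ξ, obj (Corolla.one ξ) 0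
  comp : ∀ {q q₁ q₂ : Corolla Ξ} (_ : Tree₂ q q₁ q₂) {i j k : ℤ} (_ : i + j = k),
    obj q₁ i →ₗ[K] obj q₂ j →ₗ[K] obj q k
  act_comp : ∀ {q q₁ q₂ q' q₁' q₂' : Corolla Ξ} (t : Tree₂ q q₁ q₂) (t' : Tree₂ q' q₁' q₂')
    (σ : Corolla.Iso q q') (σ₁ : Corolla.Iso q₁ q₁') (σ₂ : Corolla.Iso q₂ q₂')
    (_ : t.Compat t' σ σ₁ σ₂) {i j k : ℤ} (h : i + j = k) (x : obj q₁ i) (y : obj q₂ j),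
    act σ (comp t h x y) = comp t' h (act σ₁ x) (act σ₂ y)
  comp_seq : ∀ {q q₁ q₂ q₃ q₁₂ q₂₃ : Corolla Ξ} (t₁ : Tree₂ q₁₂ q₁ q₂) (t₂ : Tree₂ q q₁₂ q₃)
    (t₃ : Tree₂ q₂₃ q₂ q₃) (t₄ : Tree₂ q q₁ q₂₃) (_ : SeqCompat t₁ t₂ t₃ t₄)
    {a b c ab bc k : ℤ} (h₁ : a + b = ab) (h₂ : ab + c = k) (h₃ : b + c = bc) (h₄ : a + bc = k)
    (x : obj q₁ a) (y : obj q₂ b) (z : obj q₃ c),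
    comp t₂ h₂ (comp t₁ h₁ x y) z = comp t₄ h₄ x (comp t₃ h₃ y z)
  comp_par : ∀ {q q₁ q₂ q₃ q₁₂ q₁₃ : Corolla Ξ} (t₁ : Tree₂ q₁₂ q₁ q₂) (t₂ : Tree₂ q q₁₂ q₃)
    (t₃ : Tree₂ q₁₃ q₁ q₃) (t₄ : Tree₂ q q₁₃ q₂) (_ : ParCompat t₁ t₂ t₃ t₄)
    {a b c ab ac k : ℤ} (h₁ : a + b = ab) (h₂ : ab + c = k) (h₃ : a + c = ac) (h₄ : ac + b = k)
    (x : obj q₁ a) (y : obj q₂ b) (z : obj q₃ c),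
    comp t₂ h₂ (comp t₁ h₁ x y) z = (-1 : K) ^ (b * c) • comp t₄ h₄ (comp t₃ h₃ x z) y
  unit_comp : ∀ {q q₂ : Corolla Ξ} {ξ : Ξ} (t : Tree₂ q (Corolla.one ξ) q₂)
    (σ : Corolla.Iso q₂ q) (_ : ∀ y, t.src (σ.toEquiv y) = Sum.inr y) {j : ℤ} (h : 0 + j = j)
    (y : obj q₂ j), comp t h (unit ξ) y = act σ y
  comp_unit : ∀ {q q₁ : Corolla Ξ} {ξ : Ξ} (t : Tree₂ q q₁ (Corolla.one ξ))
    (σ : Corolla.Iso q₁ q)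
    (_ : ∀ x, t.src (σ.toEquiv x) = if x = t.edge then Sum.inr (0 : Fin 1) else Sum.inl x) {i : ℤ}
    (h : i + 0 = i) (x : obj q₁ i), comp t h x (unit ξ) = act σ x

/-- Derivations of degree `d` of an operad in graded vector spaces. -/
structure Derivation {K : Type uK} [Field K] {Ξ : Type uC} (E : Operad.{uK, uC, u} K Ξ) (d : ℤ)
    where
  toHom : HomColl E.toColl E.toColl d
  leibniz : ∀ {q q₁ q₂ : Corolla Ξ} (t : Tree₂ q q₁ q₂) {i j k i' j' k' : ℤ} (h : i + j = k)
    (hi : i + d = i') (hj : j + d = j') (hk : k + d = k') (h₁ : i' + j = k') (h₂ : i + j' = k')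
    (x : E.obj q₁ i) (y : E.obj q₂ j),
    toHom.app hk (E.comp t h x y) =
      E.comp t h₁ (toHom.app hi x) y + (-1 : K) ^ (d * i) • E.comp t h₂ x (toHom.app hj y)

/-- Differential graded coloured operads. -/
structure DGOperad (K : Type uK) [Field K] (Ξ : Type uC) extends Operad.{uK, uC, u} K Ξ where
  d : Derivation toOperad 1
  d_d : ∀ {q : Corolla Ξ} {i j k : ℤ} (h : i + 1 = j) (h' : j + 1 = k) (x : obj q i),
    d.toHom.app h' (d.toHom.app h x) = 0

/-- Differential graded coloured pseudo-cooperads, given by the comultiplications along labelled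
trees with two nodal vertices; `Δ t h` is the component of `Δ_t` in bidegree `(i, j)`.
The comultiplications along all other trees are the iterations of these.  The condition
`finite` says that `Δ_t x` has finitely many bihomogeneous components and that, if there are
infinitely many colours, only finitely many colours of the inner edge contribute. -/
structure PseudoCooperad (K : Type uK) [Field K] (Ξ : Type uC) extends Coll.{uK, uC, u} K Ξ where
  d : HomColl toColl toColl 1
  d_d : ∀ {q : Corolla Ξ} {i j k : ℤ} (h : i + 1 = j) (h' : j + 1 = k) (x : obj q i),
    d.app h' (d.app h x) = 0
  Δ : ∀ {q q₁ q₂ : Corolla Ξ} (_ : Tree₂ q q₁ q₂) {i j k : ℤ} (_ : i + j = k),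
    obj q k →ₗ[K] obj q₁ i ⊗[K] obj q₂ j
  finite : ∀ {q : Corolla Ξ} {k : ℤ} (x : obj q k),
    {c : Ξ × ℤ | ∃ (q₁ q₂ : Corolla Ξ) (t : Tree₂ q q₁ q₂) (j : ℤ) (h : c.2 + j = k),
      q₂.out = c.1 ∧ Δ t h x ≠ 0}.Finite
  Δ_act : ∀ {q q₁ q₂ q' q₁' q₂' : Corolla Ξ} (t : Tree₂ q q₁ q₂) (t' : Tree₂ q' q₁' q₂')
    (σ : Corolla.Iso q q') (σ₁ : Corolla.Iso q₁ q₁') (σ₂ : Corolla.Iso q₂ q₂')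
    (_ : t.Compat t' σ σ₁ σ₂) {i j k : ℤ} (h : i + j = k) (x : obj q k),
    Δ t' h (act σ x) = TensorProduct.map (act σ₁) (act σ₂) (Δ t h x)
  Δ_d : ∀ {q q₁ q₂ : Corolla Ξ} (t : Tree₂ q q₁ q₂) {i j k i' j' k' : ℤ}
    (hi : i + 1 = i') (hj : j + 1 = j') (hk : k + 1 = k') (h : i' + j' = k')
    (h₁ : i + j' = k) (h₂ : i' + j = k) (x : obj q k),
    Δ t h (d.app hk x) = TensorProduct.map (d.app hi) LinearMap.id (Δ t h₁ x) +
      (-1 : K) ^ i' • TensorProduct.map LinearMap.id (d.app hj) (Δ t h₂ x)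
  Δ_seq : ∀ {q q₁ q₂ q₃ q₁₂ q₂₃ : Corolla Ξ} (t₁ : Tree₂ q₁₂ q₁ q₂) (t₂ : Tree₂ q q₁₂ q₃)
    (t₃ : Tree₂ q₂₃ q₂ q₃) (t₄ : Tree₂ q q₁ q₂₃) (_ : SeqCompat t₁ t₂ t₃ t₄)
    {a b c ab bc k : ℤ} (h₁ : a + b = ab) (h₂ : ab + c = k) (h₃ : b + c = bc) (h₄ : a + bc = k)
    (x : obj q k),
    TensorProduct.assoc K _ _ _ (TensorProduct.map (Δ t₁ h₁) LinearMap.id (Δ t₂ h₂ x)) =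
      TensorProduct.map LinearMap.id (Δ t₃ h₃) (Δ t₄ h₄ x)
  Δ_par : ∀ {q q₁ q₂ q₃ q₁₂ q₁₃ : Corolla Ξ} (t₁ : Tree₂ q₁₂ q₁ q₂) (t₂ : Tree₂ q q₁₂ q₃)
    (t₃ : Tree₂ q₁₃ q₁ q₃) (t₄ : Tree₂ q q₁₃ q₂) (_ : ParCompat t₁ t₂ t₃ t₄)
    {a b c ab ac k : ℤ} (h₁ : a + b = ab) (h₂ : ab + c = k) (h₃ : a + c = ac) (h₄ : ac + b = k)
    (x : obj q k),
    TensorProduct.map (Δ t₁ h₁) LinearMap.id (Δ t₂ h₂ x) = (-1 : K) ^ (b * c) •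
      TensorProduct.rightComm K _ _ _ (TensorProduct.map (Δ t₃ h₃) LinearMap.id (Δ t₄ h₄ x))


/-! ### Isomorphism classes of labelled trees with two nodal vertices -/

section Trees

variable {Ξ : Type uC}

/-- The lower vertex of the standard tree: the leaves outside `S` and the inner edge, of colour
`ξ`, in an arbitrarily chosen order. -/
def lowCor (q : Corolla Ξ) (S : Set (Fin q.arity)) (ξ : Ξ) : Corolla Ξ where
  arity := Nat.card (Option {ℓ // ℓ ∉ S})
  color a := ((Finite.equivFin (Option {ℓ // ℓ ∉ S})).symm a).elim ξ (fun ℓ => q.color ℓ)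
  out := q.out

/-- The upper vertex of the standard tree: the leaves in `S`, in an arbitrarily chosen order. -/
def upCor (q : Corolla Ξ) (S : Set (Fin q.arity)) (ξ : Ξ) : Corolla Ξ where
  arity := Nat.card {ℓ // ℓ ∈ S}
  color a := q.color ((Finite.equivFin {ℓ // ℓ ∈ S}).symm a)
  out := ξ

def lowEquiv (q : Corolla Ξ) (S : Set (Fin q.arity)) (ξ : Ξ) :
    Option {ℓ // ℓ ∉ S} ≃ Fin (lowCor q S ξ).arity := Finite.equivFin _

def upEquiv (q : Corolla Ξ) (S : Set (Fin q.arity)) (ξ : Ξ) :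
    {ℓ // ℓ ∈ S} ≃ Fin (upCor q S ξ).arity := Finite.equivFin _

theorem lowCor_color (q : Corolla Ξ) (S : Set (Fin q.arity)) (ξ : Ξ) (o : Option {ℓ // ℓ ∉ S}) :
    (lowCor q S ξ).color (lowEquiv q S ξ o) = o.elim ξ (fun ℓ => q.color ℓ) := by
  have h : (Finite.equivFin (Option {ℓ // ℓ ∉ S})).symm (lowEquiv q S ξ o) = o :=
    Equiv.symm_apply_apply _ o
  exact congrArg (fun o : Option {ℓ // ℓ ∉ S} => o.elim ξ (fun ℓ => q.color ℓ)) h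

theorem upCor_color (q : Corolla Ξ) (S : Set (Fin q.arity)) (ξ : Ξ) (o : {ℓ // ℓ ∈ S}) :
    (upCor q S ξ).color (upEquiv q S ξ o) = q.color o := by
  have h : (Finite.equivFin {ℓ // ℓ ∈ S}).symm (upEquiv q S ξ o) = o :=
    Equiv.symm_apply_apply _ o
  exact congrArg (fun o : {ℓ // ℓ ∈ S} => q.color o) h

open Classical in
/-- Every labelled tree with two nodal vertices is isomorphic to exactly one of these: `S` is the
set of the leaves attached to the upper vertex and `ξ` is the colour of the inner edge. -/
def stdTree (q : Corolla Ξ) (S : Set (Fin q.arity)) (ξ : Ξ) :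
    Tree₂ q (lowCor q S ξ) (upCor q S ξ) where
  edge := lowEquiv q S ξ none
  src ℓ := if h : ℓ ∈ S then Sum.inr (upEquiv q S ξ ⟨ℓ, h⟩)
    else Sum.inl (lowEquiv q S ξ (some ⟨ℓ, h⟩))
  src_injective := by
    intro a b h
    by_cases ha : a ∈ S <;> by_cases hb : b ∈ S <;> simp [ha, hb] at h <;>
      assumption
  src_range := by
    rintro (z | z)
    · obtain ⟨y, rfl⟩ := (lowEquiv q S ξ).surjective z
      rcases y with _ | ⟨ℓ, hℓ⟩
      · constructor
        · rintro ⟨ℓ, h⟩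
          by_cases hS : ℓ ∈ S <;> simp [hS] at h
        · simp
      · constructor
        · intro _ h
          simp at h
        · intro _
          exact ⟨ℓ, by simp [hℓ]⟩
    · obtain ⟨⟨ℓ, hℓ⟩, rfl⟩ := (upEquiv q S ξ).surjective z
      constructor
      · intro _ h
        simp at h
      · intro _
        exact ⟨ℓ, by simp [hℓ]⟩
  color_eq := by
    intro ℓ
    by_cases h : ℓ ∈ S <;> simp [h, lowCor_color, upCor_color]
  edge_eq := by simp [lowCor_color, upCor]
  out_eq := rfl

theorem stdTree_src_mem (q : Corolla Ξ) (S : Set (Fin q.arity)) (ξ : Ξ) {ℓ : Fin q.arity}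
    (h : ℓ ∈ S) : (stdTree q S ξ).src ℓ = Sum.inr (upEquiv q S ξ ⟨ℓ, h⟩) := by
  simp [stdTree, h]

theorem stdTree_src_notMem (q : Corolla Ξ) (S : Set (Fin q.arity)) (ξ : Ξ) {ℓ : Fin q.arity}
    (h : ℓ ∉ S) : (stdTree q S ξ).src ℓ = Sum.inl (lowEquiv q S ξ (some ⟨ℓ, h⟩)) := by
  simp [stdTree, h]

/-- The set of the leaves attached to the upper vertex. -/
def Tree₂.upper {q q₁ q₂ : Corolla Ξ} (t : Tree₂ q q₁ q₂) : Set (Fin q.arity) :=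
  {ℓ | (t.src ℓ).isRight}

theorem stdTree_upper (q : Corolla Ξ) (S : Set (Fin q.arity)) (ξ : Ξ) :
    (stdTree q S ξ).upper = S := by
  ext ℓ
  by_cases h : ℓ ∈ S
  · simp [Tree₂.upper, stdTree_src_mem q S ξ h, h]
  · simp [Tree₂.upper, stdTree_src_notMem q S ξ h, h]

/-- The leaves and the inner edge are exactly the incoming edges of the vertices. -/
def Tree₂.flags {q q₁ q₂ : Corolla Ξ} (t : Tree₂ q q₁ q₂) :
    Option (Fin q.arity) ≃ Fin q₁.arity ⊕ Fin q₂.arity :=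
  Equiv.ofBijective (fun o => o.elim (Sum.inl t.edge) t.src) (by
    constructor
    · rintro (_ | a) (_ | b) h
      · rfl
      · exact absurd h.symm ((t.src_range _).1 ⟨b, rfl⟩)
      · exact absurd h ((t.src_range _).1 ⟨a, rfl⟩)
      · exact congrArg some (t.src_injective h)
    · intro z
      by_cases h : z = Sum.inl t.edge
      · exact ⟨none, h.symm⟩
      · obtain ⟨ℓ, hℓ⟩ := (t.src_range z).2 h
        exact ⟨some ℓ, hℓ⟩)

theorem Tree₂.flags_none {q q₁ q₂ : Corolla Ξ} (t : Tree₂ q q₁ q₂) :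
    t.flags none = Sum.inl t.edge := rfl

theorem Tree₂.flags_some {q q₁ q₂ : Corolla Ξ} (t : Tree₂ q q₁ q₂) (ℓ : Fin q.arity) :
    t.flags (some ℓ) = t.src ℓ := rfl

theorem Tree₂.flags_symm_edge {q q₁ q₂ : Corolla Ξ} (t : Tree₂ q q₁ q₂) :
    t.flags.symm (Sum.inl t.edge) = none := by
  rw [← t.flags_none, Equiv.symm_apply_apply]

theorem Tree₂.flags_symm_src {q q₁ q₂ : Corolla Ξ} (t : Tree₂ q q₁ q₂) (ℓ : Fin q.arity) :
    t.flags.symm (t.src ℓ) = some ℓ := by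
  rw [← t.flags_some, Equiv.symm_apply_apply]

theorem sumEquiv_split {A B A' B' : Type} (φ : A ⊕ B ≃ A' ⊕ B')
    (h : ∀ z, (φ z).isRight = z.isRight) :
    ∃ (f : A ≃ A') (g : B ≃ B'), ∀ z, φ z = Sum.map f g z := by
  have h1 : ∀ a, ∃ a', φ (Sum.inl a) = Sum.inl a' := by
    intro a
    have := h (Sum.inl a)
    rcases hz : φ (Sum.inl a) with z | z
    · exact ⟨z, rfl⟩
    · simp [hz] at this
  have h2 : ∀ a, ∃ a', φ (Sum.inr a) = Sum.inr a' := by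
    intro a
    have := h (Sum.inr a)
    rcases hz : φ (Sum.inr a) with z | z
    · simp [hz] at this
    · exact ⟨z, rfl⟩
  choose f hf using h1
  choose g hg using h2
  have bf : Function.Bijective f := by
    constructor
    · intro a b hab
      have : φ (Sum.inl a) = φ (Sum.inl b) := by rw [hf, hf, hab]
      exact Sum.inl_injective (φ.injective this)
    · intro y
      obtain ⟨z | z, hz⟩ := φ.surjective (Sum.inl y)
      · exact ⟨z, Sum.inl_injective ((hf z).symm.trans hz)⟩
      · rw [hg] at hz
        simp at hz
  have bg : Function.Bijective g := by
    constructor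
    · intro a b hab
      have : φ (Sum.inr a) = φ (Sum.inr b) := by rw [hg, hg, hab]
      exact Sum.inr_injective (φ.injective this)
    · intro y
      obtain ⟨z | z, hz⟩ := φ.surjective (Sum.inr y)
      · rw [hf] at hz
        simp at hz
      · exact ⟨z, Sum.inr_injective ((hg z).symm.trans hz)⟩
  refine ⟨Equiv.ofBijective f bf, Equiv.ofBijective g bg, ?_⟩
  rintro (z | z) <;> simp [hf, hg]

/-- Trees are classified by the upper leaves and the colour of the inner edge. -/
theorem Tree₂.exists_compat {q q₁ q₂ q' q₁' q₂' : Corolla Ξ} (t : Tree₂ q q₁ q₂)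
    (t' : Tree₂ q' q₁' q₂') (σ : Corolla.Iso q q')
    (hu : ∀ ℓ, σ.toEquiv ℓ ∈ t'.upper ↔ ℓ ∈ t.upper) (hc : q₂'.out = q₂.out) :
    ∃ (σ₁ : Corolla.Iso q₁ q₁') (σ₂ : Corolla.Iso q₂ q₂'), t.Compat t' σ σ₁ σ₂ := by
  obtain ⟨f, g, hfg⟩ := sumEquiv_split
    ((t.flags.symm.trans (Equiv.optionCongr σ.toEquiv)).trans t'.flags) (by
      intro z
      obtain ⟨o, rfl⟩ := t.flags.surjective z
      rcases o with _ | ℓ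
      · simp [Tree₂.flags_none, Tree₂.flags_symm_edge]
      · have := hu ℓ
        simp only [Tree₂.upper, Set.mem_ofPred_eq] at this
        rw [Bool.eq_iff_iff]
        simpa [Tree₂.flags_some, Tree₂.flags_symm_src] using this)
  have hs : ∀ ℓ, t'.src (σ.toEquiv ℓ) = Sum.map f g (t.src ℓ) := by
    intro ℓ
    rw [← hfg]
    simp [Tree₂.flags_some, Tree₂.flags_symm_src]
  have he : t'.edge = f t.edge := by
    simpa [Tree₂.flags_none, Tree₂.flags_symm_edge] using hfg (Sum.inl t.edge)
  refine ⟨⟨f, ?_, by rw [← t'.out_eq, ← t.out_eq, σ.out_eq]⟩, ⟨g, ?_, hc⟩, he, hs⟩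
  · intro x
    by_cases hx : x = t.edge
    · rw [hx, ← he, t'.edge_eq, t.edge_eq, hc]
    · obtain ⟨ℓ, hℓ⟩ := (t.src_range (Sum.inl x)).2 (by simpa using hx)
      have h1 := t'.color_eq (σ.toEquiv ℓ)
      rw [hs, hℓ, σ.color_eq, t.color_eq, hℓ] at h1
      simpa using h1.symm
  · intro x
    obtain ⟨ℓ, hℓ⟩ := (t.src_range (Sum.inr x)).2 (by simp)
    have h1 := t'.color_eq (σ.toEquiv ℓ)
    rw [hs, hℓ, σ.color_eq, t.color_eq, hℓ] at h1
    simpa using h1.symm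

end Trees

/-! ### The convolution Lie algebra -/

section Conv

variable {K : Type uK} [Field K] {Ξ : Type uC}

/-- `x ⊗ y ↦ (-1)^{|g||x|} f(x) ∘_t g(y)`. -/
def convTerm {P : Coll.{uK, uC, u} K Ξ} {E : Operad.{uK, uC, u'} K Ξ} {a b : ℤ}
    (f : HomColl P E.toColl a) (g : HomColl P E.toColl b) {q q₁ q₂ : Corolla Ξ}
    (t : Tree₂ q q₁ q₂) {i j k : ℤ} (h : (i + a) + (j + b) = k) :
    P.obj q₁ i ⊗[K] P.obj q₂ j →ₗ[K] E.obj q k :=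
  (-1 : K) ^ (b * i) • TensorProduct.lift ((E.comp t h).compl₁₂ (f.app rfl) (g.app rfl))

theorem convTerm_tmul {P : Coll.{uK, uC, u} K Ξ} {E : Operad.{uK, uC, u'} K Ξ} {a b : ℤ}
    (f : HomColl P E.toColl a) (g : HomColl P E.toColl b) {q q₁ q₂ : Corolla Ξ}
    (t : Tree₂ q q₁ q₂) {i j k : ℤ} (h : (i + a) + (j + b) = k) (x : P.obj q₁ i)
    (y : P.obj q₂ j) :
    convTerm f g t h (x ⊗ₜ y) = (-1 : K) ^ (b * i) • E.comp t h (f.app rfl x) (g.app rfl y) := by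
  simp [convTerm]

theorem act_convTerm {P : Coll.{uK, uC, u} K Ξ} {E : Operad.{uK, uC, u'} K Ξ} {a b : ℤ}
    (f : HomColl P E.toColl a) (g : HomColl P E.toColl b) {q q₁ q₂ q' q₁' q₂' : Corolla Ξ}
    (t : Tree₂ q q₁ q₂) (t' : Tree₂ q' q₁' q₂') (σ : Corolla.Iso q q')
    (σ₁ : Corolla.Iso q₁ q₁') (σ₂ : Corolla.Iso q₂ q₂') (hc : t.Compat t' σ σ₁ σ₂)
    {i j k : ℤ} (h : (i + a) + (j + b) = k) (z : P.obj q₁ i ⊗[K] P.obj q₂ j) :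
    E.act σ (convTerm f g t h z) =
      convTerm f g t' h (TensorProduct.map (P.act σ₁) (P.act σ₂) z) := by
  induction z with
  | zero => simp
  | add z w hz hw => simp [hz, hw]
  | tmul x y =>
    simp [convTerm_tmul, E.act_comp t t' σ σ₁ σ₂ hc, f.app_act, g.app_act]

variable {P : PseudoCooperad.{uK, uC, u} K Ξ} {E : Operad.{uK, uC, u'} K Ξ}

/-- The contribution to `f • g` of the tree `t` and the bidegree `(i, j)`. -/
def treeTerm {a b : ℤ} (f : HomColl P.toColl E.toColl a) (g : HomColl P.toColl E.toColl b)
    {q q₁ q₂ : Corolla Ξ} (t : Tree₂ q q₁ q₂) {i j k r : ℤ} (h : i + j = k)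
    (h' : (i + a) + (j + b) = r) : P.obj q k →ₗ[K] E.obj q r :=
  convTerm f g t h' ∘ₗ P.Δ t h

theorem act_treeTerm {a b : ℤ}
    (f : HomColl P.toColl E.toColl a) (g : HomColl P.toColl E.toColl b)
    {q q₁ q₂ q' q₁' q₂' : Corolla Ξ} (t : Tree₂ q q₁ q₂) (t' : Tree₂ q' q₁' q₂')
    (σ : Corolla.Iso q q') (hu : ∀ ℓ, σ.toEquiv ℓ ∈ t'.upper ↔ ℓ ∈ t.upper)
    (hc : q₂'.out = q₂.out) {i j k r : ℤ} (h : i + j = k)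
    (h' : (i + a) + (j + b) = r) (x : P.obj q k) :
    E.act σ (treeTerm f g t h h' x) = treeTerm f g t' h h' (P.act σ x) := by
  obtain ⟨σ₁, σ₂, hσ⟩ := t.exists_compat t' σ hu hc
  simp only [treeTerm, LinearMap.comp_apply]
  rw [act_convTerm f g t t' σ σ₁ σ₂ hσ, P.Δ_act t t' σ σ₁ σ₂ hσ]

/-- The index set of the sum defining `f • g` on `P(q)`: isomorphism classes of trees and the
degree of the lower tensor factor. -/
abbrev TreeIdx (q : Corolla Ξ) := Set (Fin q.arity) × Ξ × ℤ

theorem Δ_std_finite (q : Corolla Ξ) {k : ℤ} (x : P.obj q k) :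
    {c : TreeIdx q | P.Δ (stdTree q c.1 c.2.1) (add_sub_cancel c.2.2 k) x ≠ 0}.Finite := by
  refine Set.Finite.subset (Set.finite_univ.prod (P.finite x)) ?_
  rintro ⟨S, ξ, i⟩ h
  exact ⟨trivial, _, _, stdTree q S ξ, _, add_sub_cancel i k, rfl, h⟩

/-- The terms of the sum defining `f • g`. -/
def bulletTerm {a b : ℤ} (f : HomColl P.toColl E.toColl a) (g : HomColl P.toColl E.toColl b)
    (q : Corolla Ξ) {k r : ℤ} (h : k + (a + b) = r) (c : TreeIdx q) :
    P.obj q k →ₗ[K] E.obj q r :=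
  treeTerm f g (stdTree q c.1 c.2.1) (add_sub_cancel c.2.2 k) (by omega)

theorem bulletTerm_finite {a b : ℤ} (f : HomColl P.toColl E.toColl a)
    (g : HomColl P.toColl E.toColl b) (q : Corolla Ξ) {k r : ℤ} (h : k + (a + b) = r)
    (x : P.obj q k) : (Function.support fun c => bulletTerm f g q h c x).Finite := by
  refine (Δ_std_finite q x).subset ?_
  intro c hc h0
  exact hc (by simp [bulletTerm, treeTerm, h0])

theorem act_bulletTerm {a b : ℤ} (f : HomColl P.toColl E.toColl a)
    (g : HomColl P.toColl E.toColl b) {q q' : Corolla Ξ} (σ : Corolla.Iso q q') {k r : ℤ}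
    (h : k + (a + b) = r) (x : P.obj q k) (c : TreeIdx q) :
    E.act σ (bulletTerm f g q h c x) =
      bulletTerm f g q' h (σ.toEquiv '' c.1, c.2) (P.act σ x) := by
  obtain ⟨S, ξ, i⟩ := c
  unfold bulletTerm
  exact act_treeTerm f g (stdTree q S ξ) (stdTree q' (σ.toEquiv '' S) ξ) σ
    (fun ℓ => by simp [stdTree_upper]) rfl (add_sub_cancel i k) (by omega) x

/-- The sum defining `f • g`. -/
def bulletMap {a b : ℤ} (f : HomColl P.toColl E.toColl a) (g : HomColl P.toColl E.toColl b)
    (q : Corolla Ξ) {k r : ℤ} (h : k + (a + b) = r) : P.obj q k →ₗ[K] E.obj q r where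
  toFun x := ∑ᶠ c : TreeIdx q, bulletTerm f g q h c x
  map_add' x y := by
    simp only [map_add]
    exact finsum_add_distrib (bulletTerm_finite f g q h x) (bulletTerm_finite f g q h y)
  map_smul' s x := by
    simp only [map_smul, RingHom.id_apply]
    exact (smul_finsum s _).symm

theorem bulletMap_apply {a b : ℤ} (f : HomColl P.toColl E.toColl a)
    (g : HomColl P.toColl E.toColl b) (q : Corolla Ξ) {k r : ℤ} (h : k + (a + b) = r)
    (x : P.obj q k) : bulletMap f g q h x = ∑ᶠ c : TreeIdx q, bulletTerm f g q h c x := rfl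

theorem act_bulletMap {a b : ℤ} (f : HomColl P.toColl E.toColl a)
    (g : HomColl P.toColl E.toColl b) {q q' : Corolla Ξ} (σ : Corolla.Iso q q') {k r : ℤ}
    (h : k + (a + b) = r) (x : P.obj q k) :
    bulletMap f g q' h (P.act σ x) = E.act σ (bulletMap f g q h x) := by
  have h1 : E.act σ (∑ᶠ c : TreeIdx q, bulletTerm f g q h c x) =
      ∑ᶠ c : TreeIdx q, E.act σ (bulletTerm f g q h c x) :=
    map_finsum (E.act σ) (bulletTerm_finite f g q h x)
  rw [bulletMap_apply, bulletMap_apply, h1]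
  have hb : Function.Bijective (fun c : TreeIdx q => ((σ.toEquiv '' c.1, c.2) : TreeIdx q')) :=
    Function.Bijective.prodMap (f := fun S => σ.toEquiv '' S) (g := fun c : Ξ × ℤ => c)
      (Equiv.Set.congr σ.toEquiv).bijective Function.bijective_id
  exact (finsum_eq_of_bijective _ hb (act_bulletTerm f g σ h x)).symm

/-- The pre-Lie product `(f • g)(x) = ∑_t ∑ (-1)^{|g||x'|} f(x') ∘_t g(x'')`, where
`Δ_t x = ∑ x' ⊗ x''` and `t` runs over the isomorphism classes of labelled trees with two nodal
vertices. -/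
def bullet {a b c : ℤ} (f : HomColl P.toColl E.toColl a) (g : HomColl P.toColl E.toColl b)
    (hab : a + b = c) : HomColl P.toColl E.toColl c where
  app {q _ _} h := bulletMap f g q (by rw [hab]; exact h)
  app_act h σ x := act_bulletMap f g σ _ x

/-- The Lie bracket `[f, g] = f • g - (-1)^{|f||g|} g • f` of the convolution Lie algebra. -/
def bracket {a b c : ℤ} (f : HomColl P.toColl E.toColl a) (g : HomColl P.toColl E.toColl b)
    (hab : a + b = c) : HomColl P.toColl E.toColl c where
  app h := (bullet f g hab).app h -
    (-1 : K) ^ (a * b) • (bullet g f (by rw [add_comm]; exact hab)).app h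
  app_act h σ x := by simp [HomColl.app_act]

end Conv


/-! ### The free operad `OP(s P)` -/

section Free

variable {K : Type uK} [Field K] {Ξ : Type uC}

/-- Formal expressions in the suspended elements `s x`, `x ∈ P`. -/
inductive Pre (P : Coll.{uK, uC, u} K Ξ) : Corolla Ξ → ℤ → Type (max uK uC u)
  | gen {q : Corolla Ξ} {p i : ℤ} (h : p + 1 = i) (x : P.obj q p) : Pre P q i
  | unit (ξ : Ξ) : Pre P (Corolla.one ξ) 0
  | comp {q q₁ q₂ : Corolla Ξ} (t : Tree₂ q q₁ q₂) {i j k : ℤ} (h : i + j = k)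
      (a : Pre P q₁ i) (b : Pre P q₂ j) : Pre P q k
  | act {q q' : Corolla Ξ} {i : ℤ} (σ : Corolla.Iso q q') (a : Pre P q i) : Pre P q' i
  | zero {q : Corolla Ξ} {i : ℤ} : Pre P q i
  | add {q : Corolla Ξ} {i : ℤ} (a b : Pre P q i) : Pre P q i
  | smul {q : Corolla Ξ} {i : ℤ} (s : K) (a : Pre P q i) : Pre P q i

/-- The relations of a graded operad and those saying that `x ↦ s x` is a map of collections. -/
inductive Rel (P : Coll.{uK, uC, u} K Ξ) :
    ∀ {q : Corolla Ξ} {i : ℤ}, Pre P q i → Pre P q i → Prop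
  -- congruence
  | comp_left {q q₁ q₂ : Corolla Ξ} (t : Tree₂ q q₁ q₂) {i j k : ℤ} (h : i + j = k)
      {a a' : Pre P q₁ i} (b : Pre P q₂ j) : Rel P a a' → Rel P (.comp t h a b) (.comp t h a' b)
  | comp_right {q q₁ q₂ : Corolla Ξ} (t : Tree₂ q q₁ q₂) {i j k : ℤ} (h : i + j = k)
      (a : Pre P q₁ i) {b b' : Pre P q₂ j} :
      Rel P b b' → Rel P (.comp t h a b) (.comp t h a b')
  | act_congr {q q' : Corolla Ξ} {i : ℤ} (σ : Corolla.Iso q q') {a a' : Pre P q i} :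
      Rel P a a' → Rel P (.act σ a) (.act σ a')
  | add_left {q : Corolla Ξ} {i : ℤ} {a a' : Pre P q i} (b : Pre P q i) :
      Rel P a a' → Rel P (.add a b) (.add a' b)
  | add_right {q : Corolla Ξ} {i : ℤ} (a : Pre P q i) {b b' : Pre P q i} :
      Rel P b b' → Rel P (.add a b) (.add a b')
  | smul_congr {q : Corolla Ξ} {i : ℤ} (s : K) {a a' : Pre P q i} :
      Rel P a a' → Rel P (.smul s a) (.smul s a')
  -- vector space axioms
  | add_assoc {q : Corolla Ξ} {i : ℤ} (a b c : Pre P q i) :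
      Rel P (.add (.add a b) c) (.add a (.add b c))
  | add_comm {q : Corolla Ξ} {i : ℤ} (a b : Pre P q i) : Rel P (.add a b) (.add b a)
  | zero_add {q : Corolla Ξ} {i : ℤ} (a : Pre P q i) : Rel P (.add .zero a) a
  | one_smul {q : Corolla Ξ} {i : ℤ} (a : Pre P q i) : Rel P (.smul 1 a) a
  | mul_smul {q : Corolla Ξ} {i : ℤ} (r s : K) (a : Pre P q i) :
      Rel P (.smul (r * s) a) (.smul r (.smul s a))
  | smul_add {q : Corolla Ξ} {i : ℤ} (r : K) (a b : Pre P q i) :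
      Rel P (.smul r (.add a b)) (.add (.smul r a) (.smul r b))
  | add_smul {q : Corolla Ξ} {i : ℤ} (r s : K) (a : Pre P q i) :
      Rel P (.smul (r + s) a) (.add (.smul r a) (.smul s a))
  | zero_smul {q : Corolla Ξ} {i : ℤ} (a : Pre P q i) : Rel P (.smul 0 a) .zero
  -- linearity
  | gen_add {q : Corolla Ξ} {p i : ℤ} (h : p + 1 = i) (x y : P.obj q p) :
      Rel P (.gen h (x + y)) (.add (.gen h x) (.gen h y))
  | gen_smul {q : Corolla Ξ} {p i : ℤ} (h : p + 1 = i) (r : K) (x : P.obj q p) :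
      Rel P (.gen h (r • x)) (.smul r (.gen h x))
  | gen_act {q q' : Corolla Ξ} (σ : Corolla.Iso q q') {p i : ℤ} (h : p + 1 = i)
      (x : P.obj q p) : Rel P (.gen h (P.act σ x)) (.act σ (.gen h x))
  | act_add {q q' : Corolla Ξ} (σ : Corolla.Iso q q') {i : ℤ} (a b : Pre P q i) :
      Rel P (.act σ (.add a b)) (.add (.act σ a) (.act σ b))
  | act_smul {q q' : Corolla Ξ} (σ : Corolla.Iso q q') {i : ℤ} (r : K) (a : Pre P q i) :
      Rel P (.act σ (.smul r a)) (.smul r (.act σ a))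
  | comp_add_left {q q₁ q₂ : Corolla Ξ} (t : Tree₂ q q₁ q₂) {i j k : ℤ} (h : i + j = k)
      (a a' : Pre P q₁ i) (b : Pre P q₂ j) :
      Rel P (.comp t h (.add a a') b) (.add (.comp t h a b) (.comp t h a' b))
  | comp_smul_left {q q₁ q₂ : Corolla Ξ} (t : Tree₂ q q₁ q₂) {i j k : ℤ} (h : i + j = k) (r : K)
      (a : Pre P q₁ i) (b : Pre P q₂ j) :
      Rel P (.comp t h (.smul r a) b) (.smul r (.comp t h a b))
  | comp_add_right {q q₁ q₂ : Corolla Ξ} (t : Tree₂ q q₁ q₂) {i j k : ℤ} (h : i + j = k)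
      (a : Pre P q₁ i) (b b' : Pre P q₂ j) :
      Rel P (.comp t h a (.add b b')) (.add (.comp t h a b) (.comp t h a b'))
  | comp_smul_right {q q₁ q₂ : Corolla Ξ} (t : Tree₂ q q₁ q₂) {i j k : ℤ} (h : i + j = k) (r : K)
      (a : Pre P q₁ i) (b : Pre P q₂ j) :
      Rel P (.comp t h a (.smul r b)) (.smul r (.comp t h a b))
  -- operad axioms
  | act_refl {q : Corolla Ξ} {i : ℤ} (a : Pre P q i) : Rel P (.act (Corolla.Iso.refl q) a) a
  | act_trans {q q' q'' : Corolla Ξ} {i : ℤ} (σ : Corolla.Iso q q') (τ : Corolla.Iso q' q'')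
      (a : Pre P q i) : Rel P (.act (σ.trans τ) a) (.act τ (.act σ a))
  | act_comp {q q₁ q₂ q' q₁' q₂' : Corolla Ξ} (t : Tree₂ q q₁ q₂) (t' : Tree₂ q' q₁' q₂')
      (σ : Corolla.Iso q q') (σ₁ : Corolla.Iso q₁ q₁') (σ₂ : Corolla.Iso q₂ q₂')
      (hc : t.Compat t' σ σ₁ σ₂) {i j k : ℤ} (h : i + j = k) (a : Pre P q₁ i) (b : Pre P q₂ j) :
      Rel P (.act σ (.comp t h a b)) (.comp t' h (.act σ₁ a) (.act σ₂ b))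
  | comp_seq {q q₁ q₂ q₃ q₁₂ q₂₃ : Corolla Ξ} (t₁ : Tree₂ q₁₂ q₁ q₂) (t₂ : Tree₂ q q₁₂ q₃)
      (t₃ : Tree₂ q₂₃ q₂ q₃) (t₄ : Tree₂ q q₁ q₂₃) (hc : SeqCompat t₁ t₂ t₃ t₄)
      {a b c ab bc k : ℤ} (h₁ : a + b = ab) (h₂ : ab + c = k) (h₃ : b + c = bc) (h₄ : a + bc = k)
      (x : Pre P q₁ a) (y : Pre P q₂ b) (z : Pre P q₃ c) :
      Rel P (.comp t₂ h₂ (.comp t₁ h₁ x y) z) (.comp t₄ h₄ x (.comp t₃ h₃ y z))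
  | comp_par {q q₁ q₂ q₃ q₁₂ q₁₃ : Corolla Ξ} (t₁ : Tree₂ q₁₂ q₁ q₂) (t₂ : Tree₂ q q₁₂ q₃)
      (t₃ : Tree₂ q₁₃ q₁ q₃) (t₄ : Tree₂ q q₁₃ q₂) (hc : ParCompat t₁ t₂ t₃ t₄)
      {a b c ab ac k : ℤ} (h₁ : a + b = ab) (h₂ : ab + c = k) (h₃ : a + c = ac) (h₄ : ac + b = k)
      (x : Pre P q₁ a) (y : Pre P q₂ b) (z : Pre P q₃ c) :
      Rel P (.comp t₂ h₂ (.comp t₁ h₁ x y) z)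
        (.smul ((-1 : K) ^ (b * c)) (.comp t₄ h₄ (.comp t₃ h₃ x z) y))
  | unit_comp {q q₂ : Corolla Ξ} {ξ : Ξ} (t : Tree₂ q (Corolla.one ξ) q₂)
      (σ : Corolla.Iso q₂ q) (hσ : ∀ y, t.src (σ.toEquiv y) = Sum.inr y) {j : ℤ} (h : 0 + j = j)
      (b : Pre P q₂ j) : Rel P (.comp t h (.unit ξ) b) (.act σ b)
  | comp_unit {q q₁ : Corolla Ξ} {ξ : Ξ} (t : Tree₂ q q₁ (Corolla.one ξ))
      (σ : Corolla.Iso q₁ q)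
      (hσ : ∀ x, t.src (σ.toEquiv x) = if x = t.edge then Sum.inr (0 : Fin 1) else Sum.inl x)
      {i : ℤ} (h : i + 0 = i) (a : Pre P q₁ i) : Rel P (.comp t h a (.unit ξ)) (.act σ a)

/-- The components of the free operad. -/
def FreeObj (P : Coll.{uK, uC, u} K Ξ) (q : Corolla Ξ) (i : ℤ) : Type (max uK uC u) :=
  Quot (Rel P (q := q) (i := i))

namespace FreeObj

variable {P : Coll.{uK, uC, u} K Ξ}

def mk {q : Corolla Ξ} {i : ℤ} (a : Pre P q i) : FreeObj P q i := Quot.mk _ a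

theorem sound {q : Corolla Ξ} {i : ℤ} {a b : Pre P q i} (h : Rel P a b) : mk a = mk b :=
  Quot.sound h

theorem ind {q : Corolla Ξ} {i : ℤ} {C : FreeObj P q i → Prop} (h : ∀ a, C (mk a))
    (x : FreeObj P q i) : C x := Quot.ind h x

instance {q : Corolla Ξ} {i : ℤ} : Zero (FreeObj P q i) := ⟨mk .zero⟩

instance {q : Corolla Ξ} {i : ℤ} : Add (FreeObj P q i) :=
  ⟨Quot.map₂ Pre.add (fun a _ _ h => .add_right a h) (fun _ _ b h => .add_left b h)⟩

instance {q : Corolla Ξ} {i : ℤ} : SMul K (FreeObj P q i) :=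
  ⟨fun r => Quot.map (Pre.smul r) (fun _ _ h => .smul_congr r h)⟩

theorem mk_zero {q : Corolla Ξ} {i : ℤ} : mk (.zero : Pre P q i) = 0 := rfl

theorem mk_add {q : Corolla Ξ} {i : ℤ} (a b : Pre P q i) : mk (.add a b) = mk a + mk b := rfl

theorem mk_smul {q : Corolla Ξ} {i : ℤ} (r : K) (a : Pre P q i) :
    mk (.smul r a) = r • mk a := rfl

instance {q : Corolla Ξ} {i : ℤ} : AddCommMonoid (FreeObj P q i) where
  add_assoc x y z := by
    induction x using ind
    induction y using ind
    induction z using ind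
    exact sound (.add_assoc _ _ _)
  add_comm x y := by
    induction x using ind
    induction y using ind
    exact sound (.add_comm _ _)
  zero_add x := by
    induction x using ind
    exact sound (.zero_add _)
  add_zero x := by
    induction x using ind
    exact (sound (.add_comm _ _)).trans (sound (.zero_add _))
  nsmul := nsmulRec

instance {q : Corolla Ξ} {i : ℤ} : Module K (FreeObj P q i) where
  one_smul x := by
    induction x using ind
    exact sound (.one_smul _)
  mul_smul r s x := by
    induction x using ind
    exact sound (.mul_smul _ _ _)
  smul_add r x y := by
    induction x using ind
    induction y using ind
    exact sound (.smul_add _ _ _)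
  add_smul r s x := by
    induction x using ind
    exact sound (.add_smul _ _ _)
  zero_smul x := by
    induction x using ind
    exact sound (.zero_smul _)
  smul_zero r := by
    have h : (0 : FreeObj P q i) = (0 : K) • (0 : FreeObj P q i) :=
      (sound (.zero_smul _)).symm
    rw [h]
    exact (sound (.mul_smul r 0 .zero)).symm.trans (by rw [mul_zero]; rfl)

instance {q : Corolla Ξ} {i : ℤ} : AddCommGroup (FreeObj P q i) :=
  Module.addCommMonoidToAddCommGroup K

end FreeObj

open FreeObj

/-- The free operad `OP(s P)` generated by the suspension `s P` of the collection `P`. -/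
def FreeOp (P : Coll.{uK, uC, u} K Ξ) : Operad.{uK, uC, max uK uC u} K Ξ where
  obj := FreeObj P
  act σ :=
    { toFun := Quot.map (Pre.act σ) (fun _ _ h => .act_congr σ h)
      map_add' := by
        intro x y
        induction x using ind
        induction y using ind
        exact sound (.act_add _ _ _)
      map_smul' := by
        intro r x
        induction x using ind
        exact sound (.act_smul _ _ _) }
  act_refl x := by
    induction x using ind
    exact sound (.act_refl _)
  act_trans σ τ x := by
    induction x using ind
    exact sound (.act_trans _ _ _)
  unit ξ := mk (.unit ξ)
  comp := @fun q q₁ q₂ t i j k h => LinearMap.mk₂ K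
    (Quot.map₂ (Pre.comp t h) (fun a _ _ r => .comp_right t h a r)
      (fun _ _ b r => .comp_left t h b r))
    (by
      intro x y z
      induction x using ind
      induction y using ind
      induction z using ind
      exact sound (.comp_add_left _ _ _ _ _))
    (by
      intro r x y
      induction x using ind
      induction y using ind
      exact sound (.comp_smul_left _ _ _ _ _))
    (by
      intro x y z
      induction x using ind
      induction y using ind
      induction z using ind
      exact sound (.comp_add_right _ _ _ _ _))
    (by
      intro r x y
      induction x using ind
      induction y using ind
      exact sound (.comp_smul_right _ _ _ _ _))
  act_comp := @fun q q₁ q₂ q' q₁' q₂' t t' σ σ₁ σ₂ hc i j k h x y => by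
    induction x using ind
    induction y using ind
    exact sound (.act_comp t t' σ σ₁ σ₂ hc h _ _)
  comp_seq := @fun q q₁ q₂ q₃ q₁₂ q₂₃ t₁ t₂ t₃ t₄ hc a b c ab bc k h₁ h₂ h₃ h₄ x y z => by
    induction x using ind
    induction y using ind
    induction z using ind
    exact sound (.comp_seq t₁ t₂ t₃ t₄ hc h₁ h₂ h₃ h₄ _ _ _)
  comp_par := @fun q q₁ q₂ q₃ q₁₂ q₁₃ t₁ t₂ t₃ t₄ hc a b c ab ac k h₁ h₂ h₃ h₄ x y z => by
    induction x using ind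
    induction y using ind
    induction z using ind
    exact sound (.comp_par t₁ t₂ t₃ t₄ hc h₁ h₂ h₃ h₄ _ _ _)
  unit_comp := @fun q q₂ ξ t σ hσ j h y => by
    induction y using ind
    exact sound (.unit_comp t σ hσ h _)
  comp_unit := @fun q q₁ ξ t σ hσ i h x => by
    induction x using ind
    exact sound (.comp_unit t σ hσ h _)

/-- The class of a formal expression. -/
def cl {P : Coll.{uK, uC, u} K Ξ} {q : Corolla Ξ} {i : ℤ} (a : Pre P q i) :
    (FreeOp P).obj q i := FreeObj.mk a

section

variable {P : Coll.{uK, uC, u} K Ξ}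

theorem cl_sound {q : Corolla Ξ} {i : ℤ} {a b : Pre P q i} (h : Rel P a b) : cl a = cl b :=
  Quot.sound h

theorem cl_zero {q : Corolla Ξ} {i : ℤ} : cl (.zero : Pre P q i) = 0 := rfl

theorem cl_add {q : Corolla Ξ} {i : ℤ} (a b : Pre P q i) : cl (.add a b) = cl a + cl b := rfl

theorem cl_smul {q : Corolla Ξ} {i : ℤ} (r : K) (a : Pre P q i) :
    cl (.smul r a) = r • cl a := rfl

theorem cl_comp {q q₁ q₂ : Corolla Ξ} (t : Tree₂ q q₁ q₂) {i j k : ℤ} (h : i + j = k)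
    (a : Pre P q₁ i) (b : Pre P q₂ j) :
    cl (.comp t h a b) = (FreeOp P).comp t h (cl a) (cl b) := rfl

theorem cl_act {q q' : Corolla Ξ} {i : ℤ} (σ : Corolla.Iso q q') (a : Pre P q i) :
    cl (.act σ a) = (FreeOp P).act σ (cl a) := rfl

theorem cl_unit (ξ : Ξ) : cl (.unit ξ : Pre P _ _) = (FreeOp P).unit ξ := rfl

theorem cl_ind {q : Corolla Ξ} {i : ℤ} {C : (FreeOp P).obj q i → Prop} (h : ∀ a, C (cl a))
    (x : (FreeOp P).obj q i) : C x := Quot.ind h x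

end

/-- The suspension `s : P → OP(s P)`, a map of collections of degree `1`. -/
def susp (P : Coll.{uK, uC, u} K Ξ) : HomColl P (FreeOp P).toColl 1 where
  app h :=
    { toFun := fun x => cl (.gen h x)
      map_add' := fun x y => cl_sound (.gen_add h x y)
      map_smul' := fun r x => cl_sound (.gen_smul h r x) }
  app_act h σ x := cl_sound (.gen_act σ h x)

/-- Induction principle: the free operad is generated by the suspended elements. -/
theorem FreeOp.induction {P : Coll.{uK, uC, u} K Ξ}
    {C : ∀ {q : Corolla Ξ} {i : ℤ}, (FreeOp P).obj q i → Prop}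
    (gen : ∀ {q : Corolla Ξ} {p i : ℤ} (h : p + 1 = i) (x : P.obj q p), C ((susp P).app h x))
    (unit : ∀ ξ : Ξ, C ((FreeOp P).unit ξ))
    (comp : ∀ {q q₁ q₂ : Corolla Ξ} (t : Tree₂ q q₁ q₂) {i j k : ℤ} (h : i + j = k)
      (x : (FreeOp P).obj q₁ i) (y : (FreeOp P).obj q₂ j), C x → C y →
      C ((FreeOp P).comp t h x y))
    (act : ∀ {q q' : Corolla Ξ} {i : ℤ} (σ : Corolla.Iso q q') (x : (FreeOp P).obj q i), C x →
      C ((FreeOp P).act σ x))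
    (zero : ∀ {q : Corolla Ξ} {i : ℤ}, C (0 : (FreeOp P).obj q i))
    (add : ∀ {q : Corolla Ξ} {i : ℤ} (x y : (FreeOp P).obj q i), C x → C y → C (x + y))
    (smul : ∀ {q : Corolla Ξ} {i : ℤ} (r : K) (x : (FreeOp P).obj q i), C x → C (r • x))
    {q : Corolla Ξ} {i : ℤ} (x : (FreeOp P).obj q i) : C x := by
  refine cl_ind (C := fun x => C x) (fun a => ?_) x
  clear x
  induction a with
  | gen h x => exact gen h x
  | unit ξ => exact unit ξ
  | comp t h a b ha hb => exact comp t h _ _ ha hb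
  | act σ a ha => exact act σ _ ha
  | zero => exact zero
  | add a b ha hb => exact add _ _ ha hb
  | smul r a ha => exact smul r _ ha

/-! ### Derivations of the free operad -/

section Der

variable {P : Coll.{uK, uC, u} K Ξ} {d c : ℤ}

/-- The value of the derivation extending `δ` on a formal expression. -/
def preDer (δ : HomColl P (FreeOp P).toColl c) (hc : d + 1 = c) :
    ∀ {q : Corolla Ξ} {i : ℤ}, Pre P q i → ∀ {j : ℤ}, i + d = j → (FreeOp P).obj q j
  | _, _, .gen h x, _, hj => δ.app (by omega) x
  | _, _, .unit _, _, _ => 0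
  | _, _, @Pre.comp _ _ _ _ _ _ _ t i j _ h a b, _, hj =>
    (FreeOp P).comp t (by omega) (preDer δ hc a (rfl : i + d = i + d)) (cl b) +
      (-1 : K) ^ (d * i) • (FreeOp P).comp t (by omega) (cl a) (preDer δ hc b (rfl : j + d = j + d))
  | _, _, .act σ a, _, hj => (FreeOp P).act σ (preDer δ hc a hj)
  | _, _, .zero, _, _ => 0
  | _, _, .add a b, _, hj => preDer δ hc a hj + preDer δ hc b hj
  | _, _, .smul r a, _, hj => r • preDer δ hc a hj

theorem sign_congr (K : Type uK) [Field K] {m n : ℤ} (h : Even (m - n)) :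
    (-1 : K) ^ m = (-1 : K) ^ n := by
  obtain ⟨r, hr⟩ := h
  have hm : m = n + 2 * r := by omega
  have h0 : (-1 : K) ≠ 0 := neg_ne_zero.2 one_ne_zero
  rw [hm, zpow_add₀ h0, zpow_mul]
  simp

theorem sign_mul (K : Type uK) [Field K] (m n : ℤ) :
    (-1 : K) ^ m * (-1 : K) ^ n = (-1 : K) ^ (m + n) :=
  (zpow_add₀ (neg_ne_zero.2 one_ne_zero) m n).symm

theorem preDer_comp (δ : HomColl P (FreeOp P).toColl c) (hc : d + 1 = c) {q q₁ q₂ : Corolla Ξ}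
    (t : Tree₂ q q₁ q₂) {i j k i' j' k' : ℤ} (h : i + j = k) (hi : i + d = i') (hj : j + d = j')
    (hk : k + d = k') (h₁ : i' + j = k') (h₂ : i + j' = k') (a : Pre P q₁ i) (b : Pre P q₂ j) :
    preDer δ hc (.comp t h a b) hk = (FreeOp P).comp t h₁ (preDer δ hc a hi) (cl b) +
      (-1 : K) ^ (d * i) • (FreeOp P).comp t h₂ (cl a) (preDer δ hc b hj) := by
  subst hi hj
  rfl

theorem preDer_rel (δ : HomColl P (FreeOp P).toColl c) (hc : d + 1 = c) {q : Corolla Ξ} {i : ℤ}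
    {a b : Pre P q i} (h : Rel P a b) {j : ℤ} (hj : i + d = j) :
    preDer δ hc a hj = preDer δ hc b hj := by
  induction h generalizing j with
  | comp_left t h b r ih =>
    rw [preDer_comp δ hc t h rfl rfl hj (by omega) (by omega),
      preDer_comp δ hc t h rfl rfl hj (by omega) (by omega), ih, cl_sound r]
  | comp_right t h a r ih =>
    rw [preDer_comp δ hc t h rfl rfl hj (by omega) (by omega),
      preDer_comp δ hc t h rfl rfl hj (by omega) (by omega), ih, cl_sound r]
  | act_congr σ r ih => simp only [preDer, ih]
  | add_left b r ih => simp only [preDer, ih]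
  | add_right a r ih => simp only [preDer, ih]
  | smul_congr s r ih => simp only [preDer, ih]
  | add_assoc a b c => simp only [preDer, _root_.add_assoc]
  | add_comm a b => simp only [preDer, _root_.add_comm]
  | zero_add a => simp only [preDer, _root_.zero_add]
  | one_smul a => simp only [preDer, _root_.one_smul]
  | mul_smul r s a => simp only [preDer, SemigroupAction.mul_smul]
  | smul_add r a b => simp only [preDer, _root_.smul_add]
  | add_smul r s a => simp only [preDer, _root_.add_smul]
  | zero_smul a => simp only [preDer, _root_.zero_smul]
  | gen_add h x y => simp only [preDer, map_add]
  | gen_smul h r x => simp only [preDer, map_smul]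
  | gen_act σ h x => simp only [preDer, HomColl.app_act]
  | act_add σ a b => simp only [preDer, map_add]
  | act_smul σ r a => simp only [preDer, map_smul]
  | comp_add_left t h a a' b =>
    simp only [preDer, cl_add, map_add, LinearMap.add_apply, _root_.smul_add]
    abel
  | comp_smul_left t h r a b =>
    simp only [preDer, cl_smul, map_smul, LinearMap.smul_apply, _root_.smul_add, smul_comm _ r]
  | comp_add_right t h a b b' =>
    simp only [preDer, cl_add, map_add, _root_.smul_add]
    abel
  | comp_smul_right t h r a b =>
    simp only [preDer, cl_smul, map_smul, _root_.smul_add, smul_comm _ r]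
  | act_refl a => simp only [preDer, (FreeOp P).act_refl]
  | act_trans σ τ a => simp only [preDer, (FreeOp P).act_trans]
  | act_comp t t' σ σ₁ σ₂ hcc h a b =>
    simp only [preDer, map_add, map_smul, cl_act, (FreeOp P).act_comp t t' σ σ₁ σ₂ hcc]
  | @comp_seq _ _ _ _ _ _ t₁ t₂ t₃ t₄ hcc a b c ab bc k h₁ h₂ h₃ h₄ x y z =>
    rw [preDer_comp δ hc t₂ h₂ rfl rfl hj (by omega) (by omega),
      preDer_comp δ hc t₁ h₁ rfl rfl rfl (by omega) (by omega),
      preDer_comp δ hc t₄ h₄ rfl rfl hj (by omega) (by omega),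
      preDer_comp δ hc t₃ h₃ rfl rfl rfl (by omega) (by omega)]
    simp only [map_add, map_smul, LinearMap.add_apply, LinearMap.smul_apply, cl_comp,
      _root_.smul_add, smul_smul, sign_mul]
    rw [(FreeOp P).comp_seq t₁ t₂ t₃ t₄ hcc _ _ h₃ (by omega),
      (FreeOp P).comp_seq t₁ t₂ t₃ t₄ hcc _ _ (show (b + d) + c = bc + d by omega) (by omega),
      (FreeOp P).comp_seq t₁ t₂ t₃ t₄ hcc _ _ (show b + (c + d) = bc + d by omega) (by omega),
      show d * a + d * b = d * ab by rw [← h₁, mul_add], _root_.add_assoc]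
  | @comp_par _ _ _ _ _ _ t₁ t₂ t₃ t₄ hcc a b c ab ac k h₁ h₂ h₃ h₄ x y z =>
    simp only [preDer.eq_7]
    rw [preDer_comp δ hc t₂ h₂ rfl rfl hj (by omega) (by omega),
      preDer_comp δ hc t₁ h₁ rfl rfl rfl (by omega) (by omega),
      preDer_comp δ hc t₄ h₄ rfl rfl hj (by omega) (by omega),
      preDer_comp δ hc t₃ h₃ rfl rfl rfl (by omega) (by omega)]
    simp only [map_add, map_smul, LinearMap.add_apply, LinearMap.smul_apply, cl_comp,
      _root_.smul_add, smul_smul, sign_mul]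
    rw [(FreeOp P).comp_par t₁ t₂ t₃ t₄ hcc _ _ (show (a + d) + c = ac + d by omega) (by omega),
      (FreeOp P).comp_par t₁ t₂ t₃ t₄ hcc _ _ h₃ (by omega) (cl x) (preDer δ hc y _),
      (FreeOp P).comp_par t₁ t₂ t₃ t₄ hcc _ _ (show a + (c + d) = ac + d by omega) (by omega)]
    simp only [smul_smul, sign_mul]
    rw [sign_congr K (show Even ((d * a + (b + d) * c) - (b * c + d * ac)) from
        ⟨0, by rw [← h₃]; ring⟩),
      sign_congr K (show Even ((d * ab + b * (c + d)) - (b * c + d * a)) from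
        ⟨b * d, by rw [← h₁]; ring⟩)]
    exact add_right_comm _ _ _
  | unit_comp t σ hσ h b =>
    rw [preDer_comp δ hc t h rfl hj hj (by omega) (by omega)]
    simp only [preDer, map_zero, LinearMap.zero_apply, _root_.zero_add, mul_zero, zpow_zero,
      _root_.one_smul]
    exact (FreeOp P).unit_comp t σ hσ _ _
  | comp_unit t σ hσ h a =>
    rw [preDer_comp δ hc t h hj rfl hj (by omega) (by omega)]
    simp only [preDer, map_zero, smul_zero, _root_.add_zero]
    exact (FreeOp P).comp_unit t σ hσ _ _

/-- The derivation of degree `d` of `OP(s P)` with `D ∘ s = δ`. -/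
def freeDer (δ : HomColl P (FreeOp P).toColl c) (hc : d + 1 = c) : Derivation (FreeOp P) d where
  toHom :=
    { app := fun h =>
        { toFun := Quot.lift (fun a => preDer δ hc a h) (fun _ _ r => preDer_rel δ hc r h)
          map_add' := by
            intro x y
            induction x using cl_ind
            induction y using cl_ind
            rfl
          map_smul' := by
            intro r x
            induction x using cl_ind
            rfl }
      app_act := by
        intro q q' i j h σ x
        induction x using cl_ind
        rfl }
  leibniz := @fun q q₁ q₂ t i j k i' j' k' h hi hj hk h₁ h₂ x y => by
    induction x using cl_ind
    induction y using cl_ind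
    exact preDer_comp δ hc t h hi hj hk h₁ h₂ _ _

theorem freeDer_susp (δ : HomColl P (FreeOp P).toColl c) (hc : d + 1 = c) {q : Corolla Ξ}
    {p i j : ℤ} (h : p + 1 = i) (h' : i + d = j) (h'' : p + c = j) (x : P.obj q p) :
    (freeDer δ hc).toHom.app h' ((susp P).app h x) = δ.app h'' x := rfl

theorem freeDer_unit (δ : HomColl P (FreeOp P).toColl c) (hc : d + 1 = c) (ξ : Ξ) {j : ℤ}
    (h : 0 + d = j) : (freeDer δ hc).toHom.app h ((FreeOp P).unit ξ) = 0 := rfl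

end Der

end Free


/-! ### The cobar construction -/

section Cobar

variable {K : Type uK} [Field K] {Ξ : Type uC}

/-- `x ↦ - s (∂_P x) - (s • s)(x)`, the restriction of the cobar differential to generators. -/
def cobarGen (P : PseudoCooperad.{uK, uC, u} K Ξ) :
    HomColl P.toColl (FreeOp P.toColl).toColl 2 where
  app {_ i j} h := -((susp P.toColl).app (show (i + 1) + 1 = j by omega) ∘ₗ P.d.app rfl) -
    (bullet (susp P.toColl) (susp P.toColl) (show (1 : ℤ) + 1 = 2 by norm_num)).app h
  app_act h σ x := by simp [HomColl.app_act]

/-- The cobar differential on `OP(s P)`. -/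
def cobarD (P : PseudoCooperad.{uK, uC, u} K Ξ) : Derivation (FreeOp P.toColl) 1 :=
  freeDer (cobarGen P) (show (1 : ℤ) + 1 = 2 by norm_num)

section Graft

/-- Two corollas can be glued along edges of the same colour. -/
theorem exists_graft (q₁ q₂ : Corolla Ξ) (e : Fin q₁.arity) (h : q₁.color e = q₂.out) :
    ∃ (q : Corolla Ξ) (t : Tree₂ q q₁ q₂), t.edge = e := by
  let ε := Finite.equivFin {z : Fin q₁.arity ⊕ Fin q₂.arity // z ≠ Sum.inl e}
  refine ⟨⟨_, fun ℓ => Sum.elim q₁.color q₂.color (ε.symm ℓ).1, q₁.out⟩,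
    ⟨e, fun ℓ => (ε.symm ℓ).1, ?_, ?_, fun _ => rfl, h, rfl⟩, rfl⟩
  · exact Subtype.val_injective.comp ε.symm.injective
  · intro z
    constructor
    · rintro ⟨ℓ, rfl⟩
      exact (ε.symm ℓ).2
    · intro hz
      exact ⟨ε ⟨z, hz⟩, by simp⟩

theorem exists_seq {q q₁ q₂ q₃ q₁₂ : Corolla Ξ} (t₁ : Tree₂ q₁₂ q₁ q₂) (t₂ : Tree₂ q q₁₂ q₃)
    (e : Fin q₂.arity) (he : t₁.src t₂.edge = Sum.inr e) :
    ∃ (q₂₃ : Corolla Ξ) (t₃ : Tree₂ q₂₃ q₂ q₃) (t₄ : Tree₂ q q₁ q₂₃), SeqCompat t₁ t₂ t₃ t₄ := by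
  have hcol : q₂.color e = q₃.out := by
    have := t₁.color_eq t₂.edge
    rw [he] at this
    rw [← t₂.edge_eq, this]
    rfl
  obtain ⟨q₂₃, t₃, ht₃⟩ := exists_graft q₂ q₃ e hcol
  have hinj : Function.Injective fun ℓ =>
      Equiv.sumAssoc _ _ _ (Sum.map t₁.src (id : Fin q₃.arity → _) (t₂.src ℓ)) :=
    (Equiv.injective _).comp
      ((Sum.map_injective.2 ⟨t₁.src_injective, Function.injective_id⟩).comp t₂.src_injective)
  have hinj3 : Function.Injective (Sum.map (id : Fin q₁.arity → _) t₃.src) :=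
    Sum.map_injective.2 ⟨Function.injective_id, t₃.src_injective⟩
  have hne : ∀ ℓ, Equiv.sumAssoc _ _ _ (Sum.map t₁.src (id : Fin q₃.arity → _) (t₂.src ℓ)) ≠
      Sum.inr (Sum.inl e) := by
    intro ℓ h
    rcases hz : t₂.src ℓ with z | z
    · rw [hz] at h
      rcases hw : t₁.src z with w | w
      · simp [hw] at h
      · simp [hw] at h
        have : z = t₂.edge := t₁.src_injective (by rw [hw, he, h])
        exact (t₂.src_range (Sum.inl z)).1 ⟨ℓ, hz⟩ (by rw [this])
    · simp [hz] at h
  have hex : ∀ ℓ, ∃ w : Fin q₁.arity ⊕ Fin q₂₃.arity, Sum.map id t₃.src w =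
      Equiv.sumAssoc _ _ _ (Sum.map t₁.src (id : Fin q₃.arity → _) (t₂.src ℓ)) := by
    intro ℓ
    rcases hz : Equiv.sumAssoc _ _ _ (Sum.map t₁.src (id : Fin q₃.arity → _) (t₂.src ℓ)) with z | z
    · exact ⟨Sum.inl z, rfl⟩
    · obtain ⟨y, hy⟩ := (t₃.src_range z).2 (by
        rw [ht₃]
        rintro rfl
        exact hne ℓ hz)
      exact ⟨Sum.inr y, by simp [hy]⟩
  choose f hf using hex
  have hlow : ∀ a : Fin q₁.arity, a ≠ t₁.edge → ∃ ℓ, f ℓ = Sum.inl a := by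
    intro a ha
    obtain ⟨y, hy⟩ := (t₁.src_range (Sum.inl a)).2 (by simpa using ha)
    obtain ⟨ℓ, hℓ⟩ := (t₂.src_range (Sum.inl y)).2 (by
      intro h
      rw [Sum.inl.injEq] at h
      rw [h, he] at hy
      simp at hy)
    refine ⟨ℓ, hinj3 ?_⟩
    rw [hf, hℓ]
    simp [hy]
  refine ⟨q₂₃, t₃, ⟨t₁.edge, f, ?_, ?_, ?_, ?_, ?_⟩, ?_, rfl, ?_⟩
  · intro a b hab
    apply hinj
    simp only [← hf, hab]
  · rintro (a | y)
    · constructor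
      · rintro ⟨ℓ, hℓ⟩ rfl_eq
        have h1 := hf ℓ
        rw [hℓ] at h1
        rw [Sum.inl.injEq] at rfl_eq
        subst rfl_eq
        rcases hz : t₂.src ℓ with z | z
        · rw [hz] at h1
          rcases hw : t₁.src z with w | w
          · simp [hw] at h1
            subst h1
            exact (t₁.src_range _).1 ⟨z, hw⟩ rfl
          · simp [hw] at h1
        · simp [hz] at h1
      · intro h
        exact hlow a (by simpa using h)
    · refine ⟨fun _ => by simp, fun _ => ?_⟩
      have hy : t₃.src y ≠ Sum.inl e := by
        rw [← ht₃]
        exact (t₃.src_range _).1 ⟨y, rfl⟩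
      rcases hz : t₃.src y with b | c
      · obtain ⟨x, hx⟩ := (t₁.src_range (Sum.inr b)).2 (by simp)
        obtain ⟨ℓ, hℓ⟩ := (t₂.src_range (Sum.inl x)).2 (by
          intro h
          rw [Sum.inl.injEq] at h
          rw [h, he] at hx
          exact hy (by rw [hz, Sum.inr_injective hx]))
        refine ⟨ℓ, hinj3 ?_⟩
        rw [hf, hℓ]
        simp [hx, hz]
      · obtain ⟨ℓ, hℓ⟩ := (t₂.src_range (Sum.inr c)).2 (by simp)
        refine ⟨ℓ, hinj3 ?_⟩
        rw [hf, hℓ]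
        simp [hz]
  · intro ℓ
    have h1 := hf ℓ
    rw [t₂.color_eq]
    rcases hw : f ℓ with w | w
    · rcases hz : t₂.src ℓ with z | z
      · rcases hv : t₁.src z with v | v <;> simp [hw, hz, hv] at h1
        simp [t₁.color_eq, hv, h1]
      · simp [hw, hz] at h1
    · rcases hz : t₂.src ℓ with z | z
      · rcases hv : t₁.src z with v | v <;> simp [hw, hz, hv] at h1
        simp [t₁.color_eq, t₃.color_eq, hv, h1]
      · simp [hw, hz] at h1
        simp [t₃.color_eq, h1]
  · rw [t₁.edge_eq, t₃.out_eq]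
  · rw [t₂.out_eq, t₁.out_eq]
  · rw [he, ht₃]
  · intro ℓ
    exact (hf ℓ).symm

theorem exists_par {q q₁ q₂ q₃ q₁₂ : Corolla Ξ} (t₁ : Tree₂ q₁₂ q₁ q₂) (t₂ : Tree₂ q q₁₂ q₃)
    (e : Fin q₁.arity) (he : t₁.src t₂.edge = Sum.inl e) :
    ∃ (q₁₃ : Corolla Ξ) (t₃ : Tree₂ q₁₃ q₁ q₃) (t₄ : Tree₂ q q₁₃ q₂), ParCompat t₁ t₂ t₃ t₄ := by
  have hcol : q₁.color e = q₃.out := by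
    have := t₁.color_eq t₂.edge
    rw [he] at this
    rw [← t₂.edge_eq, this]
    rfl
  have hee : t₁.edge ≠ e := by
    intro h
    exact (t₁.src_range _).1 ⟨_, he⟩ (by rw [h])
  obtain ⟨q₁₃, t₃, ht₃⟩ := exists_graft q₁ q₃ e hcol
  let sw : (Fin q₁.arity ⊕ Fin q₃.arity) ⊕ Fin q₂.arity →
      (Fin q₁.arity ⊕ Fin q₂.arity) ⊕ Fin q₃.arity :=
    Sum.elim (Sum.elim (Sum.inl ∘ Sum.inl) Sum.inr) (Sum.inl ∘ Sum.inr)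
  have hsw : Function.Injective sw := by
    rintro ((a | a) | a) ((b | b) | b) h <;> simp [sw] at h <;> simp [h]
  have hinj : Function.Injective fun ℓ =>
      (Sum.map t₁.src (id : Fin q₃.arity → _) (t₂.src ℓ)) :=
      ((Sum.map_injective.2 ⟨t₁.src_injective, Function.injective_id⟩).comp t₂.src_injective)
  have hinj3 : Function.Injective fun w => sw (Sum.map t₃.src (id : Fin q₂.arity → _) w) :=
    hsw.comp (Sum.map_injective.2 ⟨t₃.src_injective, Function.injective_id⟩)
  obtain ⟨e', he'⟩ := (t₃.src_range (Sum.inl t₁.edge)).2 (by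
    rw [ht₃]
    simpa using hee)
  have hex : ∀ ℓ, ∃ w : Fin q₁₃.arity ⊕ Fin q₂.arity, sw (Sum.map t₃.src id w) =
      Sum.map t₁.src (id : Fin q₃.arity → _) (t₂.src ℓ) := by
    intro ℓ
    rcases hz : t₂.src ℓ with z | z
    · rcases hw : t₁.src z with w | w
      · obtain ⟨y, hy⟩ := (t₃.src_range (Sum.inl w)).2 (by
          rw [ht₃]
          intro h
          rw [Sum.inl.injEq] at h
          have : z = t₂.edge := t₁.src_injective (by rw [hw, he, h])
          exact (t₂.src_range (Sum.inl z)).1 ⟨ℓ, hz⟩ (by rw [this]))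
        exact ⟨Sum.inl y, by simp [hy, sw, hw]⟩
      · exact ⟨Sum.inr w, by simp [sw, hw]⟩
    · obtain ⟨y, hy⟩ := (t₃.src_range (Sum.inr z)).2 (by simp)
      exact ⟨Sum.inl y, by simp [hy, sw]⟩
  choose f hf using hex
  refine ⟨q₁₃, t₃, ⟨e', f, ?_, ?_, ?_, ?_, ?_⟩, ?_, he', ?_⟩
  · intro a b hab
    apply hinj
    simp only [← hf, hab]
  · rintro (y | b)
    · constructor
      · rintro ⟨ℓ, hℓ⟩ h
        rw [Sum.inl.injEq] at h
        have h1 := hf ℓ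
        rw [hℓ, h] at h1
        simp only [Sum.map_inl, he', sw] at h1
        rcases hz : t₂.src ℓ with z | z
        · rw [hz] at h1
          simp at h1
          exact (t₁.src_range _).1 ⟨z, h1.symm⟩ rfl
        · simp [hz] at h1
      · intro h
        have hy : y ≠ e' := by simpa using h
        rcases hz : t₃.src y with a | c
        · obtain ⟨x, hx⟩ := (t₁.src_range (Sum.inl a)).2 (by
            intro h'
            rw [Sum.inl.injEq] at h'
            exact hy (t₃.src_injective (by rw [hz, he', h'])))
          obtain ⟨ℓ, hℓ⟩ := (t₂.src_range (Sum.inl x)).2 (by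
            intro h'
            rw [Sum.inl.injEq] at h'
            rw [h', he] at hx
            refine (t₃.src_range _).1 ⟨y, rfl⟩ ?_
            rw [hz, ht₃, Sum.inl_injective hx])
          refine ⟨ℓ, hinj3 ?_⟩
          simp only [hf, hℓ]
          simp [hx, hz, sw]
        · obtain ⟨ℓ, hℓ⟩ := (t₂.src_range (Sum.inr c)).2 (by simp)
          refine ⟨ℓ, hinj3 ?_⟩
          simp only [hf, hℓ]
          simp [hz, sw]
    · refine ⟨fun _ => by simp, fun _ => ?_⟩
      obtain ⟨x, hx⟩ := (t₁.src_range (Sum.inr b)).2 (by simp)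
      obtain ⟨ℓ, hℓ⟩ := (t₂.src_range (Sum.inl x)).2 (by
        intro h'
        rw [Sum.inl.injEq] at h'
        rw [h', he] at hx
        simp at hx)
      refine ⟨ℓ, hinj3 ?_⟩
      simp only [hf, hℓ]
      simp [hx, sw]
  · intro ℓ
    have h1 := hf ℓ
    rw [t₂.color_eq]
    rcases hw : f ℓ with w | w
    · rcases hu : t₃.src w with u | u
      · rcases hz : t₂.src ℓ with z | z
        · rcases hv : t₁.src z with v | v <;> simp [hw, hz, hv, hu, sw] at h1
          simp [t₁.color_eq, t₃.color_eq, hv, hu, h1]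
        · simp [hw, hz, hu, sw] at h1
      · rcases hz : t₂.src ℓ with z | z
        · rcases hv : t₁.src z with v | v <;> simp [hw, hz, hv, hu, sw] at h1
        · simp [hw, hz, hu, sw] at h1
          simp [t₃.color_eq, hu, h1]
    · rcases hz : t₂.src ℓ with z | z
      · rcases hv : t₁.src z with v | v <;> simp [hw, hz, hv, sw] at h1
        simp [t₁.color_eq, hv, h1]
      · simp [hw, hz, sw] at h1
  · rw [← t₁.edge_eq, t₃.color_eq, he']
    rfl
  · rw [t₂.out_eq, t₁.out_eq, t₃.out_eq]
  · rw [he, ht₃]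
  · intro ℓ
    exact (hf ℓ).symm

end Graft

end Cobar


section Square

variable {K : Type uK} [Field K] {Ξ : Type uC} {P : PseudoCooperad.{uK, uC, u} K Ξ}

/-- `(u ⊗ v) ⊗ w ↦ (-1)^{|v|} (s u ∘ s v) ∘ s w`, applied to `(Δ ⊗ 1) Δ x`. -/
def lowTriple {q q₁ q₂ q₃ q₁₂ : Corolla Ξ} (t₁ : Tree₂ q₁₂ q₁ q₂) (t₂ : Tree₂ q q₁₂ q₃)
    {a b c ab k r' r : ℤ} (h₁ : a + b = ab) (h₂ : ab + c = k) (g₁ : (a + 1) + (b + 1) = r')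
    (g₂ : r' + (c + 1) = r) : P.obj q k →ₗ[K] (FreeOp P.toColl).obj q r :=
  ((-1 : K) ^ b • TensorProduct.lift (((FreeOp P.toColl).comp t₂ g₂).compl₁₂
    (TensorProduct.lift (((FreeOp P.toColl).comp t₁ g₁).compl₁₂ ((susp P.toColl).app rfl)
      ((susp P.toColl).app rfl))) ((susp P.toColl).app rfl))) ∘ₗ
    TensorProduct.map (P.Δ t₁ h₁) LinearMap.id ∘ₗ P.Δ t₂ h₂

/-- `u ⊗ (v ⊗ w) ↦ (-1)^{|v|} s u ∘ (s v ∘ s w)`, applied to `(1 ⊗ Δ) Δ x`. -/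
def upTriple {q q₁ q₂ q₃ q₂₃ : Corolla Ξ} (t₃ : Tree₂ q₂₃ q₂ q₃) (t₄ : Tree₂ q q₁ q₂₃)
    {a b c bc k r' r : ℤ} (h₃ : b + c = bc) (h₄ : a + bc = k) (g₃ : (b + 1) + (c + 1) = r')
    (g₄ : (a + 1) + r' = r) : P.obj q k →ₗ[K] (FreeOp P.toColl).obj q r :=
  ((-1 : K) ^ b • TensorProduct.lift (((FreeOp P.toColl).comp t₄ g₄).compl₁₂
    ((susp P.toColl).app rfl)
    (TensorProduct.lift (((FreeOp P.toColl).comp t₃ g₃).compl₁₂ ((susp P.toColl).app rfl)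
      ((susp P.toColl).app rfl))))) ∘ₗ
    TensorProduct.map LinearMap.id (P.Δ t₃ h₃) ∘ₗ P.Δ t₄ h₄

theorem seq_triple {q q₁ q₂ q₃ q₁₂ q₂₃ : Corolla Ξ} (t₁ : Tree₂ q₁₂ q₁ q₂) (t₂ : Tree₂ q q₁₂ q₃)
    (t₃ : Tree₂ q₂₃ q₂ q₃) (t₄ : Tree₂ q q₁ q₂₃) (hc : SeqCompat t₁ t₂ t₃ t₄)
    {a b c ab bc k r' r'' r : ℤ} (h₁ : a + b = ab) (h₂ : ab + c = k) (h₃ : b + c = bc)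
    (h₄ : a + bc = k) (g₁ : (a + 1) + (b + 1) = r') (g₂ : r' + (c + 1) = r)
    (g₃ : (b + 1) + (c + 1) = r'') (g₄ : (a + 1) + r'' = r) (x : P.obj q k) :
    lowTriple t₁ t₂ h₁ h₂ g₁ g₂ x = upTriple t₃ t₄ h₃ h₄ g₃ g₄ x := by
  have key : ∀ z : (P.obj q₁ a ⊗[K] P.obj q₂ b) ⊗[K] P.obj q₃ c,
      TensorProduct.lift (((FreeOp P.toColl).comp t₂ g₂).compl₁₂
        (TensorProduct.lift (((FreeOp P.toColl).comp t₁ g₁).compl₁₂ ((susp P.toColl).app rfl)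
          ((susp P.toColl).app rfl))) ((susp P.toColl).app rfl)) z =
      TensorProduct.lift (((FreeOp P.toColl).comp t₄ g₄).compl₁₂
        ((susp P.toColl).app rfl)
        (TensorProduct.lift (((FreeOp P.toColl).comp t₃ g₃).compl₁₂ ((susp P.toColl).app rfl)
          ((susp P.toColl).app rfl)))) (TensorProduct.assoc K _ _ _ z) := by
    intro z
    rw [← LinearEquiv.coe_coe, ← LinearMap.comp_apply]
    congr 1
    refine TensorProduct.ext_threefold fun u v w => ?_
    simp [(FreeOp P.toColl).comp_seq t₁ t₂ t₃ t₄ hc g₁ g₂ g₃ g₄]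
  simp only [lowTriple, upTriple, LinearMap.comp_apply, LinearMap.smul_apply]
  rw [key, P.Δ_seq t₁ t₂ t₃ t₄ hc h₁ h₂ h₃ h₄]

theorem par_triple {q q₁ q₂ q₃ q₁₂ q₁₃ : Corolla Ξ} (t₁ : Tree₂ q₁₂ q₁ q₂) (t₂ : Tree₂ q q₁₂ q₃)
    (t₃ : Tree₂ q₁₃ q₁ q₃) (t₄ : Tree₂ q q₁₃ q₂) (hc : ParCompat t₁ t₂ t₃ t₄)
    {a b c ab ac k r' r'' r : ℤ} (h₁ : a + b = ab) (h₂ : ab + c = k) (h₃ : a + c = ac)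
    (h₄ : ac + b = k) (g₁ : (a + 1) + (b + 1) = r') (g₂ : r' + (c + 1) = r)
    (g₃ : (a + 1) + (c + 1) = r'') (g₄ : r'' + (b + 1) = r) (x : P.obj q k) :
    lowTriple t₁ t₂ h₁ h₂ g₁ g₂ x = - lowTriple t₃ t₄ h₃ h₄ g₃ g₄ x := by
  have key : ∀ z : (P.obj q₁ a ⊗[K] P.obj q₃ c) ⊗[K] P.obj q₂ b,
      TensorProduct.lift (((FreeOp P.toColl).comp t₂ g₂).compl₁₂
        (TensorProduct.lift (((FreeOp P.toColl).comp t₁ g₁).compl₁₂ ((susp P.toColl).app rfl)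
          ((susp P.toColl).app rfl))) ((susp P.toColl).app rfl))
          (TensorProduct.rightComm K _ _ _ z) =
      (-1 : K) ^ ((b + 1) * (c + 1)) • TensorProduct.lift (((FreeOp P.toColl).comp t₄ g₄).compl₁₂
        (TensorProduct.lift (((FreeOp P.toColl).comp t₃ g₃).compl₁₂ ((susp P.toColl).app rfl)
          ((susp P.toColl).app rfl))) ((susp P.toColl).app rfl)) z := by
    intro z
    rw [← LinearEquiv.coe_coe, ← LinearMap.comp_apply, ← LinearMap.smul_apply]
    congr 1
    refine TensorProduct.ext_threefold fun u v w => ?_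
    simp [(FreeOp P.toColl).comp_par t₁ t₂ t₃ t₄ hc g₁ g₂ g₃ g₄]
  simp only [lowTriple, LinearMap.comp_apply, LinearMap.smul_apply]
  rw [P.Δ_par t₁ t₂ t₃ t₄ hc h₁ h₂ h₃ h₄, map_smul, key]
  rw [smul_smul, smul_smul, sign_mul, sign_mul,
    sign_congr K (show Even ((b + b * c + (b + 1) * (c + 1)) - (c + 1)) from
      ⟨b * c + b, by ring⟩), ← neg_smul]
  congr 1
  rw [← sign_mul]
  simp

theorem act_lowTriple {q q₁ q₂ q₃ q₁₂ q' q₁' q₂' q₃' q₁₂' : Corolla Ξ} (t₁ : Tree₂ q₁₂ q₁ q₂)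
    (t₂ : Tree₂ q q₁₂ q₃) (t₁' : Tree₂ q₁₂' q₁' q₂') (t₂' : Tree₂ q' q₁₂' q₃')
    (σ : Corolla.Iso q q') (σ₁₂ : Corolla.Iso q₁₂ q₁₂') (σ₁ : Corolla.Iso q₁ q₁')
    (σ₂ : Corolla.Iso q₂ q₂') (σ₃ : Corolla.Iso q₃ q₃') (c₁ : t₁.Compat t₁' σ₁₂ σ₁ σ₂)
    (c₂ : t₂.Compat t₂' σ σ₁₂ σ₃)
    {a b c ab k r' r : ℤ} (h₁ : a + b = ab) (h₂ : ab + c = k) (g₁ : (a + 1) + (b + 1) = r')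
    (g₂ : r' + (c + 1) = r) (x : P.obj q k) :
    (FreeOp P.toColl).act σ (lowTriple t₁ t₂ h₁ h₂ g₁ g₂ x) =
      lowTriple t₁' t₂' h₁ h₂ g₁ g₂ (P.act σ x) := by
  simp only [lowTriple, LinearMap.comp_apply, LinearMap.smul_apply, map_smul]
  rw [P.Δ_act t₂ t₂' σ σ₁₂ σ₃ c₂]
  congr 1
  generalize P.Δ t₂ h₂ x = z
  induction z with
  | zero => simp
  | add z w hz hw => simp only [map_add, hz, hw]
  | tmul y w =>
    simp only [TensorProduct.map_tmul, LinearMap.id_apply]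
    rw [P.Δ_act t₁ t₁' σ₁₂ σ₁ σ₂ c₁]
    generalize P.Δ t₁ h₁ y = z
    induction z with
    | zero => simp
    | add z w hz hw => simp only [map_add, TensorProduct.add_tmul, hz, hw]
    | tmul u v =>
      simp [(FreeOp P.toColl).act_comp t₂ t₂' σ σ₁₂ σ₃ c₂,
        (FreeOp P.toColl).act_comp t₁ t₁' σ₁₂ σ₁ σ₂ c₁, HomColl.app_act]

theorem act_upTriple {q q₁ q₂ q₃ q₂₃ q' q₁' q₂' q₃' q₂₃' : Corolla Ξ} (t₃ : Tree₂ q₂₃ q₂ q₃)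
    (t₄ : Tree₂ q q₁ q₂₃) (t₃' : Tree₂ q₂₃' q₂' q₃') (t₄' : Tree₂ q' q₁' q₂₃')
    (σ : Corolla.Iso q q') (σ₂₃ : Corolla.Iso q₂₃ q₂₃') (σ₁ : Corolla.Iso q₁ q₁')
    (σ₂ : Corolla.Iso q₂ q₂') (σ₃ : Corolla.Iso q₃ q₃') (c₃ : t₃.Compat t₃' σ₂₃ σ₂ σ₃)
    (c₄ : t₄.Compat t₄' σ σ₁ σ₂₃)
    {a b c bc k r' r : ℤ} (h₃ : b + c = bc) (h₄ : a + bc = k) (g₃ : (b + 1) + (c + 1) = r')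
    (g₄ : (a + 1) + r' = r) (x : P.obj q k) :
    (FreeOp P.toColl).act σ (upTriple t₃ t₄ h₃ h₄ g₃ g₄ x) =
      upTriple t₃' t₄' h₃ h₄ g₃ g₄ (P.act σ x) := by
  simp only [upTriple, LinearMap.comp_apply, LinearMap.smul_apply, map_smul]
  rw [P.Δ_act t₄ t₄' σ σ₁ σ₂₃ c₄]
  congr 1
  generalize P.Δ t₄ h₄ x = z
  induction z with
  | zero => simp
  | add z w hz hw => simp only [map_add, hz, hw]
  | tmul w y =>
    simp only [TensorProduct.map_tmul, LinearMap.id_apply]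
    rw [P.Δ_act t₃ t₃' σ₂₃ σ₂ σ₃ c₃]
    generalize P.Δ t₃ h₃ y = z
    induction z with
    | zero => simp
    | add z w hz hw => simp only [map_add, TensorProduct.tmul_add, hz, hw]
    | tmul u v =>
      simp [(FreeOp P.toColl).act_comp t₄ t₄' σ σ₁ σ₂₃ c₄,
        (FreeOp P.toColl).act_comp t₃ t₃' σ₂₃ σ₂ σ₃ c₃, HomColl.app_act]

/-- The incoming edges of the upper vertex which are leaves in `S`. -/
def upLegs {q q₁ q₂ : Corolla Ξ} (t : Tree₂ q q₁ q₂) (S : Set (Fin q.arity)) :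
    Set (Fin q₂.arity) := {b | ∃ ℓ ∈ S, t.src ℓ = Sum.inr b}

/-- The incoming edges of the lower vertex which are leaves in `R`. -/
def lowLegs {q q₁ q₂ : Corolla Ξ} (t : Tree₂ q q₁ q₂) (R : Set (Fin q.arity)) :
    Set (Fin q₁.arity) := {a | ∃ ℓ ∈ R, t.src ℓ = Sum.inl a}

theorem mem_upLegs {q q₁ q₂ : Corolla Ξ} (t : Tree₂ q q₁ q₂) (S : Set (Fin q.arity))
    {ℓ : Fin q.arity} {b : Fin q₂.arity} (h : t.src ℓ = Sum.inr b) :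
    b ∈ upLegs t S ↔ ℓ ∈ S := by
  constructor
  · rintro ⟨ℓ', h', h''⟩
    rwa [← t.src_injective (h''.trans h.symm)]
  · exact fun h' => ⟨ℓ, h', h⟩

theorem mem_lowLegs {q q₁ q₂ : Corolla Ξ} (t : Tree₂ q q₁ q₂) (S : Set (Fin q.arity))
    {ℓ : Fin q.arity} {b : Fin q₁.arity} (h : t.src ℓ = Sum.inl b) :
    b ∈ lowLegs t S ↔ ℓ ∈ S := by
  constructor
  · rintro ⟨ℓ', h', h''⟩
    rwa [← t.src_injective (h''.trans h.symm)]
  · exact fun h' => ⟨ℓ, h', h⟩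

theorem edge_notMem_lowLegs {q q₁ q₂ : Corolla Ξ} (t : Tree₂ q q₁ q₂) (R : Set (Fin q.arity)) :
    t.edge ∉ lowLegs t R := by
  rintro ⟨ℓ, _, h⟩
  exact (t.src_range _).1 ⟨ℓ, h⟩ rfl

theorem mem_upper {q q₁ q₂ : Corolla Ξ} (t : Tree₂ q q₁ q₂) (ℓ : Fin q.arity) :
    ℓ ∈ t.upper ↔ ∃ b, t.src ℓ = Sum.inr b := by
  change (t.src ℓ).isRight = true ↔ _
  exact Sum.isRight_iff

theorem mem_std {q : Corolla Ξ} {S : Set (Fin q.arity)} {ξ : Ξ} (ℓ : Fin q.arity) :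
    ℓ ∈ S ↔ ∃ b, (stdTree q S ξ).src ℓ = Sum.inr b := by
  rw [← mem_upper, stdTree_upper]

theorem notMem_std {q : Corolla Ξ} {S : Set (Fin q.arity)} {ξ : Ξ} (ℓ : Fin q.arity) :
    ℓ ∉ S ↔ ∃ b, (stdTree q S ξ).src ℓ = Sum.inl b := by
  rw [mem_std (ξ := ξ)]
  rcases (stdTree q S ξ).src ℓ with z | z <;> simp

theorem seq_std (q : Corolla Ξ) (S R : Set (Fin q.arity)) (ξ ξ' : Ξ)
    {a b c ab bc k r' r'' r : ℤ} (h₁ : a + b = ab) (h₂ : ab + c = k) (h₃ : b + c = bc)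
    (h₄ : a + bc = k) (g₁ : (a + 1) + (b + 1) = r') (g₂ : r' + (c + 1) = r)
    (g₃ : (b + 1) + (c + 1) = r'') (g₄ : (a + 1) + r'' = r) (x : P.obj q k) :
    lowTriple (stdTree (lowCor q S ξ)
      (insert (stdTree q S ξ).edge (lowLegs (stdTree q S ξ) R)) ξ') (stdTree q S ξ)
      h₁ h₂ g₁ g₂ x =
    upTriple (stdTree (upCor q (S ∪ R) ξ') (upLegs (stdTree q (S ∪ R) ξ') S) ξ)
      (stdTree q (S ∪ R) ξ') h₃ h₄ g₃ g₄ x := by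
  obtain ⟨e, he⟩ := (mem_std (ξ := ξ') (stdTree q S ξ).edge).1
    (Set.mem_insert (stdTree q S ξ).edge (lowLegs (stdTree q S ξ) R))
  obtain ⟨q₂₃, t₃, t₄, hc⟩ := exists_seq _ _ e he
  rw [seq_triple _ _ t₃ t₄ hc h₁ h₂ h₃ h₄ g₁ g₂ g₃ g₄]
  have hu : ∀ ℓ, ℓ ∈ S ∪ R ↔ ℓ ∈ t₄.upper := by
    intro ℓ
    have h := hc.2.2 ℓ
    rw [mem_upper]
    rcases hz : (stdTree q S ξ).src ℓ with z | z
    · have hS : ℓ ∉ S := (notMem_std (ξ := ξ) ℓ).2 ⟨z, hz⟩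
      have hne : z ≠ (stdTree q S ξ).edge := by
        intro h'
        exact ((stdTree q S ξ).src_range (Sum.inl z)).1 ⟨ℓ, hz⟩ (by rw [h'])
      have h1 : ℓ ∈ S ∪ R ↔ z ∈ insert (stdTree q S ξ).edge (lowLegs (stdTree q S ξ) R) := by
        rw [Set.mem_insert_iff, mem_lowLegs _ _ hz]
        simp [hS, hne]
      rw [h1, mem_std (ξ := ξ')]
      rcases hw : (stdTree (lowCor q S ξ)
        (insert (stdTree q S ξ).edge (lowLegs (stdTree q S ξ) R)) ξ').src z with w | w <;>
      rcases hv : t₄.src ℓ with v | v <;> simp [hz, hw, hv] at h ⊢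
    · have hS : ℓ ∈ S := (mem_std (ξ := ξ) ℓ).2 ⟨z, hz⟩
      simp only [Set.mem_union, hS, true_or, true_iff]
      rcases hv : t₄.src ℓ with v | v
      · simp [hz, hv] at h
      · exact ⟨v, rfl⟩
  obtain ⟨σ₁, σ₂₃, c₄⟩ := t₄.exists_compat (stdTree q (S ∪ R) ξ') (Corolla.Iso.refl q)
    (fun ℓ => by rw [stdTree_upper]; exact hu ℓ) (by rw [t₃.out_eq]; rfl)
  obtain ⟨σ₂, σ₃, c₃⟩ := t₃.exists_compat
    (stdTree (upCor q (S ∪ R) ξ') (upLegs (stdTree q (S ∪ R) ξ') S) ξ) σ₂₃ (by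
      intro b
      rw [stdTree_upper]
      obtain ⟨ℓ, hℓ⟩ := (t₄.src_range (Sum.inr b)).2 (by simp)
      have h1 : (stdTree q (S ∪ R) ξ').src ℓ = Sum.inr (σ₂₃.toEquiv b) := by
        have := c₄.2 ℓ
        rw [hℓ] at this
        exact this
      rw [mem_upLegs _ _ h1, mem_upper, mem_std (ξ := ξ)]
      have h := hc.2.2 ℓ
      rw [hℓ] at h
      rcases hz : (stdTree q S ξ).src ℓ with z | z
      · rcases hw : (stdTree (lowCor q S ξ)
          (insert (stdTree q S ξ).edge (lowLegs (stdTree q S ξ) R)) ξ').src z with w | w <;>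
        rcases hv : t₃.src b with v | v <;> simp [hz, hw, hv] at h ⊢
      · rcases hv : t₃.src b with v | v <;> simp [hz, hv] at h ⊢) rfl
  have := act_upTriple t₃ t₄ _ _ _ σ₂₃ σ₁ σ₂ σ₃ c₃ c₄ h₃ h₄ g₃ g₄ x
  rwa [P.act_refl, (FreeOp P.toColl).act_refl] at this

theorem par_std (q : Corolla Ξ) (S R : Set (Fin q.arity)) (hSR : Disjoint S R) (ξ ξ' : Ξ)
    {a b c ab ac k r' r'' r : ℤ} (h₁ : a + b = ab) (h₂ : ab + c = k) (h₃ : a + c = ac)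
    (h₄ : ac + b = k) (g₁ : (a + 1) + (b + 1) = r') (g₂ : r' + (c + 1) = r)
    (g₃ : (a + 1) + (c + 1) = r'') (g₄ : r'' + (b + 1) = r) (x : P.obj q k) :
    lowTriple (stdTree (lowCor q S ξ) (lowLegs (stdTree q S ξ) R) ξ') (stdTree q S ξ)
      h₁ h₂ g₁ g₂ x =
    - lowTriple (stdTree (lowCor q R ξ') (lowLegs (stdTree q R ξ') S) ξ) (stdTree q R ξ')
      h₃ h₄ g₃ g₄ x := by
  obtain ⟨e, he⟩ := (notMem_std (ξ := ξ') (stdTree q S ξ).edge).1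
    (edge_notMem_lowLegs (stdTree q S ξ) R)
  obtain ⟨q₁₃, t₃, t₄, hc⟩ := exists_par _ _ e he
  rw [par_triple _ _ t₃ t₄ hc h₁ h₂ h₃ h₄ g₁ g₂ g₃ g₄, neg_inj]
  have hu : ∀ ℓ, ℓ ∈ R ↔ ℓ ∈ t₄.upper := by
    intro ℓ
    have h := hc.2.2 ℓ
    rw [mem_upper]
    rcases hz : (stdTree q S ξ).src ℓ with z | z
    · rw [← mem_lowLegs _ _ hz, mem_std (ξ := ξ')]
      rcases hw : (stdTree (lowCor q S ξ) (lowLegs (stdTree q S ξ) R) ξ').src z with w | w <;>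
      rcases hv : t₄.src ℓ with v | v
      · simp
      · simp [hz, hw, hv] at h
      · rcases hy : t₃.src v with y | y <;> simp [hz, hw, hv, hy] at h
      · simp
    · have hS : ℓ ∈ S := (mem_std (ξ := ξ) ℓ).2 ⟨z, hz⟩
      have hR : ℓ ∉ R := Set.disjoint_left.1 hSR hS
      simp only [hR, false_iff]
      rcases hv : t₄.src ℓ with v | v
      · simp
      · simp [hz, hv] at h
  obtain ⟨σ₁₃, σ₂, c₄⟩ := t₄.exists_compat (stdTree q R ξ') (Corolla.Iso.refl q)
    (fun ℓ => by rw [stdTree_upper]; exact hu ℓ) rfl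
  obtain ⟨σ₁, σ₃, c₃⟩ := t₃.exists_compat
    (stdTree (lowCor q R ξ') (lowLegs (stdTree q R ξ') S) ξ) σ₁₃ (by
      intro z
      rw [stdTree_upper]
      by_cases hz : z = t₄.edge
      · have h1 : σ₁₃.toEquiv z = (stdTree q R ξ').edge := by rw [c₄.1, hz]
        rw [h1, mem_upper, hz, hc.2.1]
        simp [edge_notMem_lowLegs]
      · obtain ⟨ℓ, hℓ⟩ := (t₄.src_range (Sum.inl z)).2 (by simpa using hz)
        have h1 : (stdTree q R ξ').src ℓ = Sum.inl (σ₁₃.toEquiv z) := by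
          have := c₄.2 ℓ
          rw [hℓ] at this
          exact this
        rw [mem_lowLegs _ _ h1, mem_upper, mem_std (ξ := ξ)]
        have h := hc.2.2 ℓ
        rw [hℓ] at h
        rcases hy : (stdTree q S ξ).src ℓ with y | y
        · rcases hv : t₃.src z with v | v <;> simp [hy, hv] at h ⊢
        · rcases hv : t₃.src z with v | v <;> simp [hy, hv] at h ⊢) rfl
  have := act_lowTriple t₃ t₄ _ _ _ σ₁₃ σ₁ σ₃ σ₂ c₃ c₄ h₃ h₄ g₃ g₄ x
  rwa [P.act_refl, (FreeOp P.toColl).act_refl] at this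

end Square

section Sums

theorem tensor_finsum {K V Y Z ι : Type*} [Field K] [AddCommGroup V] [Module K V]
    [AddCommGroup Y] [Module K Y] [AddCommGroup Z] [Module K Z] (φ : ι → V ⊗[K] Y →ₗ[K] Z)
    (Φ : V ⊗[K] Y →ₗ[K] Z)
    (hf : ∀ v y, (Function.support fun c => φ c (v ⊗ₜ y)).Finite)
    (h : ∀ v y, Φ (v ⊗ₜ y) = ∑ᶠ c, φ c (v ⊗ₜ y)) (z : V ⊗[K] Y) :
    (Function.support fun c => φ c z).Finite ∧ Φ z = ∑ᶠ c, φ c z := by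
  induction z with
  | zero => simp
  | tmul v y => exact ⟨hf v y, h v y⟩
  | add z w hz hw =>
    simp only [map_add]
    refine ⟨(hz.1.union hw.1).subset (Function.support_add _ _), ?_⟩
    rw [hz.2, hw.2]
    exact (finsum_add_distrib hz.1 hw.1).symm

theorem pair_finite {ι κ M : Type*} [Zero M] (f : ι × κ → M)
    (h₁ : {c | ∃ d, f (c, d) ≠ 0}.Finite) (h₂ : ∀ c, {d | f (c, d) ≠ 0}.Finite) :
    (Function.support f).Finite := by
  refine (h₁.biUnion (t := fun c => Prod.mk c '' {d | f (c, d) ≠ 0})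
    (fun c _ => (h₂ c).image _)).subset ?_
  rintro ⟨c, d⟩ h
  simp only [Set.mem_iUnion]
  exact ⟨c, ⟨d, h⟩, d, h, rfl⟩

variable {K : Type uK} [Field K] {Ξ : Type uC} {P : PseudoCooperad.{uK, uC, u} K Ξ}

/-- The terms of `(∂ ∘ ∂)(s x)` which come from applying the quadratic part of the differential to
the lower vertex. -/
def lowTerm (q : Corolla Ξ) {k r : ℤ} (h : k + 3 = r) (c : TreeIdx q)
    (c' : TreeIdx (lowCor q c.1 c.2.1)) : P.obj q k →ₗ[K] (FreeOp P.toColl).obj q r :=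
  lowTriple (stdTree (lowCor q c.1 c.2.1) c'.1 c'.2.1) (stdTree q c.1 c.2.1)
    (add_sub_cancel c'.2.2 c.2.2) (add_sub_cancel c.2.2 k)
    (show _ = c.2.2 + 2 by omega) (by omega)

/-- The terms of `(∂ ∘ ∂)(s x)` which come from applying the quadratic part of the differential to
the upper vertex. -/
def upTerm (q : Corolla Ξ) {k r : ℤ} (h : k + 3 = r) (c : TreeIdx q)
    (c' : TreeIdx (upCor q c.1 c.2.1)) : P.obj q k →ₗ[K] (FreeOp P.toColl).obj q r :=
  upTriple (stdTree (upCor q c.1 c.2.1) c'.1 c'.2.1) (stdTree q c.1 c.2.1)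
    (add_sub_cancel c'.2.2 (k - c.2.2)) (add_sub_cancel c.2.2 k)
    (show _ = k - c.2.2 + 2 by omega) (by omega)

theorem low_sum (q : Corolla Ξ) {k r : ℤ} (h : k + 3 = r) (c : TreeIdx q) (x : P.obj q k)
    (h' : (c.2.2 + 2) + ((k - c.2.2) + 1) = r) :
    (Function.support fun c' => lowTerm q h c c' x).Finite ∧
    (-1 : K) ^ c.2.2 • TensorProduct.lift
      (((FreeOp P.toColl).comp (stdTree q c.1 c.2.1) h').compl₁₂
        ((bullet (susp P.toColl) (susp P.toColl) (show (1 : ℤ) + 1 = 2 by norm_num)).app rfl)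
        ((susp P.toColl).app rfl)) (P.Δ (stdTree q c.1 c.2.1) (add_sub_cancel c.2.2 k) x) =
      ∑ᶠ c', lowTerm q h c c' x := by
  obtain ⟨S, ξ, i⟩ := c
  simp only at h' ⊢
  refine tensor_finsum (fun c' : TreeIdx (lowCor q S ξ) => ((-1 : K) ^ (i - c'.2.2) •
      TensorProduct.lift (((FreeOp P.toColl).comp (stdTree q S ξ) h').compl₁₂
    (TensorProduct.lift (((FreeOp P.toColl).comp (stdTree (lowCor q S ξ) c'.1 c'.2.1)
      (show (c'.2.2 + 1) + ((i - c'.2.2) + 1) = i + 2 by omega)).compl₁₂ ((susp P.toColl).app rfl)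
      ((susp P.toColl).app rfl))) ((susp P.toColl).app rfl))) ∘ₗ
    TensorProduct.map (P.Δ (stdTree (lowCor q S ξ) c'.1 c'.2.1) (add_sub_cancel c'.2.2 i))
      LinearMap.id) ((-1 : K) ^ i • TensorProduct.lift
      (((FreeOp P.toColl).comp (stdTree q S ξ) h').compl₁₂
        ((bullet (susp P.toColl) (susp P.toColl) (show (1 : ℤ) + 1 = 2 by norm_num)).app rfl)
        ((susp P.toColl).app rfl))) ?_ ?_ _
  · intro v y
    refine (Δ_std_finite (lowCor q S ξ) v).subset ?_
    intro c' hc' h0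
    apply hc'
    simp [h0]
  · intro v y
    have hb := bulletTerm_finite (susp P.toColl) (susp P.toColl) (lowCor q S ξ)
      (show i + (1 + 1) = i + 2 by omega) v
    have h1 : (bullet (susp P.toColl) (susp P.toColl) (show (1 : ℤ) + 1 = 2 by norm_num)).app
      (rfl : i + 2 = i + 2) v = ∑ᶠ c', bulletTerm (susp P.toColl) (susp P.toColl) (lowCor q S ξ)
      (show i + (1 + 1) = i + 2 by omega) c' v := rfl
    have h2 := map_finsum (((FreeOp P.toColl).comp (stdTree q S ξ) h').flip
      ((susp P.toColl).app rfl y)) hb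
    simp only [LinearMap.smul_apply, TensorProduct.lift.tmul, LinearMap.compl₁₂_apply, h1]
    refine (congrArg _ h2).trans ?_
    rw [smul_finsum]
    refine finsum_congr fun c' => ?_
    simp only [LinearMap.flip_apply, bulletTerm, treeTerm, convTerm, LinearMap.comp_apply,
      LinearMap.smul_apply, map_smul, TensorProduct.map_tmul, LinearMap.id_apply,
      TensorProduct.lift.tmul, LinearMap.compl₁₂_apply, smul_smul, sign_mul]
    rw [sign_congr K (show Even ((i + 1 * c'.2.2) - (i - c'.2.2)) from ⟨c'.2.2, by ring⟩)]

theorem up_sum (q : Corolla Ξ) {k r : ℤ} (h : k + 3 = r) (c : TreeIdx q) (x : P.obj q k)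
    (h' : (c.2.2 + 1) + ((k - c.2.2) + 2) = r) :
    (Function.support fun c' => upTerm q h c c' x).Finite ∧
    TensorProduct.lift
      (((FreeOp P.toColl).comp (stdTree q c.1 c.2.1) h').compl₁₂ ((susp P.toColl).app rfl)
        ((bullet (susp P.toColl) (susp P.toColl) (show (1 : ℤ) + 1 = 2 by norm_num)).app rfl))
        (P.Δ (stdTree q c.1 c.2.1) (add_sub_cancel c.2.2 k) x) =
      ∑ᶠ c', upTerm q h c c' x := by
  obtain ⟨S, ξ, i⟩ := c
  simp only at h' ⊢
  refine tensor_finsum (fun c' : TreeIdx (upCor q S ξ) => ((-1 : K) ^ c'.2.2 •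
      TensorProduct.lift (((FreeOp P.toColl).comp (stdTree q S ξ) h').compl₁₂
      ((susp P.toColl).app rfl)
    (TensorProduct.lift (((FreeOp P.toColl).comp (stdTree (upCor q S ξ) c'.1 c'.2.1)
      (show (c'.2.2 + 1) + ((k - i - c'.2.2) + 1) = k - i + 2 by omega)).compl₁₂
        ((susp P.toColl).app rfl) ((susp P.toColl).app rfl))))) ∘ₗ
    TensorProduct.map LinearMap.id
      (P.Δ (stdTree (upCor q S ξ) c'.1 c'.2.1) (add_sub_cancel c'.2.2 (k - i))))
      (TensorProduct.lift
      (((FreeOp P.toColl).comp (stdTree q S ξ) h').compl₁₂ ((susp P.toColl).app rfl)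
        ((bullet (susp P.toColl) (susp P.toColl)
          (show (1 : ℤ) + 1 = 2 by norm_num)).app rfl))) ?_ ?_ _
  · intro y v
    refine (Δ_std_finite (upCor q S ξ) v).subset ?_
    intro c' hc' h0
    apply hc'
    simp [h0]
  · intro y v
    have hb := bulletTerm_finite (susp P.toColl) (susp P.toColl) (upCor q S ξ)
      (show (k - i) + (1 + 1) = k - i + 2 by omega) v
    have h1 : (bullet (susp P.toColl) (susp P.toColl) (show (1 : ℤ) + 1 = 2 by norm_num)).app
      (rfl : k - i + 2 = k - i + 2) v = ∑ᶠ c', bulletTerm (susp P.toColl) (susp P.toColl)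
      (upCor q S ξ) (show (k - i) + (1 + 1) = k - i + 2 by omega) c' v := rfl
    have h2 := map_finsum ((FreeOp P.toColl).comp (stdTree q S ξ) h'
      ((susp P.toColl).app rfl y)) hb
    simp only [TensorProduct.lift.tmul, LinearMap.compl₁₂_apply, h1]
    refine h2.trans ?_
    refine finsum_congr fun c' => ?_
    simp only [bulletTerm, treeTerm, convTerm, LinearMap.comp_apply,
      LinearMap.smul_apply, map_smul, TensorProduct.map_tmul, LinearMap.id_apply,
      TensorProduct.lift.tmul, LinearMap.compl₁₂_apply, one_mul]

theorem comp_app_left (E : Operad.{uK, uC, u'} K Ξ) {V : Coll.{uK, uC, u} K Ξ} {d : ℤ}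
    (f : HomColl V E.toColl d) {q q₁ q₂ : Corolla Ξ} (t : Tree₂ q q₁ q₂) {i i₁ i₂ j r : ℤ}
    (h₁ : i + d = i₁) (h₂ : i + d = i₂) (e₁ : i₁ + j = r) (e₂ : i₂ + j = r) (x : V.obj q₁ i)
    (y : E.obj q₂ j) : E.comp t e₁ (f.app h₁ x) y = E.comp t e₂ (f.app h₂ x) y := by
  subst h₁ h₂
  rfl

theorem comp_app_right (E : Operad.{uK, uC, u'} K Ξ) {V : Coll.{uK, uC, u} K Ξ} {d : ℤ}
    (f : HomColl V E.toColl d) {q q₁ q₂ : Corolla Ξ} (t : Tree₂ q q₁ q₂) {i i₁ i₂ j r : ℤ}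
    (h₁ : i + d = i₁) (h₂ : i + d = i₂) (e₁ : j + i₁ = r) (e₂ : j + i₂ = r) (x : V.obj q₂ i)
    (y : E.obj q₁ j) : E.comp t e₁ y (f.app h₁ x) = E.comp t e₂ y (f.app h₂ x) := by
  subst h₁ h₂
  rfl

theorem d_convTerm {q q₁ q₂ : Corolla Ξ} (t : Tree₂ q q₁ q₂) {i j r r' : ℤ}
    (h : (i + 1) + (j + 1) = r) (hr : r + 1 = r') (e₁ : ((i + 1) + 1) + (j + 1) = r')
    (e₂ : (i + 1) + ((j + 1) + 1) = r') (e₃ : (i + 2) + (j + 1) = r')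
    (e₄ : (i + 1) + (j + 2) = r') (z : P.obj q₁ i ⊗[K] P.obj q₂ j) :
    (cobarD P).toHom.app hr (convTerm (susp P.toColl) (susp P.toColl) t h z) =
      convTerm (susp P.toColl) (susp P.toColl) t e₁
        (TensorProduct.map (P.d.app rfl) LinearMap.id z) +
      (-1 : K) ^ i • convTerm (susp P.toColl) (susp P.toColl) t e₂
        (TensorProduct.map LinearMap.id (P.d.app rfl) z) -
      (-1 : K) ^ i • TensorProduct.lift (((FreeOp P.toColl).comp t e₃).compl₁₂
        ((bullet (susp P.toColl) (susp P.toColl) (show (1 : ℤ) + 1 = 2 by norm_num)).app rfl)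
        ((susp P.toColl).app rfl)) z +
      TensorProduct.lift (((FreeOp P.toColl).comp t e₄).compl₁₂ ((susp P.toColl).app rfl)
        ((bullet (susp P.toColl) (susp P.toColl) (show (1 : ℤ) + 1 = 2 by norm_num)).app rfl))
        z := by
  induction z with
  | zero => simp
  | add z w hz hw =>
    simp only [map_add, hz, hw, smul_add]
    abel
  | tmul x y =>
    rw [convTerm_tmul, map_smul,
      (cobarD P).leibniz t h (show i + 1 + 1 = i + 2 by omega) (show j + 1 + 1 = j + 2 by omega)
        hr e₃ e₄]
    have hx : (cobarD P).toHom.app (show i + 1 + 1 = i + 2 by omega)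
      ((susp P.toColl).app rfl x) = (cobarGen P).app rfl x := rfl
    have hy : (cobarD P).toHom.app (show j + 1 + 1 = j + 2 by omega)
      ((susp P.toColl).app rfl y) = (cobarGen P).app rfl y := rfl
    rw [hx, hy]
    simp only [cobarGen, LinearMap.sub_apply, LinearMap.neg_apply, LinearMap.comp_apply,
      TensorProduct.map_tmul, LinearMap.id_apply, convTerm_tmul, TensorProduct.lift.tmul,
      LinearMap.compl₁₂_apply, map_sub, map_neg, smul_add, smul_sub, smul_neg, smul_smul,
      sign_mul, one_mul, LinearMap.sub_apply, LinearMap.neg_apply]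
    rw [comp_app_left (FreeOp P.toColl) (susp P.toColl) t (show (i + 1) + 1 = i + 2 by omega) rfl
        e₃ e₁,
      comp_app_right (FreeOp P.toColl) (susp P.toColl) t (show (j + 1) + 1 = j + 2 by omega) rfl
        e₄ e₂,
      sign_congr K (show Even ((i + i) - 0) from ⟨i, by ring⟩),
      sign_congr K (show Even ((i + (i + 1)) - 1) from ⟨i, by ring⟩),
      ← sign_mul K i 1]
    simp only [zpow_zero, zpow_one, one_smul, neg_smul, mul_neg, mul_one]
    abel

end Sums

section Sums

variable {K : Type uK} [Field K] {Ξ : Type uC} {P : PseudoCooperad.{uK, uC, u} K Ξ}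

/-- Pairs of disjoint sets of leaves. -/
def disjPairs (q : Corolla Ξ) : Set (TreeIdx q × TreeIdx q) := {p | Disjoint p.1.1 p.2.1}

/-- Pairs of nested sets of leaves. -/
def nestPairs (q : Corolla Ξ) : Set (TreeIdx q × TreeIdx q) := {p | p.2.1 ⊆ p.1.1}

/-- Index of a tree which grafts the second set of leaves on the lower vertex. -/
def lowIdx {q : Corolla Ξ} (c d : TreeIdx q) : TreeIdx (lowCor q c.1 c.2.1) :=
  (lowLegs (stdTree q c.1 c.2.1) d.1, d.2)

/-- Index of a tree which inserts a vertex, with the second set of leaves, in the inner edge. -/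
def midIdx {q : Corolla Ξ} (c d : TreeIdx q) : TreeIdx (lowCor q c.1 c.2.1) :=
  (insert (stdTree q c.1 c.2.1).edge (lowLegs (stdTree q c.1 c.2.1) d.1), d.2)

/-- Index of a tree which splits the upper vertex. -/
def upIdx {q : Corolla Ξ} (c d : TreeIdx q) : TreeIdx (upCor q c.1 c.2.1) :=
  (upLegs (stdTree q c.1 c.2.1) d.1, d.2)

theorem upLegs_bijOn {q q₁ q₂ : Corolla Ξ} (t : Tree₂ q q₁ q₂) :
    Set.BijOn (upLegs t) {S | S ⊆ t.upper} Set.univ := by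
  refine ⟨fun _ _ => trivial, ?_, ?_⟩
  · intro S hS S' hS' h
    have : ∀ S ⊆ t.upper, ∀ ℓ, ℓ ∈ S ↔ ∃ b ∈ upLegs t S, t.src ℓ = Sum.inr b := by
      intro S hS ℓ
      constructor
      · intro hℓ
        obtain ⟨b, hb⟩ := (mem_upper t ℓ).1 (hS hℓ)
        exact ⟨b, ⟨ℓ, hℓ, hb⟩, hb⟩
      · rintro ⟨b, h1, h2⟩
        exact (mem_upLegs t S h2).1 h1
    ext ℓ
    rw [this S hS, this S' hS', h]
  · intro T _
    refine ⟨{ℓ | ∃ b ∈ T, t.src ℓ = Sum.inr b}, ?_, ?_⟩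
    · rintro ℓ ⟨b, _, hb⟩
      exact (mem_upper t ℓ).2 ⟨b, hb⟩
    · ext b
      obtain ⟨ℓ, hℓ⟩ := (t.src_range (Sum.inr b)).2 (by simp)
      rw [mem_upLegs t _ hℓ]
      constructor
      · rintro ⟨b', h1, h2⟩
        rwa [Sum.inr_injective (hℓ.symm.trans h2)]
      · exact fun h => ⟨b, h, hℓ⟩

theorem lowLegs_bijOn {q q₁ q₂ : Corolla Ξ} (t : Tree₂ q q₁ q₂) :
    Set.BijOn (lowLegs t) {S | Disjoint t.upper S} {T | t.edge ∉ T} := by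
  refine ⟨fun S _ => edge_notMem_lowLegs t S, ?_, ?_⟩
  · intro S hS S' hS' h
    have : ∀ S, Disjoint t.upper S → ∀ ℓ, ℓ ∈ S ↔ ∃ b ∈ lowLegs t S, t.src ℓ = Sum.inl b := by
      intro S hS ℓ
      constructor
      · intro hℓ
        have h1 := Set.disjoint_right.1 hS hℓ
        rw [mem_upper] at h1
        rcases hb : t.src ℓ with b | b
        · exact ⟨b, ⟨ℓ, hℓ, hb⟩, rfl⟩
        · exact absurd ⟨b, hb⟩ h1
      · rintro ⟨b, h1, h2⟩
        exact (mem_lowLegs t S h2).1 h1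
    ext ℓ
    rw [this S hS, this S' hS', h]
  · intro T hT
    refine ⟨{ℓ | ∃ b ∈ T, t.src ℓ = Sum.inl b}, ?_, ?_⟩
    · refine Set.disjoint_right.2 ?_
      rintro ℓ ⟨b, _, hb⟩ h
      obtain ⟨b', hb'⟩ := (mem_upper t ℓ).1 h
      rw [hb] at hb'
      simp at hb'
    · ext b
      by_cases hbe : b = t.edge
      · subst hbe
        exact iff_of_false (edge_notMem_lowLegs t _) hT
      obtain ⟨ℓ, hℓ⟩ := (t.src_range (Sum.inl b)).2 (by simpa using hbe)
      rw [mem_lowLegs t _ hℓ]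
      constructor
      · rintro ⟨b', h1, h2⟩
        rwa [Sum.inl_injective (hℓ.symm.trans h2)]
      · exact fun h => ⟨b, h, hℓ⟩

theorem upIdx_bijOn {q : Corolla Ξ} (c : TreeIdx q) :
    Set.BijOn (upIdx c) {d | d.1 ⊆ c.1} Set.univ := by
  have h := upLegs_bijOn (stdTree q c.1 c.2.1)
  rw [stdTree_upper] at h
  refine ⟨fun _ _ => trivial, ?_, ?_⟩
  · rintro ⟨S, d⟩ hS ⟨S', d'⟩ hS' hh
    simp only [upIdx, Prod.mk.injEq] at hh
    have hSS : S = S' := h.2.1 hS hS' hh.1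
    rw [hSS, hh.2]
  · rintro ⟨T, d⟩ _
    obtain ⟨S, hS, rfl⟩ := h.2.2 (Set.mem_univ T)
    exact ⟨(S, d), hS, rfl⟩

theorem lowIdx_bijOn {q : Corolla Ξ} (c : TreeIdx q) :
    Set.BijOn (lowIdx c) {d | Disjoint c.1 d.1} {c' | (stdTree q c.1 c.2.1).edge ∉ c'.1} := by
  have h := lowLegs_bijOn (stdTree q c.1 c.2.1)
  rw [stdTree_upper] at h
  refine ⟨fun d hd => h.1 hd, ?_, ?_⟩
  · rintro ⟨S, d⟩ hS ⟨S', d'⟩ hS' hh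
    simp only [lowIdx, Prod.mk.injEq] at hh
    have hSS : S = S' := h.2.1 hS hS' hh.1
    rw [hSS, hh.2]
  · rintro ⟨T, d⟩ hT
    obtain ⟨S, hS, rfl⟩ := h.2.2 hT
    exact ⟨(S, d), hS, rfl⟩

theorem midIdx_bijOn {q : Corolla Ξ} (c : TreeIdx q) :
    Set.BijOn (midIdx c) {d | Disjoint c.1 d.1} {c' | (stdTree q c.1 c.2.1).edge ∈ c'.1} := by
  have h := lowLegs_bijOn (stdTree q c.1 c.2.1)
  rw [stdTree_upper] at h
  refine ⟨fun d _ => Set.mem_insert _ _, ?_, ?_⟩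
  · rintro ⟨S, d⟩ hS ⟨S', d'⟩ hS' hh
    simp only [midIdx, Prod.mk.injEq] at hh
    have h1 := congrArg (fun T => T \ {(stdTree q c.1 c.2.1).edge}) hh.1
    simp only [Set.insert_sdiff_of_mem _ (Set.mem_singleton _),
      Set.sdiff_singleton_eq_self (edge_notMem_lowLegs _ _)] at h1
    have hSS : S = S' := h.2.1 hS hS' h1
    rw [hSS, hh.2]
  · rintro ⟨T, d⟩ hT
    obtain ⟨S, hS, hST⟩ := h.2.2 (show T \ {(stdTree q c.1 c.2.1).edge} ∈
      {T : Set _ | (stdTree q c.1 c.2.1).edge ∉ T} from fun hm => hm.2 rfl)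
    refine ⟨(S, d), hS, ?_⟩
    simp only [midIdx, hST]
    rw [Set.insert_sdiff_singleton, Set.insert_eq_of_mem (show (stdTree q c.1 c.2.1).edge ∈ T from hT)]

theorem lowTerm_ne {q : Corolla Ξ} {k r : ℤ} (h : k + 3 = r) (x : P.obj q k) {c : TreeIdx q}
    {c'} (h' : lowTerm q h c c' x ≠ 0) :
    P.Δ (stdTree q c.1 c.2.1) (add_sub_cancel c.2.2 k) x ≠ 0 := by
  intro h0
  apply h'
  simp [lowTerm, lowTriple, h0]

theorem upTerm_ne {q : Corolla Ξ} {k r : ℤ} (h : k + 3 = r) (x : P.obj q k) {c : TreeIdx q}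
    {c'} (h' : upTerm q h c c' x ≠ 0) :
    P.Δ (stdTree q c.1 c.2.1) (add_sub_cancel c.2.2 k) x ≠ 0 := by
  intro h0
  apply h'
  simp [upTerm, upTriple, h0]

theorem indicator_pair_finite {q : Corolla Ξ} {M : Type*} [Zero M] (Y : Set (TreeIdx q × TreeIdx q))
    (f : TreeIdx q × TreeIdx q → M)
    {T : TreeIdx q → Type*} (g : ∀ c, T c → M) (e : ∀ c, TreeIdx q → T c)
    (he : ∀ c, Set.InjOn (e c) {d | (c, d) ∈ Y}) (hf : ∀ c d, f (c, d) = g c (e c d))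
    (h₁ : {c | ∃ d, g c d ≠ 0}.Finite) (h₂ : ∀ c, (Function.support (g c)).Finite) :
    (Function.support (Y.indicator f)).Finite := by
  refine pair_finite _ (h₁.subset ?_) ?_
  · rintro c ⟨d, hd⟩
    refine ⟨e c d, ?_⟩
    rw [← hf]
    exact fun h0 => hd (by simp [h0])
  · intro c
    refine Set.Finite.of_finite_image (f := e c) ((h₂ c).subset ?_) ?_
    · rintro _ ⟨d, hd, rfl⟩
      rw [Function.mem_support, ← hf]
      exact fun h0 => hd (by simp [h0])
    · refine (he c).mono ?_
      intro d hd
      by_contra hY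
      exact hd (Set.indicator_of_notMem (s := Y) (show (c, d) ∉ Y from hY) f)

theorem lowTriple_congr {q q₁ q₂ q₃ q₁₂ : Corolla Ξ} (t₁ : Tree₂ q₁₂ q₁ q₂) (t₂ : Tree₂ q q₁₂ q₃)
    {a b c ab a' b' c' ab' k r₁ r₂ r : ℤ} (ha : a = a') (hb : b = b') (hc : c = c')
    (h₁ : a + b = ab) (h₂ : ab + c = k) (g₁ : (a + 1) + (b + 1) = r₁) (g₂ : r₁ + (c + 1) = r)
    (h₁' : a' + b' = ab') (h₂' : ab' + c' = k) (g₁' : (a' + 1) + (b' + 1) = r₂)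
    (g₂' : r₂ + (c' + 1) = r) (x : P.obj q k) :
    lowTriple t₁ t₂ h₁ h₂ g₁ g₂ x = lowTriple t₁ t₂ h₁' h₂' g₁' g₂' x := by
  subst ha hb hc
  obtain rfl : ab = ab' := h₁.symm.trans h₁'
  obtain rfl : r₁ = r₂ := g₁.symm.trans g₁'
  rfl

theorem upTriple_congr {q q₁ q₂ q₃ q₂₃ : Corolla Ξ} (t₃ : Tree₂ q₂₃ q₂ q₃) (t₄ : Tree₂ q q₁ q₂₃)
    {a b c bc a' b' c' bc' k r₁ r₂ r : ℤ} (ha : a = a') (hb : b = b') (hc : c = c')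
    (h₃ : b + c = bc) (h₄ : a + bc = k) (g₃ : (b + 1) + (c + 1) = r₁) (g₄ : (a + 1) + r₁ = r)
    (h₃' : b' + c' = bc') (h₄' : a' + bc' = k) (g₃' : (b' + 1) + (c' + 1) = r₂)
    (g₄' : (a' + 1) + r₂ = r) (x : P.obj q k) :
    upTriple t₃ t₄ h₃ h₄ g₃ g₄ x = upTriple t₃ t₄ h₃' h₄' g₃' g₄' x := by
  subst ha hb hc
  obtain rfl : bc = bc' := h₃.symm.trans h₃'
  obtain rfl : r₁ = r₂ := g₃.symm.trans g₃'
  rfl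

theorem quad_sum [CharZero K] (q : Corolla Ξ) {k r : ℤ} (h : k + 3 = r) (x : P.obj q k)
    (hl : ∀ c, (Function.support fun c' => lowTerm q h c c' x).Finite)
    (hu : ∀ c, (Function.support fun c' => upTerm q h c c' x).Finite) :
    ∑ᶠ c : TreeIdx q, (- ∑ᶠ c', lowTerm q h c c' x + ∑ᶠ c', upTerm q h c c' x) = 0 := by
  have hlc : {c : TreeIdx q | ∃ d, lowTerm q h c d x ≠ 0}.Finite :=
    (Δ_std_finite q x).subset fun c ⟨d, hd⟩ => lowTerm_ne h x hd
  have huc : {c : TreeIdx q | ∃ d, upTerm q h c d x ≠ 0}.Finite :=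
    (Δ_std_finite q x).subset fun c ⟨d, hd⟩ => upTerm_ne h x hd
  let fl : TreeIdx q × TreeIdx q → (FreeOp P.toColl).obj q r :=
    fun p => lowTerm q h p.1 (lowIdx p.1 p.2) x
  let fm : TreeIdx q × TreeIdx q → (FreeOp P.toColl).obj q r :=
    fun p => lowTerm q h p.1 (midIdx p.1 p.2) x
  let fu : TreeIdx q × TreeIdx q → (FreeOp P.toColl).obj q r :=
    fun p => upTerm q h p.1 (upIdx p.1 p.2) x
  have finl : (Function.support ((disjPairs q).indicator fl)).Finite :=
    indicator_pair_finite _ fl (fun c c' => lowTerm q h c c' x) (fun c d => lowIdx c d)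
      (fun c => (lowIdx_bijOn c).2.1) (fun _ _ => rfl) hlc hl
  have finm : (Function.support ((disjPairs q).indicator fm)).Finite :=
    indicator_pair_finite _ fm (fun c c' => lowTerm q h c c' x) (fun c d => midIdx c d)
      (fun c => (midIdx_bijOn c).2.1) (fun _ _ => rfl) hlc hl
  have finu : (Function.support ((nestPairs q).indicator fu)).Finite :=
    indicator_pair_finite _ fu (fun c c' => upTerm q h c c' x) (fun c d => upIdx c d)
      (fun c => (upIdx_bijOn c).2.1) (fun _ _ => rfl) huc hu
  have hlow : ∀ c, ∑ᶠ c', lowTerm q h c c' x =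
      ∑ᶠ d, (disjPairs q).indicator fl (c, d) + ∑ᶠ d, (disjPairs q).indicator fm (c, d) := by
    intro c
    have h1 := finsum_mem_union' (f := fun c' => lowTerm q h c c' x)
      (s := {c' | (stdTree q c.1 c.2.1).edge ∉ c'.1})
      (t := {c' | (stdTree q c.1 c.2.1).edge ∈ c'.1})
      (Set.disjoint_left.2 fun _ h h' => h h') ((hl c).inter_of_right _)
      ((hl c).inter_of_right _)
    have h2 : {c' : TreeIdx (lowCor q c.1 c.2.1) | (stdTree q c.1 c.2.1).edge ∉ c'.1} ∪
        {c' | (stdTree q c.1 c.2.1).edge ∈ c'.1} = Set.univ := by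
      ext c'
      simp [em']
    rw [h2, finsum_mem_univ] at h1
    rw [h1, ← finsum_mem_eq_of_bijOn (f := fun d => fl (c, d)) (lowIdx c) (lowIdx_bijOn c)
      (fun _ _ => rfl), ← finsum_mem_eq_of_bijOn (f := fun d => fm (c, d)) (midIdx c)
      (midIdx_bijOn c) (fun _ _ => rfl), finsum_mem_def, finsum_mem_def]
    rfl
  have hup : ∀ c, ∑ᶠ c', upTerm q h c c' x = ∑ᶠ d, (nestPairs q).indicator fu (c, d) := by
    intro c
    rw [← finsum_mem_univ, ← finsum_mem_eq_of_bijOn (f := fun d => fu (c, d)) (upIdx c)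
      (upIdx_bijOn c) (fun _ _ => rfl), finsum_mem_def]
    rfl
  have hL : ∑ᶠ p ∈ disjPairs q, fl p = 0 := by
    let φ : TreeIdx q × TreeIdx q → TreeIdx q × TreeIdx q := fun p =>
      ((p.2.1, p.2.2.1, p.2.2.2 + k - p.1.2.2), (p.1.1, p.1.2.1, p.2.2.2))
    have hφ : ∀ p, φ (φ p) = p := by
      rintro ⟨⟨S, ξ, i⟩, ⟨R, ξ', a⟩⟩
      simp [φ]
    have hm : Set.MapsTo φ (disjPairs q) (disjPairs q) := fun p hp => Disjoint.symm hp
    have hb : Set.BijOn φ (disjPairs q) (disjPairs q) :=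
      Set.BijOn.mk hm (fun p _ p' _ hpp => by rw [← hφ p, hpp, hφ])
        (fun p hp => ⟨φ p, hm hp, hφ p⟩)
    have h1 : ∑ᶠ p ∈ disjPairs q, fl p = ∑ᶠ p ∈ disjPairs q, (fun p => - fl p) p := by
      refine finsum_mem_eq_of_bijOn φ hb ?_
      rintro ⟨⟨S, ξ, i⟩, ⟨R, ξ', a⟩⟩ hp
      refine (par_std q S R hp ξ ξ' _ _ (show a + (k - i) = a + k - i by omega)
        (show a + k - i + (i - a) = k by omega) _ _
        (show a + 1 + (k - i + 1) = a + k - i + 2 by omega) (by omega) x).trans ?_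
      refine congrArg Neg.neg ?_
      refine lowTriple_congr _ _ rfl ?_ ?_ _ _ _ _ _ _ _ _ x
      · change k - i = (a + k - i) - a
        omega
      · change i - a = k - (a + k - i)
        omega
    have h2 : ∑ᶠ p ∈ disjPairs q, (fun p => - fl p) p = - ∑ᶠ p ∈ disjPairs q, fl p := by
      rw [finsum_mem_def, finsum_mem_def, ← finsum_neg_distrib]
      refine finsum_congr fun p => ?_
      by_cases hp : p ∈ disjPairs q <;> simp [hp]
    rw [h2] at h1
    have h3 : (2 : K) • ∑ᶠ p ∈ disjPairs q, fl p = 0 := by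
      rw [two_smul]
      nth_rewrite 1 [h1]
      exact neg_add_cancel _
    exact (smul_eq_zero.1 h3).resolve_left two_ne_zero
  have hM : ∑ᶠ p ∈ disjPairs q, fm p = ∑ᶠ p ∈ nestPairs q, fu p := by
    let χ : TreeIdx q × TreeIdx q → TreeIdx q × TreeIdx q := fun p =>
      ((p.1.1 ∪ p.2.1, p.2.2.1, p.2.2.2), (p.1.1, p.1.2.1, p.1.2.2 - p.2.2.2))
    have hb : Set.BijOn χ (disjPairs q) (nestPairs q) := by
      refine Set.BijOn.mk (fun p _ => Set.subset_union_left) ?_ ?_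
      · rintro ⟨⟨S, ξ, i⟩, ⟨R, ξ', a⟩⟩ hp ⟨⟨S', η, i'⟩, ⟨R', η', a'⟩⟩ hp' hpp
        simp only [χ, Prod.mk.injEq] at hpp
        obtain ⟨⟨h1, rfl, rfl⟩, rfl, rfl, h2⟩ := hpp
        obtain rfl : i = i' := by omega
        have h3 : R = R' := by
          rw [← Set.union_sdiff_cancel_left (show S ∩ R ⊆ ∅ from Set.disjoint_iff.1 hp), h1,
            Set.union_sdiff_cancel_left (show S ∩ R' ⊆ ∅ from Set.disjoint_iff.1 hp')]
        rw [h3]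
      · rintro ⟨⟨U, ξ', a⟩, ⟨S, ξ, b⟩⟩ hp
        refine ⟨((S, ξ, a + b), (U \ S, ξ', a)), Set.disjoint_sdiff_right, ?_⟩
        have hU : S ∪ U \ S = U := Set.union_sdiff_cancel hp
        simp [χ, hU]
    refine finsum_mem_eq_of_bijOn χ hb ?_
    rintro ⟨⟨S, ξ, i⟩, ⟨R, ξ', a⟩⟩ hp
    refine (seq_std q S R ξ ξ' (add_sub_cancel a i) (add_sub_cancel i k)
      (show i - a + (k - i) = k - a by omega) (by omega) _ _
      (show i - a + 1 + (k - i + 1) = k - a + 2 by omega) (by omega) x).trans ?_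
    refine upTriple_congr _ _ rfl rfl ?_ _ _ _ _ _ _ _ _ x
    change k - i = k - a - (i - a)
    omega
  have sec : ∀ F : TreeIdx q × TreeIdx q → (FreeOp P.toColl).obj q r,
      (Function.support F).Finite → (Function.support fun c => ∑ᶠ d, F (c, d)).Finite := by
    intro F hF
    refine (hF.image Prod.fst).subset ?_
    intro c hc
    by_contra h0
    apply hc
    rw [← finsum_zero (α := TreeIdx q)]
    refine finsum_congr fun d => ?_
    by_contra hd
    exact h0 ⟨(c, d), hd, rfl⟩
  simp only [hlow, hup]
  rw [finsum_add_distrib, finsum_neg_distrib, finsum_add_distrib (sec _ finl) (sec _ finm),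
    ← finsum_curry _ finl, ← finsum_curry _ finm, ← finsum_curry _ finu, ← finsum_mem_def,
    ← finsum_mem_def, ← finsum_mem_def, hL, hM]
  · simp
  · refine ((sec _ finl).union (sec _ finm)).subset fun c hc => ?_
    rw [Function.mem_support, neg_ne_zero] at hc
    exact Function.support_add _ _ hc
  · exact sec _ finu

end Sums

section Sq

variable {K : Type uK} [Field K] {Ξ : Type uC} {P : PseudoCooperad.{uK, uC, u} K Ξ}

/-- `(s ⊗ s)(∂ ⊗ 1) Δ x`, multiplied in the free operad. -/
def dLeftTerm {q q₁ q₂ : Corolla Ξ} (t : Tree₂ q q₁ q₂) {i i' j k r : ℤ} (hi : i + 1 = i')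
    (h : i + j = k) (e : (i' + 1) + (j + 1) = r) : P.obj q k →ₗ[K] (FreeOp P.toColl).obj q r :=
  convTerm (susp P.toColl) (susp P.toColl) t e ∘ₗ
    TensorProduct.map (P.d.app hi) LinearMap.id ∘ₗ P.Δ t h

/-- `(s ⊗ s)(1 ⊗ ∂) Δ x`, multiplied in the free operad. -/
def dRightTerm {q q₁ q₂ : Corolla Ξ} (t : Tree₂ q q₁ q₂) {i j j' k r : ℤ} (hj : j + 1 = j')
    (h : i + j = k) (e : (i + 1) + (j' + 1) = r) : P.obj q k →ₗ[K] (FreeOp P.toColl).obj q r :=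
  convTerm (susp P.toColl) (susp P.toColl) t e ∘ₗ
    TensorProduct.map LinearMap.id (P.d.app hj) ∘ₗ P.Δ t h

theorem dLeftTerm_congr {q q₁ q₂ : Corolla Ξ} (t : Tree₂ q q₁ q₂) {a a' b i i' j k r : ℤ}
    (hai : a = i) (hbj : b = j) (ha : a + 1 = a') (hi : i + 1 = i')
    (h₁ : a + b = k) (h : i + j = k) (e₁ : (a' + 1) + (b + 1) = r)
    (e : (i' + 1) + (j + 1) = r) (x : P.obj q k) :
    dLeftTerm t ha h₁ e₁ x = dLeftTerm t hi h e x := by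
  subst hai hbj ha hi
  rfl

theorem dRightTerm_congr {q q₁ q₂ : Corolla Ξ} (t : Tree₂ q q₁ q₂) {a b b' i j j' k r : ℤ}
    (hai : a = i) (hbj : b = j) (hb : b + 1 = b') (hj : j + 1 = j')
    (h₁ : a + b = k) (h : i + j = k) (e₁ : (a + 1) + (b' + 1) = r)
    (e : (i + 1) + (j' + 1) = r) (x : P.obj q k) :
    dRightTerm t hb h₁ e₁ x = dRightTerm t hj h e x := by
  subst hai hbj hb hj
  rfl

theorem bullet_d (q : Corolla Ξ) {k r : ℤ} (h : k + 3 = r) (x : P.obj q k) :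
    (bullet (susp P.toColl) (susp P.toColl) (show (1 : ℤ) + 1 = 2 by norm_num)).app
      (show (k + 1) + 2 = r by omega) (P.d.app rfl x) =
    ∑ᶠ c : TreeIdx q, (dLeftTerm (stdTree q c.1 c.2.1) rfl (add_sub_cancel c.2.2 k)
      (show (c.2.2 + 1) + 1 + ((k - c.2.2) + 1) = r by omega) x + (-1 : K) ^ c.2.2 •
      dRightTerm (stdTree q c.1 c.2.1) rfl (add_sub_cancel c.2.2 k)
      (show (c.2.2 + 1) + ((k - c.2.2) + 1 + 1) = r by omega) x) := by
  have fin : ∀ (f : TreeIdx q → (FreeOp P.toColl).obj q r),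
      (∀ c, P.Δ (stdTree q c.1 c.2.1) (add_sub_cancel c.2.2 k) x = 0 → f c = 0) →
      (Function.support f).Finite := fun f hf =>
    (Δ_std_finite q x).subset fun c hc h0 => hc (hf c h0)
  have fl : (Function.support fun c : TreeIdx q => dLeftTerm (stdTree q c.1 c.2.1) rfl
      (add_sub_cancel c.2.2 k)
      (show (c.2.2 + 1) + 1 + ((k - c.2.2) + 1) = r by omega) x).Finite :=
    fin _ fun c h0 => by simp [dLeftTerm, h0]
  have fr : (Function.support fun c : TreeIdx q => (-1 : K) ^ c.2.2 •
      dRightTerm (stdTree q c.1 c.2.1) rfl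
      (add_sub_cancel c.2.2 k)
      (show (c.2.2 + 1) + ((k - c.2.2) + 1 + 1) = r by omega) x).Finite :=
    fin _ fun c h0 => by simp [dRightTerm, h0]
  let σ : TreeIdx q ≃ TreeIdx q :=
    Equiv.prodCongr (Equiv.refl _) (Equiv.prodCongr (Equiv.refl _) (Equiv.subRight (1 : ℤ)))
  have fl' : (Function.support fun c : TreeIdx q => dLeftTerm (stdTree q c.1 c.2.1)
      (show (c.2.2 - 1) + 1 = c.2.2 by omega) (show c.2.2 - 1 + (k + 1 - c.2.2) = k by omega)
      (show c.2.2 + 1 + ((k + 1 - c.2.2) + 1) = r by omega) x).Finite ∧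
      ∑ᶠ c : TreeIdx q, dLeftTerm (stdTree q c.1 c.2.1)
      (show (c.2.2 - 1) + 1 = c.2.2 by omega) (show c.2.2 - 1 + (k + 1 - c.2.2) = k by omega)
      (show c.2.2 + 1 + ((k + 1 - c.2.2) + 1) = r by omega) x =
      ∑ᶠ c : TreeIdx q, dLeftTerm (stdTree q c.1 c.2.1) rfl (add_sub_cancel c.2.2 k)
      (show (c.2.2 + 1) + 1 + ((k - c.2.2) + 1) = r by omega) x := by
    have he : ∀ c : TreeIdx q, dLeftTerm (stdTree q c.1 c.2.1)
      (show (c.2.2 - 1) + 1 = c.2.2 by omega) (show c.2.2 - 1 + (k + 1 - c.2.2) = k by omega)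
      (show c.2.2 + 1 + ((k + 1 - c.2.2) + 1) = r by omega) x =
      dLeftTerm (stdTree q (σ c).1 (σ c).2.1) rfl (add_sub_cancel (σ c).2.2 k)
      (show ((σ c).2.2 + 1) + 1 + ((k - (σ c).2.2) + 1) = r by omega) x := by
      rintro ⟨S, ξ, i⟩
      refine dLeftTerm_congr (stdTree q S ξ) rfl ?_ _ _ _ _ _ _ x
      change k + 1 - i = k - (i - 1)
      omega
    refine ⟨?_, finsum_eq_of_bijective σ σ.bijective he⟩
    refine (fl.preimage (f := σ) σ.injective.injOn).subset fun c hc => ?_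
    rw [Function.mem_support, he] at hc
    exact hc
  have h1 : (bullet (susp P.toColl) (susp P.toColl) (show (1 : ℤ) + 1 = 2 by norm_num)).app
      (show (k + 1) + 2 = r by omega) (P.d.app rfl x) = ∑ᶠ c : TreeIdx q,
      bulletTerm (susp P.toColl) (susp P.toColl) q (show (k + 1) + (1 + 1) = r by omega) c
      (P.d.app rfl x) := rfl
  have h2 : ∀ c : TreeIdx q,
      bulletTerm (susp P.toColl) (susp P.toColl) q (show (k + 1) + (1 + 1) = r by omega) c
      (P.d.app rfl x) = dLeftTerm (stdTree q c.1 c.2.1)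
      (show (c.2.2 - 1) + 1 = c.2.2 by omega) (show c.2.2 - 1 + (k + 1 - c.2.2) = k by omega)
      (show c.2.2 + 1 + ((k + 1 - c.2.2) + 1) = r by omega) x + (-1 : K) ^ c.2.2 •
      dRightTerm (stdTree q c.1 c.2.1) rfl (add_sub_cancel c.2.2 k)
      (show (c.2.2 + 1) + ((k - c.2.2) + 1 + 1) = r by omega) x := by
    rintro ⟨S, ξ, i⟩
    have h3 := P.Δ_d (stdTree q S ξ) (show (i - 1) + 1 = i by omega)
      (show (k - i) + 1 = k + 1 - i by omega) (rfl : k + 1 = k + 1) (add_sub_cancel i (k + 1))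
      (show i - 1 + (k + 1 - i) = k by omega) (add_sub_cancel i k) x
    simp only [bulletTerm, treeTerm, LinearMap.comp_apply]
    refine (congrArg _ h3).trans ?_
    rw [map_add, map_smul]
    refine congrArg₂ _ rfl (congrArg _ ?_)
    exact dRightTerm_congr (stdTree q S ξ) rfl rfl (show (k - i) + 1 = k + 1 - i by omega) rfl
      (add_sub_cancel i k) (add_sub_cancel i k) (by omega) (by omega) x
  rw [h1, finsum_congr h2, finsum_add_distrib fl'.1 fr, fl'.2, finsum_add_distrib fl fr]

theorem d_bullet [CharZero K] (q : Corolla Ξ) {k r : ℤ} (h : k + 3 = r) (x : P.obj q k) :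
    (cobarD P).toHom.app (show (k + 2) + 1 = r by omega) ((bullet (susp P.toColl) (susp P.toColl)
      (show (1 : ℤ) + 1 = 2 by norm_num)).app (rfl : k + 2 = k + 2) x) =
    (bullet (susp P.toColl) (susp P.toColl) (show (1 : ℤ) + 1 = 2 by norm_num)).app
      (show (k + 1) + 2 = r by omega) (P.d.app rfl x) := by
  have h1 : (bullet (susp P.toColl) (susp P.toColl)
      (show (1 : ℤ) + 1 = 2 by norm_num)).app (rfl : k + 2 = k + 2) x = ∑ᶠ c : TreeIdx q,
      bulletTerm (susp P.toColl) (susp P.toColl) q (show k + (1 + 1) = k + 2 by omega) c x := rfl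
  have hl := fun c => low_sum q h c x (by omega)
  have hu := fun c => up_sum q h c x (by omega)
  have h2 : ∀ c : TreeIdx q, (cobarD P).toHom.app (show (k + 2) + 1 = r by omega)
      (bulletTerm (susp P.toColl) (susp P.toColl) q (show k + (1 + 1) = k + 2 by omega) c x) =
      (dLeftTerm (stdTree q c.1 c.2.1) rfl (add_sub_cancel c.2.2 k)
      (show (c.2.2 + 1) + 1 + ((k - c.2.2) + 1) = r by omega) x + (-1 : K) ^ c.2.2 •
      dRightTerm (stdTree q c.1 c.2.1) rfl (add_sub_cancel c.2.2 k)
      (show (c.2.2 + 1) + ((k - c.2.2) + 1 + 1) = r by omega) x) +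
      (- ∑ᶠ c', lowTerm q h c c' x + ∑ᶠ c', upTerm q h c c' x) := by
    intro c
    rw [← (hl c).2, ← (hu c).2]
    refine (d_convTerm (stdTree q c.1 c.2.1) (by omega) (by omega) (by omega) (by omega)
      (by omega) (by omega) (P.Δ (stdTree q c.1 c.2.1) (add_sub_cancel c.2.2 k) x)).trans ?_
    simp only [dLeftTerm, dRightTerm, LinearMap.comp_apply]
    abel
  have fin : ∀ (f : TreeIdx q → (FreeOp P.toColl).obj q r),
      (∀ c, P.Δ (stdTree q c.1 c.2.1) (add_sub_cancel c.2.2 k) x = 0 → f c = 0) →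
      (Function.support f).Finite := fun f hf =>
    (Δ_std_finite q x).subset fun c hc h0 => hc (hf c h0)
  have h3 := map_finsum ((cobarD P).toHom.app (show (k + 2) + 1 = r by omega))
    (bulletTerm_finite (susp P.toColl) (susp P.toColl) q (show k + (1 + 1) = k + 2 by omega) x)
  rw [h1]
  refine h3.trans ?_
  rw [finsum_congr h2, finsum_add_distrib, quad_sum q h x (fun c => (hl c).1) (fun c => (hu c).1),
    add_zero, bullet_d q h x]
  · exact fin _ fun c h0 => by simp [dLeftTerm, dRightTerm, h0]
  · exact fin _ fun c h0 => by rw [← (hl c).2, ← (hu c).2]; simp [h0]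

theorem cobarD_sq [CharZero K] {q : Corolla Ξ} {i j k : ℤ} (h : i + 1 = j) (h' : j + 1 = k)
    (x : (FreeOp P.toColl).obj q i) :
    (cobarD P).toHom.app h' ((cobarD P).toHom.app h x) = 0 := by
  induction x using FreeOp.induction generalizing j k with
  | @gen q p i hp x =>
    obtain rfl : j = p + 2 := by omega
    have e1 : (cobarD P).toHom.app h ((susp P.toColl).app hp x) =
      (cobarGen P).app rfl x := rfl
    have e2 : (cobarD P).toHom.app h' ((susp P.toColl).app
      (show (p + 1) + 1 = p + 2 by omega) (P.d.app rfl x)) =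
      (cobarGen P).app (show (p + 1) + 2 = k by omega) (P.d.app rfl x) := rfl
    have e3 := d_bullet q (show p + 3 = k by omega) x
    rw [e1]
    simp only [cobarGen, LinearMap.sub_apply, LinearMap.neg_apply, LinearMap.comp_apply, map_sub,
      map_neg] at e2 ⊢
    rw [e2, e3, P.d_d]
    simp
  | unit ξ =>
    have e1 : (cobarD P).toHom.app h ((FreeOp P.toColl).unit ξ) = 0 := rfl
    rw [e1, map_zero]
  | @comp q q₁ q₂ t a b c habc x y hx hy =>
    rw [(cobarD P).leibniz t habc rfl rfl h (by omega) (by omega), map_add, map_smul,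
      (cobarD P).leibniz t (show a + 1 + b = j by omega) rfl rfl h' (by omega) (by omega),
      (cobarD P).leibniz t (show a + (b + 1) = j by omega) rfl rfl h' (by omega) (by omega),
      hx, hy]
    simp only [map_zero, LinearMap.zero_apply, smul_zero, zero_add, add_zero]
    rw [← add_smul, one_mul, one_mul, zpow_add₀ (neg_ne_zero.2 one_ne_zero)]
    simp
  | act σ x hx => rw [HomColl.app_act, HomColl.app_act, hx, map_zero]
  | zero => simp
  | add x y hx hy => rw [map_add, map_add, hx, hy, add_zero]
  | smul r x hx => rw [map_smul, map_smul, hx, smul_zero]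

end Sq

/-- The cobar construction: the free operad `OP(s P)` on the suspension of the collection `P`, with
the differential `∂ (s x) = - s (∂ x) - ∑_t ∑ (-1)^{|x'|} s x' ∘_t s x''`. -/
def cobar {K : Type uK} [Field K] [CharZero K] {Ξ : Type uC}
    (P : PseudoCooperad.{uK, uC, u} K Ξ) : DGOperad K Ξ where
  toOperad := FreeOp P.toColl
  d := cobarD P
  d_d h h' x := cobarD_sq h h' x

/-! ### Morphisms and cohomology -/

section Cohomology

variable {K : Type uK} [Field K] {Ξ : Type uC}

/-- Morphisms of operads in graded vector spaces. -/
structure OperadHom (E : Operad.{uK, uC, u} K Ξ) (E' : Operad.{uK, uC, u'} K Ξ) where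
  app : ∀ {q : Corolla Ξ} {i : ℤ}, E.obj q i →ₗ[K] E'.obj q i
  app_act : ∀ {q q' : Corolla Ξ} {i : ℤ} (σ : Corolla.Iso q q') (x : E.obj q i),
    app (E.act σ x) = E'.act σ (app x)
  app_unit : ∀ ξ : Ξ, app (E.unit ξ) = E'.unit ξ
  app_comp : ∀ {q q₁ q₂ : Corolla Ξ} (t : Tree₂ q q₁ q₂) {i j k : ℤ} (h : i + j = k)
    (x : E.obj q₁ i) (y : E.obj q₂ j), app (E.comp t h x y) = E'.comp t h (app x) (app y)

/-- Morphisms of dg operads. -/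
structure DGHom (O : DGOperad.{uK, uC, u} K Ξ) (O' : DGOperad.{uK, uC, u'} K Ξ) extends
    OperadHom O.toOperad O'.toOperad where
  app_d : ∀ {q : Corolla Ξ} {i j : ℤ} (h : i + 1 = j) (x : O.obj q i),
    app (O.d.toHom.app h x) = O'.d.toHom.app h (app x)

/-- A graded operad, with the zero differential. -/
def Operad.zeroDG (E : Operad.{uK, uC, u} K Ξ) : DGOperad.{uK, uC, u} K Ξ where
  toOperad := E
  d := ⟨⟨fun _ => 0, fun _ _ _ => by simp⟩, fun _ _ _ _ _ _ _ _ _ => by simp⟩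
  d_d _ _ _ := by simp

variable (O : DGOperad.{uK, uC, u} K Ξ)

/-- The cocycles of degree `i`. -/
def DGOperad.cocycles (q : Corolla Ξ) (i : ℤ) : Submodule K (O.obj q i) :=
  LinearMap.ker (O.d.toHom.app (rfl : i + 1 = i + 1))

/-- The coboundaries of degree `i`. -/
def DGOperad.coboundaries (q : Corolla Ξ) (i : ℤ) : Submodule K (O.obj q i) :=
  LinearMap.range (O.d.toHom.app (sub_add_cancel i 1))

variable {O}

theorem DGOperad.mem_cocycles {q : Corolla Ξ} {i j : ℤ} (h : i + 1 = j) (x : O.obj q i) :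
    x ∈ O.cocycles q i ↔ O.d.toHom.app h x = 0 := by
  subst h
  rfl

theorem DGOperad.mem_coboundaries {q : Corolla Ξ} {i j : ℤ} (h : j + 1 = i) (x : O.obj q i) :
    x ∈ O.coboundaries q i ↔ ∃ y : O.obj q j, O.d.toHom.app h y = x := by
  obtain rfl : j = i - 1 := by omega
  rfl

theorem DGOperad.coboundaries_le (q : Corolla Ξ) (i : ℤ) :
    O.coboundaries q i ≤ O.cocycles q i := by
  rintro _ ⟨y, rfl⟩
  exact (mem_cocycles rfl _).2 (O.d_d _ _ y)

theorem DGOperad.comp_mem_cocycles {q q₁ q₂ : Corolla Ξ} (t : Tree₂ q q₁ q₂) {i j k : ℤ}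
    (h : i + j = k) {x : O.obj q₁ i} {y : O.obj q₂ j} (hx : x ∈ O.cocycles q₁ i)
    (hy : y ∈ O.cocycles q₂ j) : O.comp t h x y ∈ O.cocycles q k := by
  rw [mem_cocycles rfl] at hx hy ⊢
  rw [O.d.leibniz t h rfl rfl rfl (by omega) (by omega), hx, hy]
  simp

theorem DGOperad.comp_mem_coboundaries_left {q q₁ q₂ : Corolla Ξ} (t : Tree₂ q q₁ q₂) {i j k : ℤ}
    (h : i + j = k) {x : O.obj q₁ i} {y : O.obj q₂ j} (hx : x ∈ O.coboundaries q₁ i)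
    (hy : y ∈ O.cocycles q₂ j) : O.comp t h x y ∈ O.coboundaries q k := by
  obtain ⟨z, rfl⟩ := hx
  rw [mem_cocycles rfl] at hy
  refine ⟨O.comp t (by omega) z y, ?_⟩
  rw [O.d.leibniz t (show i - 1 + j = k - 1 by omega) (by omega) rfl (by omega) h (by omega), hy]
  simp

theorem DGOperad.comp_mem_coboundaries_right {q q₁ q₂ : Corolla Ξ} (t : Tree₂ q q₁ q₂)
    {i j k : ℤ} (h : i + j = k) {x : O.obj q₁ i} {y : O.obj q₂ j} (hx : x ∈ O.cocycles q₁ i)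
    (hy : y ∈ O.coboundaries q₂ j) : O.comp t h x y ∈ O.coboundaries q k := by
  obtain ⟨z, rfl⟩ := hy
  rw [mem_cocycles rfl] at hx
  refine ⟨(-1 : K) ^ i • O.comp t (by omega) x z, ?_⟩
  rw [map_smul, O.d.leibniz t (show i + (j - 1) = k - 1 by omega) rfl (by omega) (by omega)
    (by omega) h, hx]
  simp only [map_zero, LinearMap.zero_apply, zero_add, smul_smul, one_mul]
  rw [← mul_zpow]
  simp

/-- The tree with two nodal vertices, both with one incoming edge. -/
def twoTree (ξ : Ξ) : Tree₂ (Corolla.one ξ) (Corolla.one ξ) (Corolla.one ξ) where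
  edge := (0 : Fin 1)
  src _ := Sum.inr (0 : Fin 1)
  src_injective a b _ := Subsingleton.elim (α := Fin 1) a b
  src_range := by
    rintro (z | z)
    · have hz : z = (0 : Fin 1) := Subsingleton.elim (α := Fin 1) _ _
      simp [hz]
    · have hz : z = (0 : Fin 1) := Subsingleton.elim (α := Fin 1) _ _
      subst hz
      exact iff_of_true ⟨(0 : Fin 1), rfl⟩ Sum.inr_ne_inl
  color_eq _ := rfl
  edge_eq := rfl
  out_eq := rfl

theorem Derivation.app_unit {E : Operad.{uK, uC, u} K Ξ} {d : ℤ} (D : Derivation E d) (ξ : Ξ)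
    {j : ℤ} (h : 0 + d = j) : D.toHom.app h (E.unit ξ) = 0 := by
  have h0 : ∀ {i : ℤ} (y : E.obj (Corolla.one ξ) i) (hi : 0 + i = i),
      E.comp (twoTree ξ) hi (E.unit ξ) y = y := by
    intro i y hi
    rw [E.unit_comp (twoTree ξ) (Corolla.Iso.refl _) (fun z => ?_) hi y, E.act_refl]
    exact congrArg Sum.inr (Subsingleton.elim (α := Fin 1) _ _)
  have h1 : ∀ {i : ℤ} (y : E.obj (Corolla.one ξ) i) (hi : i + 0 = i),
      E.comp (twoTree ξ) hi y (E.unit ξ) = y := by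
    intro i y hi
    rw [E.comp_unit (twoTree ξ) (Corolla.Iso.refl _) (fun z => ?_) hi y, E.act_refl]
    exact (if_pos (Subsingleton.elim (α := Fin 1) _ _)).symm
  have h2 := D.leibniz (twoTree ξ) (show (0 : ℤ) + 0 = 0 by norm_num) h h h (by omega) (by omega)
    (E.unit ξ) (E.unit ξ)
  rw [h0, h1, h0] at h2
  simpa using h2

theorem DGOperad.unit_mem_cocycles (ξ : Ξ) : O.unit ξ ∈ O.cocycles (Corolla.one ξ) 0 :=
  O.d.app_unit ξ rfl

theorem DGOperad.act_mem_cocycles {q q' : Corolla Ξ} (σ : Corolla.Iso q q') {i : ℤ}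
    {x : O.obj q i} (hx : x ∈ O.cocycles q i) : O.act σ x ∈ O.cocycles q' i := by
  rw [mem_cocycles rfl] at hx ⊢
  rw [HomColl.app_act, hx, map_zero]

theorem DGOperad.act_mem_coboundaries {q q' : Corolla Ξ} (σ : Corolla.Iso q q') {i : ℤ}
    {x : O.obj q i} (hx : x ∈ O.coboundaries q i) : O.act σ x ∈ O.coboundaries q' i := by
  obtain ⟨y, rfl⟩ := hx
  exact ⟨O.act σ y, HomColl.app_act _ _ _ _⟩

variable (O) in
/-- The cohomology of degree `i`. -/
abbrev DGOperad.cohObj (q : Corolla Ξ) (i : ℤ) : Type u :=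
  ↥(O.cocycles q i) ⧸ (O.coboundaries q i).submoduleOf (O.cocycles q i)

/-- The cohomology class of a cocycle. -/
def DGOperad.cls {q : Corolla Ξ} {i : ℤ} : ↥(O.cocycles q i) →ₗ[K] O.cohObj q i :=
  Submodule.mkQ _

theorem DGOperad.cls_eq_zero {q : Corolla Ξ} {i : ℤ} {x : ↥(O.cocycles q i)} :
    cls x = 0 ↔ (x : O.obj q i) ∈ O.coboundaries q i :=
  Submodule.Quotient.mk_eq_zero _

theorem DGOperad.cls_ind {q : Corolla Ξ} {i : ℤ} {C : O.cohObj q i → Prop}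
    (h : ∀ x, C (cls x)) (x : O.cohObj q i) : C x :=
  Submodule.Quotient.induction_on _ x h

/-- The composition of cocycles. -/
def DGOperad.cocComp {q q₁ q₂ : Corolla Ξ} (t : Tree₂ q q₁ q₂) {i j k : ℤ} (h : i + j = k) :
    ↥(O.cocycles q₁ i) →ₗ[K] ↥(O.cocycles q₂ j) →ₗ[K] ↥(O.cocycles q k) :=
  LinearMap.mk₂ K (fun x y => ⟨O.comp t h x y, comp_mem_cocycles t h x.2 y.2⟩)
    (fun x x' y => Subtype.ext (by simp)) (fun c x y => Subtype.ext (by simp))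
    (fun x y y' => Subtype.ext (by simp)) (fun c x y => Subtype.ext (by simp))

/-- The composition of cohomology classes. -/
def DGOperad.cohComp {q q₁ q₂ : Corolla Ξ} (t : Tree₂ q q₁ q₂) {i j k : ℤ} (h : i + j = k) :
    O.cohObj q₁ i →ₗ[K] O.cohObj q₂ j →ₗ[K] O.cohObj q k :=
  Submodule.liftQ _ (LinearMap.flip (Submodule.liftQ _ ((cocComp t h).compr₂ cls).flip (by
      intro y hy
      ext x
      exact cls_eq_zero.2 (comp_mem_coboundaries_right t h x.2 hy)))) (by
    intro x hx
    refine LinearMap.ext fun y => ?_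
    induction y using cls_ind with
    | h y => exact cls_eq_zero.2 (comp_mem_coboundaries_left t h hx y.2))

theorem DGOperad.cohComp_cls {q q₁ q₂ : Corolla Ξ} (t : Tree₂ q q₁ q₂) {i j k : ℤ} (h : i + j = k)
    (x : ↥(O.cocycles q₁ i)) (y : ↥(O.cocycles q₂ j)) :
    cohComp t h (cls x) (cls y) = cls ⟨O.comp t h x y, comp_mem_cocycles t h x.2 y.2⟩ := rfl

variable (O) in
/-- The cohomology collection. -/
def DGOperad.cohColl : Coll.{uK, uC, u} K Ξ where
  obj := O.cohObj
  act σ := Submodule.mapQ _ _ ((O.act σ).restrict fun _ hx => act_mem_cocycles σ hx)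
    fun _ hx => act_mem_coboundaries σ hx
  act_refl x := by
    induction x using cls_ind with
    | h x => exact congrArg cls (Subtype.ext (O.act_refl _))
  act_trans σ τ x := by
    induction x using cls_ind with
    | h x => exact congrArg cls (Subtype.ext (O.act_trans σ τ _))

variable (O) in
/-- The cohomology operad. -/
def DGOperad.cohomology : Operad.{uK, uC, u} K Ξ where
  toColl := O.cohColl
  unit ξ := cls ⟨O.unit ξ, unit_mem_cocycles ξ⟩
  comp t _ _ _ h := cohComp t h
  act_comp t t' σ σ₁ σ₂ hc _ _ _ h x y := by
    induction x using cls_ind with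
    | h x =>
    induction y using cls_ind with
    | h y => exact congrArg cls (Subtype.ext (O.act_comp t t' σ σ₁ σ₂ hc h x y))
  comp_seq t₁ t₂ t₃ t₄ hc _ _ _ _ _ _ h₁ h₂ h₃ h₄ x y z := by
    induction x using cls_ind with
    | h x =>
    induction y using cls_ind with
    | h y =>
    induction z using cls_ind with
    | h z =>
      exact congrArg cls (Subtype.ext (O.comp_seq t₁ t₂ t₃ t₄ hc h₁ h₂ h₃ h₄ x y z))
  comp_par t₁ t₂ t₃ t₄ hc _ _ _ _ _ _ h₁ h₂ h₃ h₄ x y z := by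
    induction x using cls_ind with
    | h x =>
    induction y using cls_ind with
    | h y =>
    induction z using cls_ind with
    | h z =>
      exact congrArg cls (Subtype.ext (O.comp_par t₁ t₂ t₃ t₄ hc h₁ h₂ h₃ h₄ x y z))
  unit_comp t σ hσ _ h y := by
    induction y using cls_ind with
    | h y => exact congrArg cls (Subtype.ext (O.unit_comp t σ hσ h y))
  comp_unit t σ hσ _ h y := by
    induction y using cls_ind with
    | h y => exact congrArg cls (Subtype.ext (O.comp_unit t σ hσ h y))

/-- The map induced by a morphism of dg operads on cohomology. -/
def DGHom.cohMap {O' : DGOperad.{uK, uC, u'} K Ξ} (f : DGHom O O') (q : Corolla Ξ) (i : ℤ) :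
    O.cohomology.obj q i →ₗ[K] O'.cohomology.obj q i :=
  Submodule.mapQ _ _ (f.app.restrict (p := O.cocycles q i) (q := O'.cocycles q i) fun x hx => by
      rw [DGOperad.mem_cocycles rfl] at hx ⊢
      rw [← f.app_d, hx, map_zero])
    (by
      rintro x ⟨y, hy⟩
      exact ⟨f.app y, by rw [← f.app_d, hy]; rfl⟩)

/-- Quasi-isomorphisms of dg operads. -/
def DGHom.IsQuasiIso {O' : DGOperad.{uK, uC, u'} K Ξ} (f : DGHom O O') : Prop :=
  ∀ (q : Corolla Ξ) (i : ℤ), Function.Bijective (f.cohMap q i)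

end Cohomology

/-! ### Gradings, weights -/

section Grading

variable {K : Type uK} [Field K] {Ξ : Type uC}

/-- A grading `P = ⨁_{k ≥ 1} G^k P` of a dg pseudo-cooperad such that
`∂ (G^k P) ⊆ G^{k-1} P` (with `G^0 P = 0`) and `Δ_t (G^m P) ⊆ ⨁_{r + s = m} G^r P ⊗ G^s P`. -/
structure Grading (P : PseudoCooperad.{uK, uC, u} K Ξ) where
  G : ℕ → ∀ (q : Corolla Ξ) (i : ℤ), Submodule K (P.obj q i)
  zero : ∀ q i, G 0 q i = ⊥
  isInternal : ∀ q i, DirectSum.IsInternal fun k => G k q i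
  act_mem : ∀ {k : ℕ} {q q' : Corolla Ξ} (σ : Corolla.Iso q q') {i : ℤ} {x : P.obj q i},
    x ∈ G k q i → P.act σ x ∈ G k q' i
  d_mem : ∀ {k : ℕ} {q : Corolla Ξ} {i j : ℤ} (h : i + 1 = j) {x : P.obj q i},
    x ∈ G (k + 1) q i → P.d.app h x ∈ G k q j
  Δ_mem : ∀ {m : ℕ} {q q₁ q₂ : Corolla Ξ} (t : Tree₂ q q₁ q₂) {i j k : ℤ} (h : i + j = k)
    {x : P.obj q k}, x ∈ G m q k → P.Δ t h x ∈ ⨆ r ∈ Finset.HasAntidiagonal.antidiagonal m,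
      LinearMap.range (TensorProduct.map (G r.1 q₁ i).subtype (G r.2 q₂ j).subtype)

/-- Membership in the suboperad generated by `S`. -/
inductive Operad.Generated (E : Operad.{uK, uC, u} K Ξ) (S : ∀ q i, Set (E.obj q i)) :
    ∀ {q : Corolla Ξ} {i : ℤ}, E.obj q i → Prop
  | base {q : Corolla Ξ} {i : ℤ} {x : E.obj q i} : x ∈ S q i → Generated E S x
  | unit (ξ : Ξ) : Generated E S (E.unit ξ)
  | comp {q q₁ q₂ : Corolla Ξ} (t : Tree₂ q q₁ q₂) {i j k : ℤ} (h : i + j = k) {x : E.obj q₁ i}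
    {y : E.obj q₂ j} : Generated E S x → Generated E S y → Generated E S (E.comp t h x y)
  | act {q q' : Corolla Ξ} (σ : Corolla.Iso q q') {i : ℤ} {x : E.obj q i} :
    Generated E S x → Generated E S (E.act σ x)
  | zero {q : Corolla Ξ} {i : ℤ} : Generated E S (0 : E.obj q i)
  | add {q : Corolla Ξ} {i : ℤ} {x y : E.obj q i} :
    Generated E S x → Generated E S y → Generated E S (x + y)
  | smul {q : Corolla Ξ} {i : ℤ} (c : K) {x : E.obj q i} :
    Generated E S x → Generated E S (c • x)

variable {P : PseudoCooperad.{uK, uC, u} K Ξ}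

/-- Operadic monomials in `s X₁, s X₂, …` with `X_a ∈ G^{k_a} P` and `∑ (k_a - 1) = w`. -/
inductive IsMonomial (𝒢 : Grading P) :
    ∀ {q : Corolla Ξ} {i : ℤ}, ℕ → (FreeOp P.toColl).obj q i → Prop
  | gen {q : Corolla Ξ} {p i : ℤ} (h : p + 1 = i) {k : ℕ} {X : P.obj q p} :
    X ∈ 𝒢.G (k + 1) q p → IsMonomial 𝒢 k ((susp P.toColl).app h X)
  | unit (ξ : Ξ) : IsMonomial 𝒢 0 ((FreeOp P.toColl).unit ξ)
  | comp {q q₁ q₂ : Corolla Ξ} (t : Tree₂ q q₁ q₂) {i j k : ℤ} (h : i + j = k) {v w : ℕ}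
    {x : (FreeOp P.toColl).obj q₁ i} {y : (FreeOp P.toColl).obj q₂ j} :
    IsMonomial 𝒢 v x → IsMonomial 𝒢 w y → IsMonomial 𝒢 (v + w) ((FreeOp P.toColl).comp t h x y)
  | act {q q' : Corolla Ξ} (σ : Corolla.Iso q q') {i : ℤ} {w : ℕ}
    {x : (FreeOp P.toColl).obj q i} :
    IsMonomial 𝒢 w x → IsMonomial 𝒢 w ((FreeOp P.toColl).act σ x)

/-- The part of weight `w` of the cobar construction. -/
def cobarWeight (𝒢 : Grading P) (q : Corolla Ξ) (i w : ℤ) :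
    Submodule K ((FreeOp P.toColl).obj q i) :=
  Submodule.span K {x | ∃ v : ℕ, (v : ℤ) = w ∧ IsMonomial 𝒢 v x}

/-- The derivations `D` with `D (s X)` of weight `(k - 1) + t` for all `k ≥ 1` and
`X ∈ G^k P`. -/
def Derivation.HasWeight (𝒢 : Grading P) {d : ℤ} (D : Derivation (FreeOp P.toColl) d) (t : ℤ) :
    Prop :=
  ∀ (k : ℕ), 1 ≤ k → ∀ {q : Corolla Ξ} {p i j : ℤ} (h : p + 1 = i) (h' : i + d = j)
    (X : P.obj q p), X ∈ 𝒢.G k q p →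
      D.toHom.app h' ((susp P.toColl).app h X) ∈ cobarWeight 𝒢 q j (((k : ℤ) - 1) + t)

/-- Derivations commuting (in the graded sense) with the differential. -/
def Derivation.IsClosed {O : DGOperad.{uK, uC, u} K Ξ} {d : ℤ} (D : Derivation O.toOperad d) :
    Prop :=
  ∀ {q : Corolla Ξ} {i i' j j' : ℤ} (h₁ : i + d = j) (h₂ : j + 1 = j') (h₃ : i + 1 = i')
    (h₄ : i' + d = j') (x : O.obj q i),
    O.d.toHom.app h₂ (D.toHom.app h₁ x) = (-1 : K) ^ d • D.toHom.app h₄ (O.d.toHom.app h₃ x)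

/-- `ρ ∘ s`: the element of the convolution Lie algebra corresponding to the morphism `ρ`. -/
def OperadHom.mc {E : Operad.{uK, uC, u'} K Ξ} (ρ : OperadHom (FreeOp P.toColl) E) :
    HomColl P.toColl E.toColl 1 where
  app h := ρ.app ∘ₗ (susp P.toColl).app h
  app_act h σ x := by simp [HomColl.app_act, OperadHom.app_act]

end Grading

end Opd

end

open scoped TensorProduct DirectSum

universe uK uC u u' u''

namespace Opd

/-! A derivation `D` of the free operad is the same as a homomorphism of collections `δ = D ∘ s` of
degree 1, and it commutes with `∂` as soon as it does so on the generators. So `δ` has to be chosen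
on each `G^k P` such that `∂ (δ X) = D (∂ (s X))`. This is a recursion on `k`: for `X ∈ G^k P` the
element `∂ (s X)` is built from `s (G^{k-1} P)` and from products of `s (G^r P)` and `s (G^s P)`
with `r + s = k`. Since `G^0 P = 0`, both `r` and `s` are smaller than `k`, and the right-hand side
only involves earlier values of `δ`.

The weight condition asks for `δ (G^k P)` in weight `k - m`. For `k < m` this weight is negative and
`δ = 0` is forced. For `k = m` it is `0`; there `δ` has to lift `ψ` through `ρ`, which is possible
because the target is generated by `ρ (s (G^1 P))`, so that `ρ` is already surjective on weight `0`
(`OperadHom.exists_weight_zero`). For all `k ≤ m` both sides of the equation have weight `k - m - 1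
< 0` and vanish (`exists_partialLift`).

For `k > m` put `z = D (∂ (s X))`. It is a cocycle, since `D` commutes with `∂` on everything that
occurs in `∂ (s X)` (`cobarD_derOf_cobarD`), and `ρ z = -(ψ (∂ X) + [ρ ∘ s, ψ] X) = 0` by the
hypothesis on `ψ` (`app_derOf_cobarD`). As `ρ` is a quasi-isomorphism, `z` is a coboundary
(`DGHom.IsQuasiIso.exists_primitive`). The primitive can be taken of weight `k - m > 0`, where `ρ`
vanishes, so that `ρ ∘ δ = ψ` persists (`OperadHom.eq_zero_of_pos`, `IsPartialLift.exists_succ`).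

Two points need care. The choices must be linear and equivariant; averaging over relabellings in
characteristic 0 achieves this (`exists_homColl_lift`). And the free operad is a quotient of formal
expressions, in which it is not visible that the weights form a direct sum. The Euler derivation
`Grading.weightDer` settles this: it has eigenvalue `w` on weight `w`, and eigenspaces for distinct
eigenvalues are independent. By `mem_cobarWeight_iff`, statements about weights become commutation
relations with this derivation, which can be checked on generators. -/

/-! ### Maps out of an internal direct sum -/

section Internal

variable {K M N ι : Type*} [Field K] [AddCommGroup M] [Module K M] [AddCommGroup N] [Module K N]
  [DecidableEq ι] {A : ι → Submodule K M}

/-- The linear map which restricts to `f k` on the `k`-th summand of an internal direct sum. -/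
noncomputable def internalGlue (h : DirectSum.IsInternal A) (f : ι → M →ₗ[K] N) : M →ₗ[K] N :=
  DirectSum.toModule K ι N (fun k => f k ∘ₗ (A k).subtype) ∘ₗ
    (LinearEquiv.ofBijective (DirectSum.coeLinearMap A) h).symm.toLinearMap

theorem internalGlue_apply (h : DirectSum.IsInternal A) (f : ι → M →ₗ[K] N) {k : ι} {x : M}
    (hx : x ∈ A k) : internalGlue h f x = f k x := by
  have h1 : (LinearEquiv.ofBijective (DirectSum.coeLinearMap A) h).symm x =
      DirectSum.lof K ι (fun k => A k) k ⟨x, hx⟩ := by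
    exact (LinearEquiv.symm_apply_eq _).2 (DirectSum.coeLinearMap_lof A k ⟨x, hx⟩).symm
  simp only [internalGlue, LinearMap.comp_apply, LinearEquiv.coe_coe, h1, DirectSum.toModule_lof,
    Submodule.subtype_apply]

/-- There is no separate case for `0` because `0` lies in every summand; this is why some index has
to exist. -/
theorem internal_induction [Nonempty ι] (h : DirectSum.IsInternal A) {C : M → Prop}
    (mem : ∀ k, ∀ x ∈ A k, C x) (add : ∀ x y, C x → C y → C (x + y)) (x : M) : C x :=
  Submodule.iSup_induction A (motive := C) (h.submodule_iSup_eq_top ▸ Submodule.mem_top) mem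
    (mem (Classical.arbitrary ι) 0 (A _).zero_mem) add

end Internal

/-! ### Equivariant lifting -/

section Lifting

variable {K : Type uK} [Field K] {Ξ : Type uC}

/-- The inverse relabelling. -/
def Corolla.Iso.symm {q q' : Corolla Ξ} (σ : Corolla.Iso q q') : Corolla.Iso q' q :=
  ⟨σ.toEquiv.symm, fun x => by rw [← σ.color_eq, Equiv.apply_symm_apply], σ.out_eq.symm⟩

theorem Corolla.Iso.toEquiv_injective {q q' : Corolla Ξ} :
    Function.Injective (Corolla.Iso.toEquiv : Corolla.Iso q q' → _) := by
  rintro ⟨e, _, _⟩ ⟨e', _, _⟩ h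
  cases h
  rfl

theorem Corolla.Iso.trans_symm {q q' : Corolla Ξ} (σ : Corolla.Iso q q') :
    σ.trans σ.symm = Corolla.Iso.refl q :=
  Corolla.Iso.toEquiv_injective (Equiv.self_trans_symm _)

instance Corolla.Iso.finite (q q' : Corolla Ξ) : Finite (Corolla.Iso q q') :=
  Finite.of_injective _ Corolla.Iso.toEquiv_injective

/-- Isomorphic corollas. -/
def Corolla.isoSetoid (Ξ : Type uC) : Setoid (Corolla Ξ) where
  r q q' := Nonempty (Corolla.Iso q q')
  iseqv := ⟨fun q => ⟨Corolla.Iso.refl q⟩, fun ⟨σ⟩ => ⟨σ.symm⟩, fun ⟨σ⟩ ⟨τ⟩ => ⟨σ.trans τ⟩⟩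

/-- A representative of the isomorphism class of a corolla. -/
noncomputable def Corolla.rep (q : Corolla Ξ) : Corolla Ξ :=
  (Quotient.mk (Corolla.isoSetoid Ξ) q).out

theorem Corolla.nonempty_iso_rep (q : Corolla Ξ) : Nonempty (Corolla.Iso q q.rep) := by
  obtain ⟨σ⟩ := @Quotient.mk_out _ (Corolla.isoSetoid Ξ) q
  exact ⟨σ.symm⟩

/-- An equality rather than an isomorphism: one linear map chosen at the representative then serves
all corollas of the class. -/
theorem Corolla.Iso.rep_eq {q q' : Corolla Ξ} (σ : Corolla.Iso q q') : q.rep = q'.rep :=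
  congrArg Quotient.out (Quotient.sound (s := Corolla.isoSetoid Ξ) ⟨σ⟩)

theorem Coll.act_symm_act (V : Coll.{uK, uC, u} K Ξ) {q q' : Corolla Ξ} (σ : Corolla.Iso q q')
    {i : ℤ} (x : V.obj q i) : V.act σ.symm (V.act σ x) = x := by
  rw [← V.act_trans, σ.trans_symm, V.act_refl]

/-! ### Averaging over relabellings -/

/-- The transport of a linear map along all isomorphisms `q ≅ r`, averaged. -/
noncomputable def averageMap {V : Coll.{uK, uC, u} K Ξ} {Y : Coll.{uK, uC, u'} K Ξ}
    (q r : Corolla Ξ) {i j : ℤ} (g : V.obj r i →ₗ[K] Y.obj r j) : V.obj q i →ₗ[K] Y.obj q j :=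
  letI := Fintype.ofFinite (Corolla.Iso q r)
  (Nat.card (Corolla.Iso q r) : K)⁻¹ • ∑ σ : Corolla.Iso q r, Y.act σ.symm ∘ₗ g ∘ₗ V.act σ

theorem averageMap_apply {V : Coll.{uK, uC, u} K Ξ} {Y : Coll.{uK, uC, u'} K Ξ}
    (q r : Corolla Ξ) [Fintype (Corolla.Iso q r)] {i j : ℤ} (g : V.obj r i →ₗ[K] Y.obj r j)
    (x : V.obj q i) : averageMap q r g x = (Nat.card (Corolla.Iso q r) : K)⁻¹ •
      ∑ σ : Corolla.Iso q r, Y.act σ.symm (g (V.act σ x)) := by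
  rw [averageMap, LinearMap.smul_apply, LinearMap.sum_apply]
  -- Only the `Fintype` instances on the set of isomorphisms can differ.
  congr!

/-- Precomposition with `θ` is a bijection from the isomorphisms `q' ≅ r` to the isomorphisms `q ≅
r`, so it merely permutes the summands. The two prefactors agree, hence nothing is needed about the
characteristic. -/
theorem act_averageMap {V : Coll.{uK, uC, u} K Ξ} {Y : Coll.{uK, uC, u'} K Ξ}
    {q q' : Corolla Ξ} (r : Corolla Ξ) (θ : Corolla.Iso q q') {i j : ℤ}
    (g : V.obj r i →ₗ[K] Y.obj r j) (x : V.obj q i) :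
    averageMap q' r g (V.act θ x) = Y.act θ (averageMap q r g x) := by
  let _ := Fintype.ofFinite (Corolla.Iso q r)
  let _ := Fintype.ofFinite (Corolla.Iso q' r)
  let e : Corolla.Iso q' r ≃ Corolla.Iso q r :=
    { toFun := fun σ => θ.trans σ
      invFun := fun σ => θ.symm.trans σ
      left_inv := fun σ => Corolla.Iso.toEquiv_injective (Equiv.ext fun z =>
        congrArg σ.toEquiv (Equiv.apply_symm_apply θ.toEquiv z))
      right_inv := fun σ => Corolla.Iso.toEquiv_injective (Equiv.ext fun z =>
        congrArg σ.toEquiv (Equiv.symm_apply_apply θ.toEquiv z)) }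
  rw [averageMap_apply, averageMap_apply, map_smul, map_sum, Nat.card_congr e]
  refine congrArg _ (Fintype.sum_equiv e _ _ fun σ => ?_)
  -- In the usual notation for composition, `σ⁻¹ = θ ∘ (σ ∘ θ)⁻¹`.
  have h1 : (e σ).symm.trans θ = σ.symm := Corolla.Iso.toEquiv_injective (Equiv.ext fun z =>
    Equiv.apply_symm_apply θ.toEquiv (σ.toEquiv.symm z))
  rw [← Y.act_trans, h1, show e σ = θ.trans σ from rfl, V.act_trans]

variable {V : Coll.{uK, uC, u} K Ξ} {Y : Coll.{uK, uC, u'} K Ξ} {Z : Coll.{uK, uC, u''} K Ξ}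

/-- On `T` a lift exists because vector spaces are projective and `p` maps `S` onto its image; a
linear map defined on a subspace extends to the whole space. -/
theorem exists_linear_lift {M N L : Type*} [AddCommGroup M] [Module K M] [AddCommGroup N]
    [Module K N] [AddCommGroup L] [Module K L] (f : M →ₗ[K] L) (p : N →ₗ[K] L)
    (T : Submodule K M) (S : Submodule K N) (h : ∀ x ∈ T, ∃ y ∈ S, p y = f x) :
    ∃ g : M →ₗ[K] N, ∀ x ∈ T, g x ∈ S ∧ p (g x) = f x := by
  let p' : S →ₗ[K] LinearMap.range (p ∘ₗ S.subtype) := (p ∘ₗ S.subtype).rangeRestrict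
  let f' : T →ₗ[K] LinearMap.range (p ∘ₗ S.subtype) :=
    (f ∘ₗ T.subtype).codRestrict _ fun x => by
      obtain ⟨y, hy, e⟩ := h x x.2
      exact ⟨⟨y, hy⟩, e⟩
  obtain ⟨g, hg⟩ := Module.projective_lifting_property p' f' (LinearMap.surjective_rangeRestrict _)
  obtain ⟨g', hg'⟩ := LinearMap.exists_extend (S.subtype ∘ₗ g)
  refine ⟨g', fun x hx => ?_⟩
  have h1 : g' x = g ⟨x, hx⟩ := LinearMap.congr_fun hg' ⟨x, hx⟩
  have h2 := congrArg Subtype.val (LinearMap.congr_fun hg ⟨x, hx⟩)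
  rw [h1]
  exact ⟨(g ⟨x, hx⟩).2, h2⟩

/-- Over a field of characteristic `0`, lifts of homomorphisms of collections exist as soon as
elements can be lifted. -/
theorem exists_homColl_lift [CharZero K] {a b c : ℤ} (f : HomColl V Z c) (p : HomColl Y Z b)
    (hab : a + b = c) (T : ∀ q i, Submodule K (V.obj q i))
    (hT : ∀ {q q' : Corolla Ξ} (σ : Corolla.Iso q q') {i : ℤ} {x : V.obj q i},
      x ∈ T q i → V.act σ x ∈ T q' i)
    (S : ∀ q i, Submodule K (Y.obj q i))
    (hS : ∀ {q q' : Corolla Ξ} (σ : Corolla.Iso q q') {i : ℤ} {x : Y.obj q i},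
      x ∈ S q i → Y.act σ x ∈ S q' i)
    (h : ∀ {q : Corolla Ξ} {i j k : ℤ} (_ : i + a = j) (hj : j + b = k) (hk : i + c = k),
      ∀ x ∈ T q i, ∃ y ∈ S q j, p.app hj y = f.app hk x) :
    ∃ g : HomColl V Y a, ∀ {q : Corolla Ξ} {i j k : ℤ} (hi : i + a = j) (hj : j + b = k)
      (hk : i + c = k), ∀ x ∈ T q i, g.app hi x ∈ S q j ∧ p.app hj (g.app hi x) = f.app hk x := by
  -- Lifts without any equivariance. Only those at the representatives `q.rep` are used afterwards.
  have h1 : ∀ (q : Corolla Ξ) (i : ℤ), ∃ g : V.obj q i →ₗ[K] Y.obj q (i + a),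
      ∀ x ∈ T q i, g x ∈ S q (i + a) ∧
        p.app (show i + a + b = i + c by omega) (g x) = f.app rfl x := fun q i =>
    exists_linear_lift _ _ _ _ (h rfl _ _)
  choose g hg using h1
  refine ⟨⟨fun {q i j} hi => hi ▸ averageMap q q.rep (g q.rep i), ?_⟩, ?_⟩
  · rintro q q' i j rfl σ x
    change averageMap q' q'.rep (g q'.rep i) (V.act σ x) =
      Y.act σ (averageMap q q.rep (g q.rep i) x)
    -- Both sides now average the same linear map, over isomorphisms to the same corolla.
    rw [σ.rep_eq]
    exact act_averageMap _ σ _ x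
  · rintro q i j k rfl hj hk x hx
    obtain rfl : k = i + c := hk.symm
    change averageMap q q.rep (g q.rep i) x ∈ S q (i + a) ∧
      p.app hj (averageMap q q.rep (g q.rep i) x) = f.app rfl x
    let _ := Fintype.ofFinite (Corolla.Iso q q.rep)
    rw [averageMap_apply]
    refine ⟨(S q _).smul_mem _ ((S q _).sum_mem fun σ _ => hS _ (hg _ _ _ (hT σ hx)).1), ?_⟩
    -- Each summand is itself a lift of `f x`, by the equivariance of `p` and `f`; therefore so is
    -- the mean.
    have h2 : ∀ σ : Corolla.Iso q q.rep,
        p.app hj (Y.act σ.symm (g q.rep i (V.act σ x))) = f.app rfl x := fun σ => by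
      rw [p.app_act, (hg _ _ _ (hT σ hx)).2, f.app_act, Z.act_symm_act]
    -- The number of isomorphisms is positive, hence invertible in characteristic 0.
    have := q.nonempty_iso_rep
    rw [map_smul, map_sum, Finset.sum_congr rfl fun σ _ => h2 σ, Finset.sum_const, Finset.card_univ,
      ← Nat.card_eq_fintype_card, ← Nat.cast_smul_eq_nsmul K, smul_smul,
      inv_mul_cancel₀ (Nat.cast_ne_zero.2 Nat.card_pos.ne'), one_smul]

end Lifting

/-! ### Commutation relations between derivations -/

section Commutes

variable {K : Type uK} [Field K] {Ξ : Type uC} {E : Operad.{uK, uC, u} K Ξ} {d : ℤ}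

/-- The relation `A (B x) = B (A x) + c • B x`. -/
def Derivation.Commutes (A : Derivation E 0) (B : Derivation E d) (c : K) {q : Corolla Ξ} {i : ℤ}
    (x : E.obj q i) : Prop :=
  ∀ (j : ℤ) (h : i + d = j), A.toHom.app (add_zero j) (B.toHom.app h x) =
    B.toHom.app h (A.toHom.app (add_zero i) x) + c • B.toHom.app h x

theorem Derivation.leibniz_zero (A : Derivation E 0) {q q₁ q₂ : Corolla Ξ} (t : Tree₂ q q₁ q₂)
    {i j k : ℤ} (h : i + j = k) (x : E.obj q₁ i) (y : E.obj q₂ j) :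
    A.toHom.app (add_zero k) (E.comp t h x y) =
      E.comp t h (A.toHom.app (add_zero i) x) y + E.comp t h x (A.toHom.app (add_zero j) y) := by
  rw [A.leibniz t h (add_zero i) (add_zero j) (add_zero k) h h, zero_mul, zpow_zero, one_smul]

variable {A : Derivation E 0} {B : Derivation E d} {c : K}

/-- As `A` has degree 0, the difference `[A, B] - c B` is again a derivation, so its kernel is
closed under compositions. The relation is used with `A` the Euler derivation and `B` either the
differential (`c = -1`) or the lift (`c = 1 - m`), and with `A` the lift, `B` the differential and
`c = 0`. -/
theorem Derivation.Commutes.comp {q q₁ q₂ : Corolla Ξ} (t : Tree₂ q q₁ q₂) {i j k : ℤ}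
    (h : i + j = k) {x : E.obj q₁ i} {y : E.obj q₂ j} (hx : A.Commutes B c x)
    (hy : A.Commutes B c y) : A.Commutes B c (E.comp t h x y) := by
  intro k' hk
  have hl : (i + d) + j = k' := by omega
  have hr : i + (j + d) = k' := by omega
  rw [B.leibniz t h rfl rfl hk hl hr, map_add, map_smul, A.leibniz_zero, A.leibniz_zero,
    A.leibniz_zero, map_add, B.leibniz t h rfl rfl hk hl hr, B.leibniz t h rfl rfl hk hl hr,
    hx _ rfl, hy _ rfl]
  simp only [map_add, map_smul, LinearMap.add_apply, LinearMap.smul_apply, smul_add,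
    smul_comm c]
  abel

theorem Derivation.Commutes.unit (ξ : Ξ) : A.Commutes B c (E.unit ξ) := by
  intro j h
  rw [B.app_unit, A.app_unit, map_zero, map_zero, smul_zero, zero_add]

theorem Derivation.Commutes.act {q q' : Corolla Ξ} (σ : Corolla.Iso q q') {i : ℤ}
    {x : E.obj q i} (hx : A.Commutes B c x) : A.Commutes B c (E.act σ x) := by
  intro j h
  rw [B.toHom.app_act, A.toHom.app_act, A.toHom.app_act, B.toHom.app_act, hx j h, map_add, map_smul]

theorem Derivation.Commutes.zero {q : Corolla Ξ} {i : ℤ} :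
    A.Commutes B c (0 : E.obj q i) := by
  intro j h
  simp only [map_zero, smul_zero, add_zero]

theorem Derivation.Commutes.add {q : Corolla Ξ} {i : ℤ} {x y : E.obj q i}
    (hx : A.Commutes B c x) (hy : A.Commutes B c y) : A.Commutes B c (x + y) := by
  intro j h
  simp only [map_add, hx j h, hy j h, smul_add]
  abel

theorem Derivation.Commutes.smul {q : Corolla Ξ} {i : ℤ} (r : K) {x : E.obj q i}
    (hx : A.Commutes B c x) : A.Commutes B c (r • x) := by
  intro j h
  simp only [map_smul, hx j h, smul_add, smul_comm c]

/-- A derivation satisfying a commutation relation with `A` shifts the eigenvalues of `A`. -/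
theorem Derivation.Commutes.eigen {q : Corolla Ξ} {i j : ℤ} (h : i + d = j) {x : E.obj q i}
    (hx : A.Commutes B c x) {a : K} (ha : A.toHom.app (add_zero i) x = a • x) :
    A.toHom.app (add_zero j) (B.toHom.app h x) = (a + c) • B.toHom.app h x := by
  rw [hx j h, ha, map_smul, add_smul]

/-- A derivation of the free operad that vanishes on the generators is zero. -/
theorem Derivation.Commutes.of_gen {P : Coll.{uK, uC, u} K Ξ} {A : Derivation (FreeOp P) 0}
    {B : Derivation (FreeOp P) d}
    (hg : ∀ {q : Corolla Ξ} {p i : ℤ} (h : p + 1 = i) (X : P.obj q p),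
      A.Commutes B c ((susp P).app h X)) {q : Corolla Ξ} {i : ℤ} (x : (FreeOp P).obj q i) :
    A.Commutes B c x := by
  induction x using FreeOp.induction with
  | gen h X => exact hg h X
  | unit ξ => exact .unit ξ
  | comp t h x y hx hy => exact .comp t h hx hy
  | act σ x hx => exact .act σ hx
  | zero => exact .zero
  | add x y hx hy => exact .add hx hy
  | smul r x hx => exact .smul r hx

end Commutes

/-! ### Homomorphisms and derivations defined on the pieces of a grading -/

section Glue

variable {K : Type uK} [Field K] {Ξ : Type uC} {P : PseudoCooperad.{uK, uC, u} K Ξ}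
  {V : Coll.{uK, uC, u'} K Ξ} {d : ℤ}

theorem Grading.induction (𝒢 : Grading P) {q : Corolla Ξ} {i : ℤ} {C : P.obj q i → Prop}
    (mem : ∀ k, ∀ X ∈ 𝒢.G k q i, C X) (add : ∀ X Y, C X → C Y → C (X + Y)) (X : P.obj q i) : C X :=
  internal_induction (𝒢.isInternal q i) mem add X

/-- The homomorphism of collections which agrees with `f k` on `G^k P`. -/
noncomputable def Grading.glue (𝒢 : Grading P) (f : ℕ → HomColl P.toColl V d) :
    HomColl P.toColl V d where
  app {q i _} h := internalGlue (𝒢.isInternal q i) fun k => (f k).app h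
  app_act h σ X := by
    induction X using 𝒢.induction with
    | mem k X hX =>
      rw [internalGlue_apply _ _ (𝒢.act_mem σ hX), internalGlue_apply _ _ hX, (f k).app_act]
    | add X Y hX hY => simp only [map_add, hX, hY]

theorem Grading.glue_apply (𝒢 : Grading P) (f : ℕ → HomColl P.toColl V d) {k : ℕ}
    {q : Corolla Ξ} {i j : ℤ} (h : i + d = j) {X : P.obj q i} (hX : X ∈ 𝒢.G k q i) :
    (𝒢.glue f).app h X = (f k).app h X :=
  internalGlue_apply _ _ hX

/-- This is the place where `G^0 P = 0` enters: it makes the weights `k - 1` of nonzero generators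
natural numbers. -/
theorem Grading.exists_succ (𝒢 : Grading P) {k : ℕ} {q : Corolla Ξ} {i : ℤ} {X : P.obj q i}
    (hX : X ∈ 𝒢.G k q i) (h0 : X ≠ 0) : ∃ l, k = l + 1 := by
  rcases k with _ | l
  · rw [𝒢.zero, Submodule.mem_bot] at hX
    exact absurd hX h0
  · exact ⟨l, rfl⟩

/-- A linear map vanishes on `∂ (s X)`, `X ∈ G^{k+1} P`, if it vanishes on `s (G^k P)` and on the
compositions of `s (G^r P)` and `s (G^s P)` for `r + s = k + 1`. -/
theorem Grading.cobarD_susp_eq_zero (𝒢 : Grading P) {M : Type*} [AddCommGroup M] [Module K M]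
    {k : ℕ} {q : Corolla Ξ} {p i j : ℤ} (hp : p + 1 = i) (hi : i + 1 = j)
    (L : (FreeOp P.toColl).obj q j →ₗ[K] M)
    (h₁ : ∀ X ∈ 𝒢.G k q i, L ((susp P.toColl).app hi X) = 0)
    (h₂ : ∀ {q₁ q₂ : Corolla Ξ} (t : Tree₂ q q₁ q₂) {a b a' b' : ℤ} (ha : a + 1 = a')
      (hb : b + 1 = b') (h : a' + b' = j) (r s : ℕ), r + s = k + 1 → r ≤ k → s ≤ k →
      ∀ X ∈ 𝒢.G r q₁ a, ∀ Y ∈ 𝒢.G s q₂ b,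
        L ((FreeOp P.toColl).comp t h ((susp P.toColl).app ha X) ((susp P.toColl).app hb Y)) = 0)
    {X : P.obj q p} (hX : X ∈ 𝒢.G (k + 1) q p) :
    L ((cobarD P).toHom.app hi ((susp P.toColl).app hp X)) = 0 := by
  subst hp
  have e1 : (cobarD P).toHom.app hi ((susp P.toColl).app rfl X) =
    -((susp P.toColl).app hi (P.d.app rfl X)) - ∑ᶠ c : TreeIdx q,
      bulletTerm (susp P.toColl) (susp P.toColl) q (show p + (1 + 1) = j by omega) c X := rfl
  have e2 := map_finsum L
    (bulletTerm_finite (susp P.toColl) (susp P.toColl) q (show p + (1 + 1) = j by omega) X)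
  rw [e1, map_sub, map_neg, h₁ _ (𝒢.d_mem rfl hX), e2, neg_zero, zero_sub, neg_eq_zero]
  refine finsum_eq_zero_of_forall_eq_zero fun c => ?_
  -- The claim is linear in the tensor `z`, so for each tree it can be tested on pure tensors from
  -- `G^r P ⊗ G^s P`.
  have key : ∀ z ∈ ⨆ r ∈ Finset.HasAntidiagonal.antidiagonal (k + 1),
      LinearMap.range (TensorProduct.map (𝒢.G r.1 (lowCor q c.1 c.2.1) c.2.2).subtype
        (𝒢.G r.2 (upCor q c.1 c.2.1) (p - c.2.2)).subtype),
      L (convTerm (susp P.toColl) (susp P.toColl) (stdTree q c.1 c.2.1)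
        (show (c.2.2 + 1) + ((p - c.2.2) + 1) = j by omega) z) = 0 := by
    intro z hz
    refine (iSup₂_le (a := LinearMap.ker (L ∘ₗ convTerm (susp P.toColl) (susp P.toColl)
      (stdTree q c.1 c.2.1) (show (c.2.2 + 1) + ((p - c.2.2) + 1) = j by omega))) ?_) hz
    rintro ⟨r, s⟩ hrs
    rw [Finset.HasAntidiagonal.mem_antidiagonal] at hrs
    rintro _ ⟨w, rfl⟩
    rw [LinearMap.mem_ker, LinearMap.comp_apply]
    induction w with
    | zero => simp only [map_zero]
    | add x y hx hy => simp only [map_add, hx, hy, add_zero]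
    | tmul x y =>
      rw [TensorProduct.map_tmul, convTerm_tmul, map_smul, Submodule.subtype_apply,
        Submodule.subtype_apply]
      -- If both factors are nonzero then `r, s ≥ 1`, and `r + s = k + 1` yields the bounds `r ≤ k`
      -- and `s ≤ k` demanded by `h₂`.
      by_cases hx : x.1 = 0
      · rw [hx]
        simp only [map_zero, LinearMap.zero_apply, smul_zero]
      by_cases hy : y.1 = 0
      · rw [hy]
        simp only [map_zero, smul_zero]
      obtain ⟨r', rfl⟩ := 𝒢.exists_succ x.2 hx
      obtain ⟨s', rfl⟩ := 𝒢.exists_succ y.2 hy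
      rw [h₂ _ _ _ _ _ _ hrs (by simp only at hrs; omega) (by simp only at hrs; omega) _ x.2 _ y.2,
        smul_zero]
  exact key _ (𝒢.Δ_mem _ _ hX)

end Glue

/-! ### The weight grading of the cobar construction -/

section Weight

variable {K : Type uK} [Field K] {Ξ : Type uC} {P : PseudoCooperad.{uK, uC, u} K Ξ}
  (𝒢 : Grading P)

/-- The homomorphism `X ↦ (k - 1) s X` for `X ∈ G^k P`. -/
noncomputable def Grading.weightHom : HomColl P.toColl (FreeOp P.toColl).toColl 1 :=
  𝒢.glue fun k => ⟨fun h => ((k : K) - 1) • (susp P.toColl).app h, fun h σ X => by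
    simp only [LinearMap.smul_apply, HomColl.app_act, map_smul]⟩

/-- The derivation which multiplies the part of weight `w` by `w`. -/
noncomputable def Grading.weightDer : Derivation (FreeOp P.toColl) 0 :=
  freeDer 𝒢.weightHom (zero_add 1)

variable {𝒢}

theorem Grading.weightDer_susp {q : Corolla Ξ} {p i : ℤ} (h : p + 1 = i) {k : ℕ} {X : P.obj q p}
    (hX : X ∈ 𝒢.G k q p) : 𝒢.weightDer.toHom.app (add_zero i) ((susp P.toColl).app h X) =
      ((k : K) - 1) • (susp P.toColl).app h X :=
  𝒢.glue_apply _ h hX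

/-- By the Leibniz rule the eigenvalues `k - 1` of the generators in a monomial add up, exactly as
the weight is defined. -/
theorem IsMonomial.weightDer {q : Corolla Ξ} {i : ℤ} {w : ℕ} {x : (FreeOp P.toColl).obj q i}
    (hx : IsMonomial 𝒢 w x) : 𝒢.weightDer.toHom.app (add_zero i) x = (w : K) • x := by
  induction hx with
  | gen h hX =>
    rw [Grading.weightDer_susp h hX]
    push_cast
    rw [add_sub_cancel_right]
  | unit ξ => rw [Derivation.app_unit, Nat.cast_zero, zero_smul]
  | comp t h _ _ hx hy =>
    rw [Derivation.leibniz_zero, hx, hy, map_smul, map_smul, LinearMap.smul_apply, ← add_smul,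
      Nat.cast_add]
  | act σ _ hx => rw [HomColl.app_act, hx, map_smul]

theorem weightDer_of_mem_cobarWeight {q : Corolla Ξ} {i w : ℤ} {x : (FreeOp P.toColl).obj q i}
    (hx : x ∈ cobarWeight 𝒢 q i w) :
    𝒢.weightDer.toHom.app (add_zero i) x = (w : K) • x := by
  induction hx using Submodule.span_induction with
  | mem x hx =>
    obtain ⟨v, rfl, hx⟩ := hx
    rw [hx.weightDer, Int.cast_natCast]
  | zero => rw [map_zero, smul_zero]
  | add x y _ _ hx hy => rw [map_add, hx, hy, smul_add]
  | smul r x _ hx => rw [map_smul, hx, smul_comm]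

theorem susp_mem_cobarWeight {q : Corolla Ξ} {p i : ℤ} (h : p + 1 = i) {k : ℕ} {X : P.obj q p}
    (hX : X ∈ 𝒢.G k q p) : (susp P.toColl).app h X ∈ cobarWeight 𝒢 q i ((k : ℤ) - 1) := by
  by_cases h0 : X = 0
  · rw [h0, map_zero]
    exact Submodule.zero_mem _
  obtain ⟨l, rfl⟩ := 𝒢.exists_succ hX h0
  exact Submodule.subset_span ⟨l, by push_cast; omega, .gen h hX⟩

theorem act_mem_cobarWeight {q q' : Corolla Ξ} (σ : Corolla.Iso q q') {i w : ℤ}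
    {x : (FreeOp P.toColl).obj q i} (hx : x ∈ cobarWeight 𝒢 q i w) :
    (FreeOp P.toColl).act σ x ∈ cobarWeight 𝒢 q' i w := by
  induction hx using Submodule.span_induction with
  | mem x hx =>
    obtain ⟨v, hv, hx⟩ := hx
    exact Submodule.subset_span ⟨v, hv, hx.act σ⟩
  | zero => rw [map_zero]; exact Submodule.zero_mem _
  | add x y _ _ hx hy => rw [map_add]; exact Submodule.add_mem _ hx hy
  | smul r x _ hx => rw [map_smul]; exact Submodule.smul_mem _ r hx

theorem comp_mem_cobarWeight {q q₁ q₂ : Corolla Ξ} (t : Tree₂ q q₁ q₂) {i j k v w : ℤ}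
    (h : i + j = k) {x : (FreeOp P.toColl).obj q₁ i} {y : (FreeOp P.toColl).obj q₂ j}
    (hx : x ∈ cobarWeight 𝒢 q₁ i v) (hy : y ∈ cobarWeight 𝒢 q₂ j w) :
    (FreeOp P.toColl).comp t h x y ∈ cobarWeight 𝒢 q k (v + w) := by
  induction hx using Submodule.span_induction with
  | mem x hx =>
    obtain ⟨v', rfl, hx⟩ := hx
    induction hy using Submodule.span_induction with
    | mem y hy =>
      obtain ⟨w', rfl, hy⟩ := hy
      exact Submodule.subset_span ⟨v' + w', Nat.cast_add _ _, hx.comp t h hy⟩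
    | zero => rw [map_zero]; exact Submodule.zero_mem _
    | add x y _ _ hx hy => rw [map_add]; exact Submodule.add_mem _ hx hy
    | smul r x _ hx => rw [map_smul]; exact Submodule.smul_mem _ r hx
  | zero => rw [map_zero]; exact Submodule.zero_mem _
  | add x y _ _ hx hy => rw [map_add]; exact Submodule.add_mem _ hx hy
  | smul r x _ hx => rw [map_smul]; exact Submodule.smul_mem _ r hx

/-- No monomial has negative weight. This forces the lift to vanish on `G^k P` for `k < m` and makes
the first stages of the recursion hold trivially. -/
theorem cobarWeight_of_neg {q : Corolla Ξ} {i w : ℤ} (hw : w < 0) : cobarWeight 𝒢 q i w = ⊥ := by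
  rw [cobarWeight, Submodule.span_eq_bot]
  rintro x ⟨v, hv, _⟩
  omega

-- The generators and the units are sums of elements of pure weight, and composition adds weights.
-- Independence of the summands is a separate matter and needs characteristic 0.
variable (𝒢) in
theorem iSup_cobarWeight (q : Corolla Ξ) (i : ℤ) : ⨆ w, cobarWeight 𝒢 q i w = ⊤ := by
  refine Submodule.eq_top_iff'.2 fun x => ?_
  induction x using FreeOp.induction with
  | gen h X =>
    induction X using 𝒢.induction with
    | mem k X hX => exact Submodule.mem_iSup_of_mem _ (susp_mem_cobarWeight h hX)
    | add X Y hX hY => rw [map_add]; exact Submodule.add_mem _ hX hY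
  | unit ξ => exact Submodule.mem_iSup_of_mem 0 (Submodule.subset_span ⟨0, rfl, .unit ξ⟩)
  | comp t h x y hx hy =>
    induction hx using Submodule.iSup_induction' with
    | mem v x hx =>
      induction hy using Submodule.iSup_induction' with
      | mem w y hy => exact Submodule.mem_iSup_of_mem _ (comp_mem_cobarWeight t h hx hy)
      | zero => rw [map_zero]; exact Submodule.zero_mem _
      | add x y _ _ hx hy => rw [map_add]; exact Submodule.add_mem _ hx hy
    | zero => rw [map_zero]; exact Submodule.zero_mem _
    | add x y _ _ hx hy => rw [map_add]; exact Submodule.add_mem _ hx hy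
  | act σ x hx =>
    induction hx using Submodule.iSup_induction' with
    | mem v x hx => exact Submodule.mem_iSup_of_mem v (act_mem_cobarWeight σ hx)
    | zero => rw [map_zero]; exact Submodule.zero_mem _
    | add x y _ _ hx hy => rw [map_add]; exact Submodule.add_mem _ hx hy
  | zero => exact Submodule.zero_mem _
  | add x y hx hy => exact Submodule.add_mem _ hx hy
  | smul r x hx => exact Submodule.smul_mem _ r hx

variable (𝒢) in
/-- The cobar differential lowers the weight by `1`. -/
theorem weightDer_commutes_cobarD {q : Corolla Ξ} {i : ℤ} (x : (FreeOp P.toColl).obj q i) :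
    𝒢.weightDer.Commutes (cobarD P) (-1 : K) x := by
  refine .of_gen (fun {q p i} h X => ?_) x
  induction X using 𝒢.induction with
  | add X Y hX hY => rw [map_add]; exact hX.add hY
  | mem k X hX =>
    by_cases h0 : X = 0
    · rw [h0, map_zero]
      exact .zero
    obtain ⟨l, rfl⟩ := 𝒢.exists_succ hX h0
    intro j hj
    -- For `X ∈ G^{l+1} P` every part of `∂ (s X)` has eigenvalue `l - 1`: the linear part lies in
    -- `s (G^l P)`, and in the quadratic part `(r - 1) + (s - 1) = l - 1` because `r + s = l + 1`.
    -- The generator `s X` itself has eigenvalue `l`, whence the shift by `-1`.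
    have key := 𝒢.cobarD_susp_eq_zero h hj
      (𝒢.weightDer.toHom.app (add_zero j) - ((l : K) - 1) • LinearMap.id) (fun Y hY => by
        rw [LinearMap.sub_apply, Grading.weightDer_susp hj hY, LinearMap.smul_apply,
          LinearMap.id_apply, sub_self])
      (fun t a b a' b' ha hb hab r s hrs _ _ Y hY Z hZ => by
        have hl : (l : K) = (r : K) + s - 1 := by
          rw [← Nat.cast_add, hrs, Nat.cast_add, Nat.cast_one, add_sub_cancel_right]
        rw [LinearMap.sub_apply, Derivation.leibniz_zero, Grading.weightDer_susp ha hY,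
          Grading.weightDer_susp hb hZ, map_smul, map_smul, LinearMap.smul_apply,
          LinearMap.smul_apply, LinearMap.id_apply, ← add_smul, ← sub_smul, hl,
          show (r : K) - 1 + ((s : K) - 1) - ((r : K) + s - 1 - 1) = 0 by ring, zero_smul]) hX
    rw [LinearMap.sub_apply, LinearMap.smul_apply, LinearMap.id_apply, sub_eq_zero] at key
    rw [key, Grading.weightDer_susp h hX, map_smul, ← add_smul]
    congr 1
    push_cast
    ring

/-! ### The direct sum decomposition by weight in characteristic 0 -/

variable [CharZero K]

variable (𝒢) in
/-- The cobar construction is the direct sum of its parts of given weight. -/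
theorem cobarWeight_isInternal (q : Corolla Ξ) (i : ℤ) :
    DirectSum.IsInternal fun w => cobarWeight 𝒢 q i w := by
  refine DirectSum.isInternal_submodule_of_iSupIndep_of_iSup_eq_top ?_ (iSup_cobarWeight 𝒢 q i)
  let f : Module.End K ((FreeOp P.toColl).obj q i) := 𝒢.weightDer.toHom.app (add_zero i)
  -- Distinct integers remain distinct in `K`, so different weights lie in independent eigenspaces.
  refine (f.eigenspaces_iSupIndep.comp (Int.cast_injective (α := K))).mono fun w x hx => ?_
  exact Module.End.mem_eigenspace_iff.2 (weightDer_of_mem_cobarWeight hx)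

variable (𝒢) in
/-- The projection to the part of weight `w`. -/
noncomputable def weightProj (q : Corolla Ξ) (i w : ℤ) :
    (FreeOp P.toColl).obj q i →ₗ[K] (FreeOp P.toColl).obj q i :=
  internalGlue (cobarWeight_isInternal 𝒢 q i) fun v => if v = w then LinearMap.id else 0

theorem weightProj_apply {q : Corolla Ξ} {i v w : ℤ} {x : (FreeOp P.toColl).obj q i}
    (hx : x ∈ cobarWeight 𝒢 q i v) : weightProj 𝒢 q i w x = if v = w then x else 0 := by
  rw [weightProj, internalGlue_apply _ _ hx]
  split_ifs <;> rfl

theorem weightProj_mem {q : Corolla Ξ} {i : ℤ} (w : ℤ) (x : (FreeOp P.toColl).obj q i) :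
    weightProj 𝒢 q i w x ∈ cobarWeight 𝒢 q i w := by
  induction x using internal_induction (cobarWeight_isInternal 𝒢 q i) with
  | mem v x hx =>
    rw [weightProj_apply hx]
    split_ifs with h
    · exact h ▸ hx
    · exact Submodule.zero_mem _
  | add x y hx hy => rw [map_add]; exact Submodule.add_mem _ hx hy

/-- The part of weight `w` is the eigenspace of the weight derivation for the eigenvalue `w`. -/
theorem mem_cobarWeight_iff {q : Corolla Ξ} {i w : ℤ} {x : (FreeOp P.toColl).obj q i} :
    x ∈ cobarWeight 𝒢 q i w ↔ 𝒢.weightDer.toHom.app (add_zero i) x = (w : K) • x := by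
  refine ⟨weightDer_of_mem_cobarWeight, fun h => ?_⟩
  -- `R` inverts `weightDer - w` on all weights other than `w`. Hence `R ∘ (weightDer - w)` is the
  -- identity minus the projection to weight `w`, and an eigenvector for `w` equals its own
  -- projection.
  let R : (FreeOp P.toColl).obj q i →ₗ[K] (FreeOp P.toColl).obj q i :=
    internalGlue (cobarWeight_isInternal 𝒢 q i) fun v => ((v : K) - w)⁻¹ • LinearMap.id
  have hR : ∀ x, R (𝒢.weightDer.toHom.app (add_zero i) x - (w : K) • x) =
      x - weightProj 𝒢 q i w x := by
    intro x
    induction x using internal_induction (cobarWeight_isInternal 𝒢 q i) with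
    | mem v x hx =>
      rw [weightDer_of_mem_cobarWeight hx, weightProj_apply hx, ← sub_smul, map_smul,
        show R x = ((v : K) - w)⁻¹ • x from internalGlue_apply _ _ hx, smul_smul]
      split_ifs with hvw
      -- On weight `w` itself `R` is multiplication by `0⁻¹`; its value is immaterial, since the
      -- factor `v - w` vanishes.
      · rw [hvw, sub_self, zero_mul, zero_smul, sub_self]
      · rw [mul_inv_cancel₀ (sub_ne_zero.2 (Int.cast_injective.ne hvw)), one_smul, sub_zero]
    | add x y hx hy =>
      have e : ∀ a b c d : (FreeOp P.toColl).obj q i, a + b - (c + d) = (a - c) + (b - d) :=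
        fun _ _ _ _ => add_sub_add_comm _ _ _ _
      rw [map_add, map_add, smul_add, e, e, map_add, hx, hy]
  have h1 := hR x
  rw [h, sub_self, map_zero, eq_comm, sub_eq_zero] at h1
  rw [h1]
  exact weightProj_mem w x

/-- The commutation relation shifts eigenvalues by `-1`, and eigenspaces are weight spaces. -/
theorem cobarD_mem_cobarWeight {q : Corolla Ξ} {i j w : ℤ} (h : i + 1 = j)
    {x : (FreeOp P.toColl).obj q i} (hx : x ∈ cobarWeight 𝒢 q i w) :
    (cobarD P).toHom.app h x ∈ cobarWeight 𝒢 q j (w - 1) := by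
  rw [mem_cobarWeight_iff] at hx ⊢
  rw [(weightDer_commutes_cobarD 𝒢 x).eigen h hx]
  push_cast
  rw [sub_eq_add_neg]

/-- A primitive of an element of weight `w` can be chosen of weight `w + 1`. -/
theorem exists_primitive_mem_cobarWeight {q : Corolla Ξ} {i j w : ℤ} (h : i + 1 = j)
    (y : (FreeOp P.toColl).obj q i)
    (hy : (cobarD P).toHom.app h y ∈ cobarWeight 𝒢 q j w) :
    ∃ y' ∈ cobarWeight 𝒢 q i (w + 1), (cobarD P).toHom.app h y' = (cobarD P).toHom.app h y := by
  -- Since `∂` is homogeneous of weight `-1`, the projections commute with it up to this shift. The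
  -- component of `y` of weight `w + 1` is therefore a primitive as well.
  have key : ∀ y, weightProj 𝒢 q j w ((cobarD P).toHom.app h y) =
      (cobarD P).toHom.app h (weightProj 𝒢 q i (w + 1) y) := by
    intro y
    induction y using internal_induction (cobarWeight_isInternal 𝒢 q i) with
    | mem v y hy =>
      rw [weightProj_apply (cobarD_mem_cobarWeight h hy), weightProj_apply hy]
      by_cases hv : v = w + 1
      · rw [if_pos hv, if_pos (by omega)]
      · rw [if_neg hv, if_neg (by omega), map_zero]
    | add x y hx hy => simp only [map_add, hx, hy]
  refine ⟨_, weightProj_mem (w + 1) y, ?_⟩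
  rw [← key, weightProj_apply hy, if_pos rfl]

end Weight

/-! ### Lifting convolution cocycles to derivations of the cobar construction -/

section Solution

variable {K : Type uK} [Field K] {Ξ : Type uC} {P : PseudoCooperad.{uK, uC, u} K Ξ}
  {𝒢 : Grading P} {H : Operad.{uK, uC, u'} K Ξ} {ρ : OperadHom (FreeOp P.toColl) H}
  {ψ : HomColl P.toColl H.toColl 1} {δ δ' : HomColl P.toColl (FreeOp P.toColl).toColl 1} {m : ℕ}

/-- The derivation of degree `0` with `D ∘ s = δ`. -/
noncomputable def derOf (δ : HomColl P.toColl (FreeOp P.toColl).toColl 1) :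
    Derivation (FreeOp P.toColl) 0 :=
  freeDer δ (zero_add 1)

theorem derOf_susp {q : Corolla Ξ} {p i : ℤ} (h : p + 1 = i) (X : P.obj q p) :
    (derOf δ).toHom.app (add_zero i) ((susp P.toColl).app h X) = δ.app h X := rfl

/-! ### Behaviour of `ρ` with respect to weight -/

/-- A monomial of nonzero weight contains a generator `s X` with `X ∈ G^k P` and `k ≥ 2`, which `ρ`
kills. -/
theorem OperadHom.eq_zero_of_monomial
    (hvan : ∀ (k : ℕ), 2 ≤ k → ∀ (q : Corolla Ξ) (p i : ℤ) (h : p + 1 = i) (X : P.obj q p),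
      X ∈ 𝒢.G k q p → ρ.app ((susp P.toColl).app h X) = 0)
    {q : Corolla Ξ} {i : ℤ} {w : ℕ} {x : (FreeOp P.toColl).obj q i} (hx : IsMonomial 𝒢 w x)
    (hw : w ≠ 0) : ρ.app x = 0 := by
  induction hx with
  | gen h hX => exact hvan _ (by omega) _ _ _ h _ hX
  | unit ξ => exact absurd rfl hw
  | @comp q q₁ q₂ t i j k h v w x y _ _ hx hy =>
    rw [ρ.app_comp]
    by_cases hv : v = 0
    · rw [hy (by omega), map_zero]
    · rw [hx hv, map_zero, LinearMap.zero_apply]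
  | act σ _ hx => rw [ρ.app_act, hx hw, map_zero]

theorem OperadHom.eq_zero_of_pos
    (hvan : ∀ (k : ℕ), 2 ≤ k → ∀ (q : Corolla Ξ) (p i : ℤ) (h : p + 1 = i) (X : P.obj q p),
      X ∈ 𝒢.G k q p → ρ.app ((susp P.toColl).app h X) = 0)
    {q : Corolla Ξ} {i w : ℤ} (hw : 0 < w) {x : (FreeOp P.toColl).obj q i}
    (hx : x ∈ cobarWeight 𝒢 q i w) : ρ.app x = 0 := by
  induction hx using Submodule.span_induction with
  | mem x hx =>
    obtain ⟨v, rfl, hx⟩ := hx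
    exact ρ.eq_zero_of_monomial hvan hx (by omega)
  | zero => rw [map_zero]
  | add x y _ _ hx hy => rw [map_add, hx, hy, add_zero]
  | smul r x _ hx => rw [map_smul, hx, smul_zero]

/-- Elements of `s (G^1 P)` have weight `0`, and weight `0` is closed under the operad operations.
Each operadic expression in the images of these elements thus lifts to weight `0`. -/
theorem OperadHom.exists_weight_zero {q : Corolla Ξ} {i : ℤ} {y : H.obj q i}
    (hy : H.Generated (fun q i => {z | ∃ (p : ℤ) (h : p + 1 = i) (X : P.obj q p),
      X ∈ 𝒢.G 1 q p ∧ ρ.app ((susp P.toColl).app h X) = z}) y) :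
    ∃ x ∈ cobarWeight 𝒢 q i 0, ρ.app x = y := by
  induction hy with
  | base hx =>
    obtain ⟨p, h, X, hX, rfl⟩ := hx
    exact ⟨_, (by simpa using susp_mem_cobarWeight h hX), rfl⟩
  | unit ξ =>
    exact ⟨(FreeOp P.toColl).unit ξ, Submodule.subset_span ⟨0, rfl, .unit ξ⟩, ρ.app_unit ξ⟩
  | comp t h _ _ hx hy =>
    obtain ⟨x, hx, rfl⟩ := hx
    obtain ⟨y, hy, rfl⟩ := hy
    have hxy := comp_mem_cobarWeight t h hx hy
    rw [add_zero] at hxy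
    exact ⟨(FreeOp P.toColl).comp t h x y, hxy, ρ.app_comp t h x y⟩
  | act σ _ hx =>
    obtain ⟨x, hx, rfl⟩ := hx
    exact ⟨(FreeOp P.toColl).act σ x, act_mem_cobarWeight σ hx, ρ.app_act σ x⟩
  | zero => exact ⟨0, Submodule.zero_mem _, map_zero ρ.app⟩
  | add _ _ hx hy =>
    obtain ⟨x, hx, rfl⟩ := hx
    obtain ⟨y, hy, rfl⟩ := hy
    exact ⟨x + y, Submodule.add_mem _ hx hy, map_add ρ.app x y⟩
  | smul c _ hx =>
    obtain ⟨x, hx, rfl⟩ := hx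
    exact ⟨c • x, Submodule.smul_mem _ c hx, map_smul ρ.app c x⟩

/-! ### The obstruction `D (∂ (s X))` -/

/-- By the Leibniz rule in degree 0, `D (s x ∘ s y) = δ x ∘ s y + s x ∘ δ y`, and `ρ` turns `δ` into
`ψ` and `s` into `ρ ∘ s`. The Koszul sign `(-1)^{|x|}` is the same in all three terms because `s`,
`ψ` and `ρ ∘ s` all have degree 1. -/
theorem app_derOf_convTerm
    (hδ : ∀ {q : Corolla Ξ} {p i : ℤ} (h : p + 1 = i) (X : P.obj q p),
      ρ.app (δ.app h X) = ψ.app h X)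
    {q q₁ q₂ : Corolla Ξ} (t : Tree₂ q q₁ q₂) {i j k : ℤ} (h : (i + 1) + (j + 1) = k)
    (z : P.obj q₁ i ⊗[K] P.obj q₂ j) :
    ρ.app ((derOf δ).toHom.app (add_zero k) (convTerm (susp P.toColl) (susp P.toColl) t h z)) =
      convTerm ρ.mc ψ t h z + convTerm ψ ρ.mc t h z := by
  induction z with
  | zero => simp only [map_zero, add_zero]
  | add x y hx hy =>
    simp only [map_add, hx, hy]
    abel
  | tmul x y =>
    rw [convTerm_tmul, convTerm_tmul, convTerm_tmul, map_smul, map_smul, Derivation.leibniz_zero,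
      map_add, ρ.app_comp, ρ.app_comp, derOf_susp, derOf_susp, hδ, hδ, ← smul_add, add_comm]
    rfl

/-- If `ρ ∘ δ = ψ`, then `ρ (D (∂ (s X))) = - ψ (∂ X) - [ρ ∘ s, ψ] X`. -/
theorem app_derOf_cobarD
    (hδ : ∀ {q : Corolla Ξ} {p i : ℤ} (h : p + 1 = i) (X : P.obj q p),
      ρ.app (δ.app h X) = ψ.app h X)
    {q : Corolla Ξ} {p i j : ℤ} (h₁ : p + 1 = i) (h₂ : i + 1 = j) (h : p + 2 = j)
    (X : P.obj q p) :
    ρ.app ((derOf δ).toHom.app (add_zero j)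
      ((cobarD P).toHom.app h₂ ((susp P.toColl).app h₁ X))) =
      -(ψ.app h₂ (P.d.app h₁ X) + (bracket ρ.mc ψ one_add_one_eq_two).app h X) := by
  subst h₁
  have hj : p + (1 + 1) = j := by omega
  have e1 : (cobarD P).toHom.app h₂ ((susp P.toColl).app rfl X) =
    -((susp P.toColl).app h₂ (P.d.app rfl X)) - ∑ᶠ c : TreeIdx q,
      bulletTerm (susp P.toColl) (susp P.toColl) q hj c X := rfl
  have e2 := map_finsum (ρ.app ∘ₗ (derOf δ).toHom.app (add_zero j))
    (bulletTerm_finite (susp P.toColl) (susp P.toColl) q hj X)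
  -- Both arguments are odd, so the bracket is the sum of the two pre-Lie products, which matches
  -- the two Leibniz terms in `e4`.
  have e3 : (bracket ρ.mc ψ one_add_one_eq_two).app h X =
      (∑ᶠ c : TreeIdx q, bulletTerm ρ.mc ψ q hj c X) -
        (-1 : K) ^ ((1 : ℤ) * 1) • ∑ᶠ c : TreeIdx q, bulletTerm ψ ρ.mc q hj c X := rfl
  have e4 : ∀ c : TreeIdx q, (ρ.app ∘ₗ (derOf δ).toHom.app (add_zero j))
      (bulletTerm (susp P.toColl) (susp P.toColl) q hj c X) =
      bulletTerm ρ.mc ψ q hj c X + bulletTerm ψ ρ.mc q hj c X := fun c =>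
    app_derOf_convTerm hδ _ _ _
  rw [finsum_congr e4, finsum_add_distrib (bulletTerm_finite ρ.mc ψ q hj X)
    (bulletTerm_finite ψ ρ.mc q hj X), LinearMap.comp_apply] at e2
  rw [e1, e3, map_sub, map_sub, e2, map_neg, map_neg, derOf_susp, hδ, mul_one, zpow_one, neg_smul,
    one_smul, sub_neg_eq_add, neg_add, sub_eq_add_neg]

/-- The differential of `s (G^k P)` only involves generators from `G^l P` with `l < k`. This is what
makes the construction of `δ` a recursion. -/
theorem derOf_cobarD_congr {k : ℕ}
    (hδ : ∀ l < k, ∀ {q : Corolla Ξ} {p i : ℤ} (h : p + 1 = i), ∀ X ∈ 𝒢.G l q p,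
      δ'.app h X = δ.app h X)
    {q : Corolla Ξ} {p i j : ℤ} (h₁ : p + 1 = i) (h₂ : i + 1 = j) {X : P.obj q p}
    (hX : X ∈ 𝒢.G k q p) :
    (derOf δ').toHom.app (add_zero j) ((cobarD P).toHom.app h₂ ((susp P.toColl).app h₁ X)) =
    (derOf δ).toHom.app (add_zero j) ((cobarD P).toHom.app h₂ ((susp P.toColl).app h₁ X)) := by
  by_cases h0 : X = 0
  · simp only [h0, map_zero]
  obtain ⟨l, rfl⟩ := 𝒢.exists_succ hX h0
  have key := 𝒢.cobarD_susp_eq_zero h₁ h₂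
    ((derOf δ').toHom.app (add_zero j) - (derOf δ).toHom.app (add_zero j))
    (fun Y hY => by
      rw [LinearMap.sub_apply, derOf_susp, derOf_susp, hδ l (by omega) _ _ hY, sub_self])
    (fun t a b a' b' ha hb hab r s _ hr hs Y hY Z hZ => by
      rw [LinearMap.sub_apply, Derivation.leibniz_zero, Derivation.leibniz_zero, derOf_susp,
        derOf_susp, derOf_susp, derOf_susp, hδ r (by omega) _ _ hY, hδ s (by omega) _ _ hZ,
        sub_self]) hX
  rwa [LinearMap.sub_apply, sub_eq_zero] at key

/-- The commutation of `derOf δ'` with the differential on `s (G^k P)` only involves the values of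
`δ'` on `G^l P` for `l ≤ k`. -/
theorem derOf_commutes_of_agree {k : ℕ}
    (hδ : ∀ l < k, ∀ {q : Corolla Ξ} {p i : ℤ} (h : p + 1 = i), ∀ X ∈ 𝒢.G l q p,
      δ'.app h X = δ.app h X)
    {q : Corolla Ξ} {p i : ℤ} (h₁ : p + 1 = i) {X : P.obj q p} (hX : X ∈ 𝒢.G k q p)
    (h : ∀ {j : ℤ} (h₂ : i + 1 = j), (derOf δ).toHom.app (add_zero j)
      ((cobarD P).toHom.app h₂ ((susp P.toColl).app h₁ X)) =
        (cobarD P).toHom.app h₂ (δ'.app h₁ X)) :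
    (derOf δ').Commutes (cobarD P) 0 ((susp P.toColl).app h₁ X) := by
  intro j h₂
  rw [derOf_cobarD_congr hδ h₁ h₂ hX, h h₂, derOf_susp, zero_smul, add_zero]

theorem derOf_commutes_eq {q : Corolla Ξ} {p i j : ℤ} (h₁ : p + 1 = i) (h₂ : i + 1 = j)
    {X : P.obj q p} (h : (derOf δ).Commutes (cobarD P) 0 ((susp P.toColl).app h₁ X)) :
    (derOf δ).toHom.app (add_zero j) ((cobarD P).toHom.app h₂ ((susp P.toColl).app h₁ X)) =
      (cobarD P).toHom.app h₂ (δ.app h₁ X) := by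
  rw [h j h₂, derOf_susp, zero_smul, add_zero]

/-- The commutator of `∂` and `D` vanishes on all parts of `∂ (s X)`, which come from degrees at
most `n`. So `∂ D ∂ (s X) = D ∂ ∂ (s X) = 0`, although nothing is known yet about `D` on `s X`
itself. -/
theorem cobarD_derOf_cobarD [CharZero K] {n : ℕ}
    (hδ : ∀ l ≤ n, ∀ {q : Corolla Ξ} {p i : ℤ} (h : p + 1 = i), ∀ X ∈ 𝒢.G l q p,
      (derOf δ).Commutes (cobarD P) 0 ((susp P.toColl).app h X))
    {q : Corolla Ξ} {p i j k : ℤ} (h₁ : p + 1 = i) (h₂ : i + 1 = j) (h₃ : j + 1 = k)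
    {X : P.obj q p} (hX : X ∈ 𝒢.G (n + 1) q p) :
    (cobarD P).toHom.app h₃ ((derOf δ).toHom.app (add_zero j)
      ((cobarD P).toHom.app h₂ ((susp P.toColl).app h₁ X))) = 0 := by
  -- The linear map is the commutator `∂ D - D ∂`; it is the map to which `cobarD_susp_eq_zero` is
  -- applied below.
  have van : ∀ {x : (FreeOp P.toColl).obj q j}, (derOf δ).Commutes (cobarD P) 0 x →
      ((cobarD P).toHom.app h₃ ∘ₗ (derOf δ).toHom.app (add_zero j) -
        (derOf δ).toHom.app (add_zero k) ∘ₗ (cobarD P).toHom.app h₃ :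
          (FreeOp P.toColl).obj q j →ₗ[K] (FreeOp P.toColl).obj q k) x = 0 := fun hx => by
    rw [LinearMap.sub_apply, LinearMap.comp_apply, LinearMap.comp_apply, hx k h₃, zero_smul,
      add_zero, sub_self]
  have key := 𝒢.cobarD_susp_eq_zero h₁ h₂ _ (fun Y hY => van (hδ n le_rfl h₂ Y hY))
    (fun t a b a' b' ha hb hab r s _ hr hs Y hY Z hZ =>
      van ((hδ r hr ha Y hY).comp t hab (hδ s hs hb Z hZ))) hX
  rwa [LinearMap.sub_apply, LinearMap.comp_apply, LinearMap.comp_apply, cobarD_sq, map_zero,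
    sub_zero] at key

/-- On a generator the eigenvalue goes from `k - 1` to `k - m`, a shift by `1 - m`; a derivation
then shifts by the same amount everywhere. -/
theorem weightDer_commutes_derOf
    (hδ : ∀ (k : ℕ) {q : Corolla Ξ} {p i : ℤ} (h : p + 1 = i), ∀ X ∈ 𝒢.G k q p,
      δ.app h X ∈ cobarWeight 𝒢 q i ((k : ℤ) - m)) {q : Corolla Ξ} {i : ℤ}
    (x : (FreeOp P.toColl).obj q i) : 𝒢.weightDer.Commutes (derOf δ) (1 - m : K) x := by
  refine .of_gen (fun {q p i} h X => ?_) x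
  induction X using 𝒢.induction with
  | add X Y hX hY => rw [map_add]; exact hX.add hY
  | mem k X hX =>
    intro j hj
    obtain rfl : i = j := by omega
    rw [Grading.weightDer_susp h hX, map_smul, derOf_susp,
      weightDer_of_mem_cobarWeight (hδ k h X hX), ← add_smul]
    congr 1
    push_cast
    ring

/-- The eigenvalue `k - 1` of `s X` is shifted by `-1` through the differential and by `1 - m`
through the derivation. -/
theorem derOf_cobarD_mem [CharZero K]
    (hδ : ∀ (k : ℕ) {q : Corolla Ξ} {p i : ℤ} (h : p + 1 = i), ∀ X ∈ 𝒢.G k q p,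
      δ.app h X ∈ cobarWeight 𝒢 q i ((k : ℤ) - m)) {k : ℕ} {q : Corolla Ξ} {p i j : ℤ}
    (h₁ : p + 1 = i) (h₂ : i + 1 = j) {X : P.obj q p} (hX : X ∈ 𝒢.G k q p) :
    (derOf δ).toHom.app (add_zero j) ((cobarD P).toHom.app h₂ ((susp P.toColl).app h₁ X)) ∈
      cobarWeight 𝒢 q j ((k : ℤ) - m - 1) := by
  rw [mem_cobarWeight_iff, (weightDer_commutes_derOf hδ _).eigen (add_zero j)
    ((weightDer_commutes_cobarD 𝒢 _).eigen h₂ (Grading.weightDer_susp h₁ hX))]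
  congr 1
  push_cast
  ring

/-! ### The recursion over the grading -/

variable (𝒢 ρ ψ m) in
/-- Lifts `δ` of `ψ` of weight `1 - m` such that the derivation extending `δ` commutes with the
differential on `s (G^k P)` for all `k ≤ n`. -/
structure IsPartialLift (n : ℕ) (δ : HomColl P.toColl (FreeOp P.toColl).toColl 1) : Prop where
  app_eq : ∀ {q : Corolla Ξ} {p i : ℤ} (h : p + 1 = i) (X : P.obj q p),
    ρ.app (δ.app h X) = ψ.app h X
  weight : ∀ (k : ℕ) {q : Corolla Ξ} {p i : ℤ} (h : p + 1 = i), ∀ X ∈ 𝒢.G k q p,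
    δ.app h X ∈ cobarWeight 𝒢 q i ((k : ℤ) - m)
  commutes : ∀ k ≤ n, ∀ {q : Corolla Ξ} {p i : ℤ} (h : p + 1 = i), ∀ X ∈ 𝒢.G k q p,
    (derOf δ).Commutes (cobarD P) 0 ((susp P.toColl).app h X)

/-- The lift of `ψ` to weight `0` is used on `G^m P`, and `δ` is zero on the other pieces. All
conditions for `k ≤ m` then hold because the equation lives in negative weight; the cocycle
condition on `ψ` plays no role at this stage. -/
theorem exists_partialLift [CharZero K]
    (hsurj : ∀ {q : Corolla Ξ} {i : ℤ} (y : H.obj q i), ∃ x ∈ cobarWeight 𝒢 q i 0, ρ.app x = y)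
    (hψ : ∀ (k : ℕ), k ≠ m → ∀ (q : Corolla Ξ) (p i : ℤ) (h : p + 1 = i) (X : P.obj q p),
      X ∈ 𝒢.G k q p → ψ.app h X = 0) :
    ∃ δ, IsPartialLift 𝒢 ρ ψ m m δ := by
  -- The morphism `ρ` seen as a homomorphism of collections of degree 0, the form in which the
  -- lifting lemma takes it.
  let ρ' : HomColl (FreeOp P.toColl).toColl H.toColl 0 :=
    { app := fun {q i j} h => (show i = j by omega) ▸ ρ.app
      app_act := by
        rintro q q' i j h σ x
        obtain rfl : i = j := by omega
        exact ρ.app_act σ x }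
  obtain ⟨g, hg⟩ := exists_homColl_lift ψ ρ' (add_zero 1) (fun q i => ⊤) (fun _ _ _ _ => trivial)
    (fun q i => cobarWeight 𝒢 q i 0) (fun σ _ _ => act_mem_cobarWeight σ) (by
      intro q i j k _ hj hk x _
      obtain rfl : j = k := by omega
      exact hsurj _)
  have hgw : ∀ {q : Corolla Ξ} {p i : ℤ} (h : p + 1 = i) (X : P.obj q p),
      g.app h X ∈ cobarWeight 𝒢 q i 0 := fun h X => (hg h (add_zero _) h X trivial).1
  have hgρ : ∀ {q : Corolla Ξ} {p i : ℤ} (h : p + 1 = i) (X : P.obj q p),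
      ρ.app (g.app h X) = ψ.app h X := fun h X => (hg h (add_zero _) h X trivial).2
  let δ : HomColl P.toColl (FreeOp P.toColl).toColl 1 := 𝒢.glue fun k =>
    if k = m then g else ⟨fun _ => 0, fun _ _ _ => by simp⟩
  have hδ : ∀ {q : Corolla Ξ} {p i : ℤ} (h : p + 1 = i) (X : P.obj q p), X ∈ 𝒢.G m q p →
      δ.app h X = g.app h X := fun h X hX => by
    rw [𝒢.glue_apply _ h hX, if_pos rfl]
  have hδ' : ∀ {k : ℕ} {q : Corolla Ξ} {p i : ℤ} (h : p + 1 = i) (X : P.obj q p), k ≠ m →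
      X ∈ 𝒢.G k q p → δ.app h X = 0 := fun h X hk hX => by
    rw [𝒢.glue_apply _ h hX, if_neg hk, LinearMap.zero_apply]
  have hw : ∀ (k : ℕ) {q : Corolla Ξ} {p i : ℤ} (h : p + 1 = i), ∀ X ∈ 𝒢.G k q p,
      δ.app h X ∈ cobarWeight 𝒢 q i ((k : ℤ) - m) := by
    intro k q p i h X hX
    by_cases hk : k = m
    · subst hk
      rw [hδ h X hX, sub_self]
      exact hgw h X
    · rw [hδ' h X hk hX]
      exact Submodule.zero_mem _
  refine ⟨δ, ?_, hw, ?_⟩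
  · intro q p i h X
    induction X using 𝒢.induction with
    | add X Y hX hY => simp only [map_add, hX, hY]
    | mem k X hX =>
      by_cases hk : k = m
      · subst hk
        rw [hδ h X hX, hgρ]
      · rw [hδ' h X hk hX, hψ k hk q p i h X hX, map_zero]
  · intro k hk q p i h X hX
    -- Here `δ` is compared with itself. What remains is an equation in weight `k - m - 1 < 0`,
    -- where everything is zero.
    refine derOf_commutes_of_agree (fun _ _ _ _ _ _ _ _ => rfl) h hX fun {j} h₂ => ?_
    have h1 := derOf_cobarD_mem hw h h₂ hX
    have h2 := cobarD_mem_cobarWeight h₂ (hw k h X hX)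
    rw [cobarWeight_of_neg (by omega), Submodule.mem_bot] at h1 h2
    rw [h1, h2]

/-- The values of `δ` on `G^{n+1} P` are replaced by primitives of `D (∂ (s X))`. Lower values are
left alone, so the conditions already achieved survive, and the successive corrections stabilise on
each `G^k P`. -/
theorem IsPartialLift.exists_succ [CharZero K] {n : ℕ} (hn : m ≤ n)
    (hvan : ∀ (k : ℕ), 2 ≤ k → ∀ (q : Corolla Ξ) (p i : ℤ) (h : p + 1 = i) (X : P.obj q p),
      X ∈ 𝒢.G k q p → ρ.app ((susp P.toColl).app h X) = 0)
    (hex : ∀ {q : Corolla Ξ} {i j k : ℤ} (h : i + 1 = j) (h' : j + 1 = k)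
      (x : (FreeOp P.toColl).obj q j), (cobarD P).toHom.app h' x = 0 → ρ.app x = 0 →
        ∃ y, (cobarD P).toHom.app h y = x)
    (hψ : ∀ (k : ℕ), k ≠ m → ∀ (q : Corolla Ξ) (p i : ℤ) (h : p + 1 = i) (X : P.obj q p),
      X ∈ 𝒢.G k q p → ψ.app h X = 0)
    (hcocycle : ∀ (q : Corolla Ξ) (p i j : ℤ) (h₁ : p + 1 = i) (h₂ : i + 1 = j)
      (h : p + 2 = j) (X : P.obj q p),
      ψ.app h₂ (P.d.app h₁ X) + (bracket ρ.mc ψ one_add_one_eq_two).app h X = 0)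
    (hδ : IsPartialLift 𝒢 ρ ψ m n δ) :
    ∃ δ', IsPartialLift 𝒢 ρ ψ m (n + 1) δ' ∧ ∀ k ≤ n, ∀ {q : Corolla Ξ} {p i : ℤ}
      (h : p + 1 = i), ∀ X ∈ 𝒢.G k q p, δ'.app h X = δ.app h X := by
  -- `f = D ∘ ∂ ∘ s` is the map to be lifted through `∂`, equivariantly and with prescribed weight.
  let f : HomColl P.toColl (FreeOp P.toColl).toColl 2 :=
    { app := fun {q i j} h => (derOf δ).toHom.app (add_zero j) ∘ₗ
        (cobarD P).toHom.app (show (i + 1) + 1 = j by omega) ∘ₗ (susp P.toColl).app rfl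
      app_act := fun h σ x => by simp only [LinearMap.comp_apply, HomColl.app_act] }
  obtain ⟨g, hg⟩ := exists_homColl_lift f (cobarD P).toHom one_add_one_eq_two
    (𝒢.G (n + 1)) (fun σ _ _ => 𝒢.act_mem σ)
    (fun q i => cobarWeight 𝒢 q i ((n : ℤ) - m + 1)) (fun σ _ _ => act_mem_cobarWeight σ) (by
      rintro q i j k rfl hj hk X hX
      -- The obstruction is closed, and `ρ` kills it by the cocycle condition on `ψ`; hence it is
      -- exact.
      obtain ⟨y, hy⟩ := hex hj rfl _ (cobarD_derOf_cobarD hδ.commutes rfl hj rfl hX) (by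
        rw [app_derOf_cobarD hδ.app_eq rfl hj hk, hcocycle, neg_zero])
      -- The obstruction has weight `(n + 1) - m - 1 = n - m`, so a primitive exists in weight `n -
      -- m + 1`, the weight prescribed on `G^{n+1} P`.
      have hz := derOf_cobarD_mem hδ.weight rfl hj hX
      rw [← hy, show ((n + 1 : ℕ) : ℤ) - m - 1 = (n : ℤ) - m by push_cast; ring] at hz
      obtain ⟨y', hy', e⟩ := exists_primitive_mem_cobarWeight hj y hz
      exact ⟨y', hy', e.trans hy⟩)
  let δ' : HomColl P.toColl (FreeOp P.toColl).toColl 1 := 𝒢.glue fun k =>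
    if k = n + 1 then g else δ
  have hδ₁ : ∀ {q : Corolla Ξ} {p i : ℤ} (h : p + 1 = i) (X : P.obj q p), X ∈ 𝒢.G (n + 1) q p →
      δ'.app h X = g.app h X := fun h X hX => by
    rw [𝒢.glue_apply _ h hX, if_pos rfl]
  have hδ₂ : ∀ {k : ℕ} {q : Corolla Ξ} {p i : ℤ} (h : p + 1 = i) (X : P.obj q p), k ≠ n + 1 →
      X ∈ 𝒢.G k q p → δ'.app h X = δ.app h X := fun h X hk hX => by
    rw [𝒢.glue_apply _ h hX, if_neg hk]
  have hgw : ∀ {q : Corolla Ξ} {p i : ℤ} (h : p + 1 = i) (X : P.obj q p), X ∈ 𝒢.G (n + 1) q p →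
      g.app h X ∈ cobarWeight 𝒢 q i ((n : ℤ) - m + 1) := fun {q p i} h X hX =>
    (hg h rfl (show p + 2 = i + 1 by omega) X hX).1
  refine ⟨δ', ⟨?_, ?_, ?_⟩, fun k hk _ _ _ h X hX => hδ₂ h X (by omega) hX⟩
  · intro q p i h X
    induction X using 𝒢.induction with
    | add X Y hX hY => simp only [map_add, hX, hY]
    | mem k X hX =>
      by_cases hk : k = n + 1
      · subst hk
        -- Both sides vanish: `ψ` because `n + 1 ≠ m`, and `ρ ∘ g` because `g` has weight `n - m + 1
        -- > 0`. This uses `m ≤ n`.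
        rw [hδ₁ h X hX, hψ _ (by omega) q p i h X hX, ρ.eq_zero_of_pos hvan (by omega) (hgw h X hX)]
      · rw [hδ₂ h X hk hX, hδ.app_eq]
  · intro k q p i h X hX
    by_cases hk : k = n + 1
    · subst hk
      rw [hδ₁ h X hX, show ((n + 1 : ℕ) : ℤ) - m = (n : ℤ) - m + 1 by push_cast; ring]
      exact hgw h X hX
    · rw [hδ₂ h X hk hX]
      exact hδ.weight k h X hX
  · intro k hk q p i h X hX
    -- In degrees below `k ≤ n + 1` the old and new homomorphisms agree, so `D (∂ (s X))` may be
    -- computed with the old one.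
    refine derOf_commutes_of_agree (fun l hl _ _ _ h Y hY => hδ₂ h Y (by omega) hY) h hX
      fun {j} h₂ => ?_
    by_cases hk' : k = n + 1
    · subst hk' h
      rw [hδ₁ rfl X hX]
      exact (hg rfl h₂ (show p + 2 = j by omega) X hX).2.symm
    · rw [hδ₂ h X hk' hX]
      exact derOf_commutes_eq h h₂ (hδ.commutes k (by omega) h X hX)

/-- A cocycle `ψ` of the convolution Lie algebra which is concentrated on `G^m P` lifts to a
derivation of weight `1 - m` which commutes with the cobar differential. -/
theorem exists_derivation_lift [CharZero K]
    (hsurj : ∀ {q : Corolla Ξ} {i : ℤ} (y : H.obj q i), ∃ x ∈ cobarWeight 𝒢 q i 0, ρ.app x = y)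
    (hvan : ∀ (k : ℕ), 2 ≤ k → ∀ (q : Corolla Ξ) (p i : ℤ) (h : p + 1 = i) (X : P.obj q p),
      X ∈ 𝒢.G k q p → ρ.app ((susp P.toColl).app h X) = 0)
    (hex : ∀ {q : Corolla Ξ} {i j k : ℤ} (h : i + 1 = j) (h' : j + 1 = k)
      (x : (FreeOp P.toColl).obj q j), (cobarD P).toHom.app h' x = 0 → ρ.app x = 0 →
        ∃ y, (cobarD P).toHom.app h y = x)
    (hψ : ∀ (k : ℕ), k ≠ m → ∀ (q : Corolla Ξ) (p i : ℤ) (h : p + 1 = i) (X : P.obj q p),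
      X ∈ 𝒢.G k q p → ψ.app h X = 0)
    (hcocycle : ∀ (q : Corolla Ξ) (p i j : ℤ) (h₁ : p + 1 = i) (h₂ : i + 1 = j)
      (h : p + 2 = j) (X : P.obj q p),
      ψ.app h₂ (P.d.app h₁ X) + (bracket ρ.mc ψ one_add_one_eq_two).app h X = 0) :
    ∃ δ : HomColl P.toColl (FreeOp P.toColl).toColl 1,
      (∀ {q : Corolla Ξ} {i : ℤ} (x : (FreeOp P.toColl).obj q i),
        (derOf δ).Commutes (cobarD P) 0 x) ∧
      (∀ (k : ℕ) {q : Corolla Ξ} {p i : ℤ} (h : p + 1 = i), ∀ X ∈ 𝒢.G k q p,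
        δ.app h X ∈ cobarWeight 𝒢 q i ((k : ℤ) - m)) ∧
      ∀ {q : Corolla Ξ} {p i : ℤ} (h : p + 1 = i) (X : P.obj q p),
        ρ.app (δ.app h X) = ψ.app h X := by
  obtain ⟨δ₀, h₀⟩ := exists_partialLift (ρ := ρ) hsurj hψ
  have step : ∀ (n : ℕ) (δ : {δ // IsPartialLift 𝒢 ρ ψ m (m + n) δ}),
      ∃ δ' : {δ // IsPartialLift 𝒢 ρ ψ m (m + (n + 1)) δ}, ∀ k ≤ m + n, ∀ {q : Corolla Ξ} {p i : ℤ}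
      (h : p + 1 = i), ∀ X ∈ 𝒢.G k q p, δ'.1.app h X = δ.1.app h X := fun n δ => by
    obtain ⟨δ', h1, h2⟩ := δ.2.exists_succ (Nat.le_add_right m n) hvan hex hψ hcocycle
    exact ⟨⟨δ', h1⟩, h2⟩
  choose next hnext using step
  -- The stage `F n` satisfies the commutation condition up to degree `m + n`; the base stage `F 0`
  -- is the lift of `ψ` on `G^m P`.
  let F : ∀ n : ℕ, {δ // IsPartialLift 𝒢 ρ ψ m (m + n) δ} := fun n =>
    Nat.rec ⟨δ₀, h₀⟩ (fun n δ => next n δ) n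
  have hF : ∀ {k n : ℕ} (_ : k ≤ n) {q : Corolla Ξ} {p i : ℤ} (h : p + 1 = i),
      ∀ X ∈ 𝒢.G k q p, (F n).1.app h X = (F k).1.app h X := by
    intro k n hkn q p i h X hX
    induction n, hkn using Nat.le_induction with
    | base => rfl
    | succ n hn ih => rw [← ih]; exact hnext n (F n) k (by omega) h X hX
  -- On `G^k P` the sequence is constant from stage `k` on, and `F k` already commutes with `∂`
  -- there, since `k ≤ m + k`.
  let δ := 𝒢.glue fun k => (F k).1
  have hδ : ∀ {k : ℕ} {q : Corolla Ξ} {p i : ℤ} (h : p + 1 = i), ∀ X ∈ 𝒢.G k q p,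
      δ.app h X = (F k).1.app h X := fun h X hX => 𝒢.glue_apply _ h hX
  refine ⟨δ, fun x => .of_gen (fun {q p i} h X => ?_) x, ?_, ?_⟩
  · induction X using 𝒢.induction with
    | add X Y hX hY => rw [map_add]; exact hX.add hY
    | mem k X hX =>
      -- For `l < k` the limit equals `F l` on `G^l P`, hence also `F k`, so the equation on `G^k P`
      -- is inherited from `F k`.
      refine derOf_commutes_of_agree (δ := (F k).1)
        (fun l hl _ _ _ h Y hY => (hδ h Y hY).trans (hF hl.le h Y hY).symm) h hX fun {j} h₂ => ?_
      rw [hδ h X hX]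
      exact derOf_commutes_eq h h₂ ((F k).2.commutes k (by omega) h X hX)
  · intro k q p i h X hX
    rw [hδ h X hX]
    exact (F k).2.weight k h X hX
  · intro q p i h X
    induction X using 𝒢.induction with
    | add X Y hX hY => simp only [map_add, hX, hY]
    | mem k X hX => rw [hδ h X hX, (F k).2.app_eq]

end Solution

/-! ### Exactness on the kernel of `ρ`, and the theorem -/

/-- A quasi-isomorphism to an operad with zero differential is exact on its kernel. -/
theorem DGHom.IsQuasiIso.exists_primitive {K : Type uK} [Field K] {Ξ : Type uC}
    {C : DGOperad.{uK, uC, u} K Ξ} {C' : DGOperad.{uK, uC, u'} K Ξ} {ρ : DGHom C C'}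
    (hρ : ρ.IsQuasiIso) {q : Corolla Ξ} {i j k : ℤ} (h : i + 1 = j) (h' : j + 1 = k)
    (x : C.obj q j) (hx : C.d.toHom.app h' x = 0) (hx' : ρ.app x = 0) :
    ∃ y, C.d.toHom.app h y = x := by
  have hc : x ∈ C.cocycles q j := (DGOperad.mem_cocycles h' x).2 hx
  -- The image of the class of `x` is represented by `ρ x = 0`. Injectivity on cohomology is the
  -- only part of the quasi-isomorphism property that is used.
  have h1 : ρ.cohMap q j (DGOperad.cls ⟨x, hc⟩) = 0 := by
    refine DGOperad.cls_eq_zero.2 ?_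
    change ρ.app x ∈ _
    rw [hx']
    exact Submodule.zero_mem _
  have h2 := (hρ q j).1 (h1.trans (map_zero (ρ.cohMap q j)).symm)
  exact (DGOperad.mem_coboundaries h x).1 (DGOperad.cls_eq_zero.1 h2)

end Opd

theorem mainTheorem12 {K : Type*} [Field K] [CharZero K] {Ξ : Type*}
    (O : Opd.DGOperad K Ξ) (P : Opd.PseudoCooperad K Ξ)
    (ρ : Opd.DGHom (Opd.cobar P) O.cohomology.zeroDG) (hρ : ρ.IsQuasiIso)
    (𝒢 : Opd.Grading P)
    (hP : ∀ k q i, FiniteDimensional K (𝒢.G k q i))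
    (hO : ∀ q i, FiniteDimensional K (O.obj q i))
    (hgen : ∀ (q : Opd.Corolla Ξ) (i : ℤ) (y : O.cohomology.obj q i),
      O.cohomology.Generated (fun q i => {z | ∃ (p : ℤ) (h : p + 1 = i) (X : P.obj q p),
        X ∈ 𝒢.G 1 q p ∧ ρ.app ((Opd.susp P.toColl).app h X) = z}) y)
    (hvan : ∀ (k : ℕ), 2 ≤ k → ∀ (q : Opd.Corolla Ξ) (p i : ℤ) (h : p + 1 = i) (X : P.obj q p),
      X ∈ 𝒢.G k q p → ρ.app ((Opd.susp P.toColl).app h X) = 0)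
    (m : ℕ) (hm : 2 ≤ m)
    (ψ : Opd.HomColl P.toColl O.cohomology.toColl 1)
    (hψ : ∀ (k : ℕ), k ≠ m → ∀ (q : Opd.Corolla Ξ) (p i : ℤ) (h : p + 1 = i) (X : P.obj q p),
      X ∈ 𝒢.G k q p → ψ.app h X = 0)
    (hcocycle : ∀ (q : Opd.Corolla Ξ) (p i j : ℤ) (h₁ : p + 1 = i) (h₂ : i + 1 = j)
      (h : p + 2 = j) (X : P.obj q p),
      ψ.app h₂ (P.d.app h₁ X) + (Opd.bracket (E := O.cohomology) ρ.mc ψ one_add_one_eq_two).app h X = 0) :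
    ∃ D : Opd.Derivation (Opd.cobar P).toOperad 0,
      D.IsClosed ∧ D.HasWeight 𝒢 (1 - m) ∧
      (∀ (q : Opd.Corolla Ξ) (p i : ℤ) (h : p + 1 = i) (X : P.obj q p),
        ρ.app (D.toHom.app (add_zero i) ((Opd.susp P.toColl).app h X)) = ψ.app h X) ∧
      (∀ (k : ℕ), k < m → ∀ (q : Opd.Corolla Ξ) (p i : ℤ) (h : p + 1 = i) (X : P.obj q p),
        X ∈ 𝒢.G k q p → D.toHom.app (add_zero i) ((Opd.susp P.toColl).app h X) = 0) := by
  obtain ⟨δ, h₁, h₂, h₃⟩ := Opd.exists_derivation_lift (ρ := ρ.toOperadHom)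
    (fun {q i} y => Opd.OperadHom.exists_weight_zero (𝒢 := 𝒢) (hgen q i y)) hvan
    (fun h h' x => hρ.exists_primitive h h' x) hψ hcocycle
  refine ⟨Opd.derOf δ, ?_, ?_, fun q p i h X => h₃ h X, ?_⟩
  · intro q i i' j j' e₁ e₂ e₃ e₄ x
    -- In degree 0 the source and target degrees coincide and the sign in `IsClosed` is trivial.
    obtain rfl : i = j := by omega
    obtain rfl : i' = j' := by omega
    have := h₁ x i' e₃
    rw [zero_smul, add_zero] at this
    rw [zpow_zero, one_smul]
    exact this.symm
  · intro k _ q p i j h h' X hX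
    obtain rfl : i = j := by omega
    have := h₂ k h X hX
    -- The lift has weight `k - m`, which is the weight `k - 1` of `s X` shifted by `1 - m`.
    rwa [show (k : ℤ) - m = (k : ℤ) - 1 + (1 - m) by ring] at this
  · intro k hk q p i h X hX
    have := h₂ k h X hX
    -- The weight `k - m` is negative for `k < m`, so the vanishing follows from the weight
    -- condition alone.
    rwa [Opd.cobarWeight_of_neg (by omega), Submodule.mem_bot] at this
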